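/- Let $d\ge 3$ be an integer and consider on $\mathbb R^d$ the pressureless Euler / incompressible Navier--Stokes system $$\partial_t\rho+\nabla\cdot(\rho u)=0,\qquad \partial_t(\rho u)+\nabla\cdot(\rho u\otimes u)=-\rho(u-v),$$ $$\partial_t v+(v\cdot\nabla)v+\nabla p-\Delta v=\rho(u-v),\qquad \nabla\cdot v=0.$$ For $T>0$, a classical solution on $[0,T]$ is a triple $(\rho,u,v)$ with $\rho\ge 0$ which, for some integer $s\ge 2\lfloor d/2\rfloor+1$, belongs to $C([0,T];H^s(\mathbb R^d))\times C([0,T];H^{s+2}(\mathbb R^d))\times C([0,T];H^{s+1}(\mathbb R^d))$, such that $\rho,u,v$ are $C^1$ on $(0,T)\times\mathbb R^d$, $v(\cdot,t)$ is $C^2$, and the four equations hold pointwise for $t\in(0,T)$ with some pressure $p$ such that $p(\cdot,t)$ is $C^1$. Write $\rho_0=\rho(\cdot,0)$, $v_0=v(\cdot,0)$, and $$E(t)=\int_{\mathbb R^d}\rho|u|^2\,dx+\frac12\int_{\mathbb R^d}|v|^2\,dx,\qquad D(t)=\int_{\mathbb R^d}|\nabla v|^2\,dx+\int_{\mathbb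 R^d}\rho|u-v|^2\,dx .$$ For every $\alpha\in(0,d/2)$ and all bounds $K,M,R$ there is a constant $C>0$, depending only on $d,\alpha,K,M,R$ (in particular independent of $T$, of $s$ and of the solution), such that for every $T>0$ and every classical solution $(\rho,u,v)$ on $[0,T]$ with $\rho_0,v_0\in L^1(\mathbb R^d)$, $$\|\rho\|_{L^\infty(\mathbb R^d\times(0,T))}\le K,\qquad \|\rho_0\|_{L^1}\le M,\qquad E(0)+\|v_0\|_{L^1}^2\le R,$$ the function $\tau\mapsto(1+\tau)^\alpha D(\tau)$ is integrable on $[0,T]$ and $$E(t)(1+t)^\alpha+\int_0^t(1+\tau)^\alpha D(\tau)\,d\tau\le C\big(E(0)+\|v_0\|_{L^1}^2\big)\qquad\text{for all }t\in[0,T].$$ -/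

import Mathlib

open MeasureTheory Set
open scoped ENNReal NNReal SchwartzMap

/-- Euclidean space `ℝᵈ`. -/
abbrev Rd (d : ℕ) : Type := EuclideanSpace ℝ (Fin d)

/-- The partial derivative `∂ⱼ f (x)`. -/
noncomputable def pderiv {d : ℕ} {F : Type*} [NormedAddCommGroup F] [NormedSpace ℝ F]
    (j : Fin d) (f : Rd d → F) (x : Rd d) : F :=
  fderiv ℝ f x (EuclideanSpace.single j 1)

/-- The divergence `∇ · w = ∑ⱼ ∂ⱼ wⱼ`. -/
noncomputable def divergence {d : ℕ} (w : Rd d → Rd d) (x : Rd d) : ℝ :=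
  ∑ j, pderiv j (fun y => w y j) x

/-- The vector field `∇ · (r w ⊗ w) = ∑ⱼ ∂ⱼ (r wⱼ w)`. -/
noncomputable def divTensor {d : ℕ} (r : Rd d → ℝ) (w : Rd d → Rd d) (x : Rd d) : Rd d :=
  ∑ j, pderiv j (fun y => (r y * w y j) • w y) x

/-- The convective term `(w · ∇) w = ∑ⱼ wⱼ ∂ⱼ w`. -/
noncomputable def convection {d : ℕ} (w : Rd d → Rd d) (x : Rd d) : Rd d :=
  ∑ j, w x j • pderiv j w x

/-- `f ∈ C([0,T]; Hˢ(ℝᵈ))` for a scalar function `f = f(t, x)`: each `f(t)` is in `L²`, its Bessel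
potential of order `s` (the Fourier multiplier `(1 + |ξ|²)^(s/2)`) is an `L²` function `G(t)`, and
`G` is continuous into `L²`. Since `‖f(t)‖_{Hˢ} = ‖G(t)‖_{L²}`, the latter is continuity in
the `Hˢ` norm. -/
def ContinuousInSobolev {d : ℕ} (s T : ℝ) (f : ℝ → Rd d → ℝ) : Prop :=
  ∃ G : ℝ → Lp ℂ 2 (volume : Measure (Rd d)),
    ContinuousOn G (Icc 0 T) ∧
    ∀ t ∈ Icc 0 T, ∃ hf : MemLp (fun x => (f t x : ℂ)) 2 volume,
      TemperedDistribution.besselPotential (Rd d) ℂ s (hf.toLp _ : 𝓢'(Rd d, ℂ))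
        = (G t : 𝓢'(Rd d, ℂ))

/-- `(ρ, u, v)`, with pressure `p`, is a classical solution on `[0,T]`, of Sobolev regularity
`C([0,T]; Hˢ) × C([0,T]; Hˢ⁺²) × C([0,T]; Hˢ⁺¹)`, of the pressureless Euler / incompressible
Navier–Stokes system coupled through the drag force, with viscosity `1`. -/
structure IsClassicalSolution (d s : ℕ) (T : ℝ) (ρ : ℝ → Rd d → ℝ) (u v : ℝ → Rd d → Rd d)
    (p : ℝ → Rd d → ℝ) : Prop where
  sobolev_density : ContinuousInSobolev (s : ℝ) T ρ
  sobolev_u : ∀ i, ContinuousInSobolev ((s : ℝ) + 2) T (fun t x => u t x i)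
  sobolev_v : ∀ i, ContinuousInSobolev ((s : ℝ) + 1) T (fun t x => v t x i)
  contDiff_density : ContDiffOn ℝ 1 (fun z : ℝ × Rd d => ρ z.1 z.2) (Ioo 0 T ×ˢ univ)
  contDiff_u : ContDiffOn ℝ 1 (fun z : ℝ × Rd d => u z.1 z.2) (Ioo 0 T ×ˢ univ)
  contDiff_v : ContDiffOn ℝ 1 (fun z : ℝ × Rd d => v z.1 z.2) (Ioo 0 T ×ˢ univ)
  contDiff_v_space : ∀ t ∈ Ioo 0 T, ContDiff ℝ 2 (v t)
  contDiff_pressure : ∀ t ∈ Ioo 0 T, ContDiff ℝ 1 (p t)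
  density_nonneg : ∀ t ∈ Icc 0 T, ∀ x, 0 ≤ ρ t x
  continuity_equation : ∀ t ∈ Ioo 0 T, ∀ x,
    deriv (fun τ => ρ τ x) t + divergence (fun y => ρ t y • u t y) x = 0
  euler_momentum : ∀ t ∈ Ioo 0 T, ∀ x,
    deriv (fun τ => ρ τ x • u τ x) t + divTensor (ρ t) (u t) x = -(ρ t x • (u t x - v t x))
  navier_stokes : ∀ t ∈ Ioo 0 T, ∀ x,
    deriv (fun τ => v τ x) t + convection (v t) x + gradient (p t) x - Laplacian.laplacian (v t) x
      = ρ t x • (u t x - v t x)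
  incompressible : ∀ t ∈ Ioo 0 T, ∀ x, divergence (v t) x = 0

/-- The energy `E(t) = ∫ ρ|u|² dx + ½ ∫ |v|² dx`. -/
noncomputable def energy {d : ℕ} (ρ : ℝ → Rd d → ℝ) (u v : ℝ → Rd d → Rd d) (t : ℝ) : ℝ :=
  (∫ x, ρ t x * ‖u t x‖ ^ 2) + 1 / 2 * ∫ x, ‖v t x‖ ^ 2

/-- The dissipation `D(t) = ∫ |∇v|² dx + ∫ ρ|u - v|² dx`, where `|∇v|² = ∑ⱼ |∂ⱼ v|²`. -/
noncomputable def dissipation {d : ℕ} (ρ : ℝ → Rd d → ℝ) (u v : ℝ → Rd d → Rd d) (t : ℝ) : ℝ :=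
  (∫ x, ∑ j, ‖pderiv j (v t) x‖ ^ 2) + ∫ x, ρ t x * ‖u t x - v t x‖ ^ 2

/-!
The proof is Fourier splitting, run on the coupled system. Put `e = ½ ∫ ρ|u|² + ½ ∫ |v|²`, which is
comparable to `energy` and satisfies `e' = -D`.

*From splitting to decay.* The upper bound on `ρ` gives `∫ ρ|u|² ≤ 2 ∫ ρ|u - v|² + 2K ∫ |v|²`
(`IsClassicalSolution.momentumSq_le`), so that `e` is controlled by `D` and `∫ |v|²`. In `∫ |v|²`
the frequencies `|ξ| ≥ √s` are at most `s⁻¹ ∫ |∇v|²`. The frequencies `|ξ| < √s` fill a ball of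
volume of order `s ^ (d/2)`, and on it `v̂` is estimated by integrating the Navier–Stokes equation in
time: with `m = ‖v₀‖_{L¹}`, the transform of `v ⊗ v` is bounded by `2e`, and that of the drag by
`√(‖ρ‖_{L¹} D)` because the mass does not grow. Hence
`e ≤ κ ((1 + 1/s) D + s ^ (d/2) (m + ∫₀ᵗ (√s e + √D))²)`
for every `s > 0` (`IsClassicalSolution.fourierSplitting`). Together with `e' = -D` this is all that
the decay needs, and it is recorded in the structure `FourierSplitting`. Taking `s` proportional to
`1 / (1 + t)` and differentiating `(1 + t) ^ α e`, a decay rate `β` of `e` is improved to every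
rate below `d/2 - max (1 - β) 0` (`FourierSplitting.improve_rate`). For `d ≥ 3` each step gains any
amount below `1/2`, a rate above `1` is reached after finitely many steps, and from there every rate
below `d/2` (`FourierSplitting.decay`).

*The balance laws.* The momentum part of `e' = -D` comes from testing the Euler equations with
cutoff functions (`balance_law_global`). The balance of `∫ |v|²` is less direct, since nothing is
known about the growth of the pressure at infinity. The pressure disappears when the Navier–Stokes
equation is tested with the divergence-free fields `∂ₖψ eₗ - ∂ₗψ eₖ`. On the Fourier side this says
that the remaining terms of the equation, integrated in time, form a vector parallel to `ξ`
(`IsClassicalSolution.mul_pressureSymbol_comm`), while `v̂` is orthogonal to `ξ`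
(`IsClassicalSolution.sum_mul_fourier_eq_zero`). So the pressure does no work on `v` in any band
`|ξ| < r`. Identified in this weak sense, the increments of `v̂` still determine those of its square
norm (`sum_norm_sq_sub_eq_integral`), which yields the energy balance in `|ξ| < r`
(`IsClassicalSolution.lowPass_energy_balance`). This balance serves twice: for small `r` it is the
estimate of `v̂` used above, and as `r → ∞` it becomes the energy balance of the fluid
(`IsClassicalSolution.energy_balance_v`).
-/

/-! ### Decay from a Fourier splitting inequality -/

/-- The Cauchy–Schwarz inequality for Bochner integrals of real functions. -/
theorem sq_integral_mul_le {X : Type*} [MeasurableSpace X] {μ : Measure X} {f g : X → ℝ}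
    (hf : Integrable (fun x => f x ^ 2) μ) (hg : Integrable (fun x => g x ^ 2) μ)
    (hfg : Integrable (fun x => f x * g x) μ) :
    (∫ x, f x * g x ∂μ) ^ 2 ≤ (∫ x, f x ^ 2 ∂μ) * ∫ x, g x ^ 2 ∂μ := by
  have key : ∀ y : ℝ, 0 ≤ (∫ x, f x ^ 2 ∂μ) * (y * y) + (2 * ∫ x, f x * g x ∂μ) * y
      + ∫ x, g x ^ 2 ∂μ := by
    intro y
    have h : ∫ x, (y * f x + g x) ^ 2 ∂μ = (∫ x, f x ^ 2 ∂μ) * (y * y)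
        + (2 * ∫ x, f x * g x ∂μ) * y + ∫ x, g x ^ 2 ∂μ := by
      have : ∀ x, (y * f x + g x) ^ 2 = (y * y) * f x ^ 2 + (2 * y) * (f x * g x) + g x ^ 2 :=
        fun x => by ring
      simp_rw [this]
      have h1 : Integrable (fun x => (y * y) * f x ^ 2 + (2 * y) * (f x * g x)) μ :=
        (hf.const_mul _).add (hfg.const_mul _)
      rw [integral_add h1 hg, integral_add (hf.const_mul _) (hfg.const_mul _), integral_const_mul,
        integral_const_mul]
      ring
    rw [← h]
    exact integral_nonneg fun x => sq_nonneg _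
  have := discrim_le_zero key
  rw [discrim] at this
  nlinarith

/-- The inequalities on an energy `e` and its dissipation `D` on `[0,T]` from which the decay of
`e` is derived: the energy balance `e' = -D`, and, for every splitting frequency `√s`, a bound of
`e` by the dissipation up to a low-frequency part controlled by the history of `e` and `D`. Here
`m` stands for the `L¹` norm of the initial velocity of the fluid, `Q` for the size of the initial
data, to which the decay estimate is proportional, and `R` for the a priori bound on this size. -/
structure FourierSplitting (δ κ R T Q m : ℝ) (e D : ℝ → ℝ) : Prop where
  continuousOn_energy : ContinuousOn e (Icc 0 T)
  continuousOn_dissipation : ContinuousOn D (Icc 0 T)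
  energy_nonneg : ∀ t ∈ Icc 0 T, 0 ≤ e t
  dissipation_nonneg : ∀ t ∈ Icc 0 T, 0 ≤ D t
  balance : ∀ t ∈ Icc 0 T, e t = e 0 - ∫ τ in (0)..t, D τ
  m_sq_le : m ^ 2 ≤ Q
  le_R : Q ≤ R
  energy_zero_le : e 0 ≤ Q
  splitting : ∀ t ∈ Icc 0 T, ∀ s, 0 < s →
    e t ≤ κ * ((1 + s⁻¹) * D t + s ^ δ * (m + ∫ τ in (0)..t, (√s * e τ + √(D τ))) ^ 2)

namespace FourierSplitting

variable {δ κ R T Q m : ℝ} {e D : ℝ → ℝ}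

theorem Q_nonneg (h : FourierSplitting δ κ R T Q m e D) : 0 ≤ Q :=
  (sq_nonneg m).trans h.m_sq_le

theorem intervalIntegrable {f : ℝ → ℝ} {T t : ℝ} (hf : ContinuousOn f (Icc 0 T))
    (ht : t ∈ Icc 0 T) : IntervalIntegrable f volume 0 t :=
  (hf.mono (by rw [uIcc_of_le ht.1]; exact Icc_subset_Icc_right ht.2)).intervalIntegrable

theorem continuousOn_rpow_shift (a : ℝ) (ha : 0 < a) (β : ℝ) (T : ℝ) :
    ContinuousOn (fun τ : ℝ => (a + τ) ^ β) (Icc 0 T) :=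
  ContinuousOn.rpow_const (by fun_prop) fun x hx => Or.inl (by linarith [hx.1])

/-- The history of `e` and `D` entering the splitting inequality, estimated from a known decay
rate. -/
theorem history_le (h : FourierSplitting δ κ R T Q m e D) {β γ B c₁ : ℝ} (hγ0 : 0 ≤ γ)
    (hγ1 : γ ≤ 1) (hB : 0 ≤ B)
    (hI : ∀ t, 0 ≤ t → ∫ τ in (0)..t, (1 + τ) ^ (-β) ≤ c₁ * (1 + t) ^ γ)
    (hE : ∀ t ∈ Icc 0 T, (1 + t) ^ β * e t ≤ B * Q)
    (hD : ∀ t ∈ Icc 0 T, ∫ τ in (0)..t, (1 + τ) ^ β * D τ ≤ B * Q)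
    {c s t : ℝ} (ht : t ∈ Icc 0 T) (hs : 0 < s) (hsc : s * (1 + t) ≤ c) :
    (m + ∫ τ in (0)..t, (√s * e τ + √(D τ))) ^ 2
      ≤ 3 * (1 + c * B ^ 2 * R * c₁ ^ 2 + B * c₁) * Q * (1 + t) ^ γ := by
  have hQ := h.Q_nonneg
  have ht1 : (1 : ℝ) ≤ 1 + t := by linarith [ht.1]
  have ht0 : (0 : ℝ) < 1 + t := by linarith
  have hc : 0 ≤ c := le_trans (by positivity) hsc
  have hP1 : 1 ≤ (1 + t) ^ γ := Real.one_le_rpow ht1 hγ0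
  have hie : IntervalIntegrable e volume 0 t := intervalIntegrable h.continuousOn_energy ht
  have hsD : ContinuousOn (fun τ => √(D τ)) (Icc 0 T) := h.continuousOn_dissipation.sqrt
  have hiD : IntervalIntegrable (fun τ => √(D τ)) volume 0 t := intervalIntegrable hsD ht
  have hsplit : ∫ τ in (0)..t, (√s * e τ + √(D τ))
      = √s * (∫ τ in (0)..t, e τ) + ∫ τ in (0)..t, √(D τ) := by
    rw [intervalIntegral.integral_add (hie.const_mul _) hiD, intervalIntegral.integral_const_mul]
  have hsub : ∀ τ ∈ Icc 0 t, τ ∈ Icc 0 T := fun τ hτ => ⟨hτ.1, hτ.2.trans ht.2⟩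
  have hwc : ∀ b : ℝ, ContinuousOn (fun τ : ℝ => (1 + τ) ^ b) (Icc 0 T) :=
    fun b => continuousOn_rpow_shift 1 one_pos b T
  have he0 : 0 ≤ ∫ τ in (0)..t, e τ :=
    intervalIntegral.integral_nonneg ht.1 fun τ hτ => h.energy_nonneg τ (hsub τ hτ)
  have he1 : ∫ τ in (0)..t, e τ ≤ B * Q * (c₁ * (1 + t) ^ γ) := by
    calc ∫ τ in (0)..t, e τ ≤ ∫ τ in (0)..t, B * Q * (1 + τ) ^ (-β) := by
          refine intervalIntegral.integral_mono_on ht.1 hie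
            ((intervalIntegrable (hwc _) ht).const_mul _) fun τ hτ => ?_
          have h1 : 0 < 1 + τ := by linarith [hτ.1]
          rw [Real.rpow_neg h1.le, ← div_eq_mul_inv, le_div_iff₀ (by positivity), mul_comm]
          exact hE τ (hsub τ hτ)
      _ ≤ _ := by
          rw [intervalIntegral.integral_const_mul]
          exact mul_le_mul_of_nonneg_left (hI t ht.1) (by positivity)
  have hsq : (∫ τ in (0)..t, √(D τ)) ^ 2 ≤ (B * Q) * (c₁ * (1 + t) ^ γ) := by
    have hc1 : ContinuousOn (fun τ => (1 + τ) ^ (β / 2) * √(D τ)) (Icc 0 T) := (hwc _).mul hsD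
    have hc2 := hwc (-β / 2)
    have hcs := sq_integral_mul_le (μ := volume.restrict (Ioc 0 t))
      (f := fun τ => (1 + τ) ^ (β / 2) * √(D τ)) (g := fun τ => (1 + τ) ^ (-β / 2))
      ((intervalIntegrable_iff_integrableOn_Ioc_of_le ht.1).1 (intervalIntegrable (hc1.pow 2) ht))
      ((intervalIntegrable_iff_integrableOn_Ioc_of_le ht.1).1 (intervalIntegrable (hc2.pow 2) ht))
      ((intervalIntegrable_iff_integrableOn_Ioc_of_le ht.1).1 (intervalIntegrable (hc1.mul hc2) ht))
    simp only [← intervalIntegral.integral_of_le ht.1] at hcs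
    have e1 : ∫ τ in (0)..t, (1 + τ) ^ (β / 2) * √(D τ) * (1 + τ) ^ (-β / 2)
        = ∫ τ in (0)..t, √(D τ) := by
      refine intervalIntegral.integral_congr fun τ hτ => ?_
      rw [uIcc_of_le ht.1] at hτ
      have h1 : 0 < 1 + τ := by linarith [hτ.1]
      have : (1 + τ) ^ (β / 2) * (1 + τ) ^ (-β / 2) = 1 := by
        rw [← Real.rpow_add h1, show β / 2 + -β / 2 = 0 by ring, Real.rpow_zero]
      linear_combination √(D τ) * this
    have e2 : ∫ τ in (0)..t, ((1 + τ) ^ (β / 2) * √(D τ)) ^ 2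
        = ∫ τ in (0)..t, (1 + τ) ^ β * D τ := by
      refine intervalIntegral.integral_congr fun τ hτ => ?_
      rw [uIcc_of_le ht.1] at hτ
      have h1 : 0 < 1 + τ := by linarith [hτ.1]
      simp only [mul_pow]
      rw [Real.sq_sqrt (h.dissipation_nonneg τ (hsub τ hτ)), ← Real.rpow_natCast,
        ← Real.rpow_mul h1.le]
      norm_num
    have e3 : ∫ τ in (0)..t, ((1 + τ) ^ (-β / 2)) ^ 2 = ∫ τ in (0)..t, (1 + τ) ^ (-β) := by
      refine intervalIntegral.integral_congr fun τ hτ => ?_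
      rw [uIcc_of_le ht.1] at hτ
      have h1 : 0 < 1 + τ := by linarith [hτ.1]
      rw [← Real.rpow_natCast, ← Real.rpow_mul h1.le]
      norm_num
    rw [e1, e2, e3] at hcs
    refine hcs.trans (mul_le_mul (hD t ht) (hI t ht.1) ?_ (by positivity))
    exact intervalIntegral.integral_nonneg ht.1 fun τ hτ =>
      Real.rpow_nonneg (by linarith [hτ.1]) _
  have hse : s * (∫ τ in (0)..t, e τ) ^ 2 ≤ c * B ^ 2 * R * c₁ ^ 2 * Q * (1 + t) ^ γ := by
    have hP2 : (1 + t) ^ γ * (1 + t) ^ γ ≤ (1 + t) * (1 + t) ^ γ := by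
      refine mul_le_mul_of_nonneg_right ?_ (by positivity)
      calc (1 + t) ^ γ ≤ (1 + t) ^ (1 : ℝ) := Real.rpow_le_rpow_of_exponent_le ht1 hγ1
        _ = 1 + t := Real.rpow_one _
    calc s * (∫ τ in (0)..t, e τ) ^ 2 ≤ s * (B * Q * (c₁ * (1 + t) ^ γ)) ^ 2 := by gcongr
      _ = s * (B ^ 2 * Q ^ 2 * c₁ ^ 2) * ((1 + t) ^ γ * (1 + t) ^ γ) := by ring
      _ ≤ s * (B ^ 2 * Q ^ 2 * c₁ ^ 2) * ((1 + t) * (1 + t) ^ γ) := by gcongr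
      _ = (s * (1 + t)) * (B ^ 2 * (Q * Q) * c₁ ^ 2) * (1 + t) ^ γ := by ring
      _ ≤ c * (B ^ 2 * (R * Q) * c₁ ^ 2) * (1 + t) ^ γ := by
          gcongr
          exact h.le_R
      _ = _ := by ring
  have hm : m ^ 2 ≤ Q * (1 + t) ^ γ := h.m_sq_le.trans (le_mul_of_one_le_right hQ hP1)
  have h3 : ∀ x y z : ℝ, (x + (y + z)) ^ 2 ≤ 3 * (x ^ 2 + y ^ 2 + z ^ 2) := fun x y z => by
    nlinarith [sq_nonneg (x - y), sq_nonneg (y - z), sq_nonneg (x - z)]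
  rw [hsplit]
  refine (h3 _ _ _).trans ?_
  rw [mul_pow, Real.sq_sqrt hs.le]
  linear_combination 3 * hm + 3 * hse + 3 * hsq

/-- One step of the bootstrap: a decay rate `β` of the energy is improved to every rate `α` below
`δ - γ`, where `(1 + t) ^ γ` bounds the growth of `∫₀ᵗ (1 + τ) ^ (-β) dτ`. -/
theorem improve_rate {δ κ R α β γ B c₁ : ℝ} (hκ : 0 < κ) (hR : 0 ≤ R) (hα : 0 < α)
    (hγ0 : 0 ≤ γ) (hγ1 : γ ≤ 1) (hαδ : α < δ - γ) (hc₁ : 0 ≤ c₁) (hB : 0 ≤ B)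
    (hI : ∀ t, 0 ≤ t → ∫ τ in (0)..t, (1 + τ) ^ (-β) ≤ c₁ * (1 + t) ^ γ) :
    ∃ C, 0 < C ∧ ∀ {T Q m : ℝ} {e D : ℝ → ℝ}, FourierSplitting δ κ R T Q m e D →
      (∀ t ∈ Icc 0 T, (1 + t) ^ β * e t ≤ B * Q) →
      (∀ t ∈ Icc 0 T, ∫ τ in (0)..t, (1 + τ) ^ β * D τ ≤ B * Q) →
      ∀ t ∈ Icc 0 T, (1 + t) ^ α * e t + ∫ τ in (0)..t, (1 + τ) ^ α * D τ ≤ C * Q := by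
  -- With the weight `(a + t) ^ α` and `s = c / (a + t)`, at least half of the dissipation is
  -- left after the term coming from the derivative of the weight has been absorbed.
  set c := 4 * α * κ with hc
  have hc0 : 0 < c := by positivity
  set a := 1 + c with ha
  set C₂ := 3 * (1 + c * B ^ 2 * R * c₁ ^ 2 + B * c₁) with hC₂
  have hC₂0 : 0 ≤ C₂ := by positivity
  set C₃ := α * κ * c ^ δ * C₂ with hC₃
  have hC₃0 : 0 ≤ C₃ := by positivity
  set η := δ - γ - α with hη
  have hη0 : 0 < η := by linarith
  refine ⟨2 * (a ^ α + C₃ / η), by positivity, ?_⟩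
  intro T Q m e D h hE hD t ht
  have hQ := h.Q_nonneg
  have ha1 : 1 ≤ a := by linarith
  have ha0 : 0 < a := by linarith
  have hsub : ∀ τ ∈ Icc 0 t, τ ∈ Icc 0 T := fun τ hτ => ⟨hτ.1, hτ.2.trans ht.2⟩
  have hpt : ∀ τ ∈ Icc 0 T, α * e τ ≤ 1 / 2 * ((a + τ) * D τ) + C₃ * Q * (a + τ) ^ (γ - δ) := by
    intro τ hτ
    have hτ0 := hτ.1
    have haτ : 0 < a + τ := by linarith
    have hs : 0 < c / (a + τ) := by positivity
    have hhist := h.history_le hγ0 hγ1 hB hI hE hD hτ hs (c := c) (by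
      rw [div_mul_eq_mul_div, div_le_iff₀ haτ]
      gcongr)
    have hsp := h.splitting τ hτ _ hs
    have hD0 := h.dissipation_nonneg τ hτ
    have h1 : (1 + (c / (a + τ))⁻¹) * c ≤ 2 * (a + τ) := by
      rw [inv_div]
      field_simp
      linarith
    have h2 : (1 + τ) ^ γ ≤ (a + τ) ^ γ := by gcongr
    have h3 : (c / (a + τ)) ^ δ * (m + ∫ x in (0)..τ, (√(c / (a + τ)) * e x + √(D x))) ^ 2
        ≤ c ^ δ * C₂ * Q * (a + τ) ^ (γ - δ) := by
      calc _ ≤ (c / (a + τ)) ^ δ * (C₂ * Q * (a + τ) ^ γ) := by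
            refine mul_le_mul_of_nonneg_left (hhist.trans ?_) (by positivity)
            gcongr
        _ = _ := by
            rw [Real.div_rpow hc0.le haτ.le, Real.rpow_sub haτ]
            ring
    calc α * e τ ≤ α * (κ * ((1 + (c / (a + τ))⁻¹) * D τ + c ^ δ * C₂ * Q * (a + τ) ^ (γ - δ))) := by
          gcongr
          exact hsp.trans (by gcongr)
      _ = 1 / 4 * (((1 + (c / (a + τ))⁻¹) * c) * D τ) + C₃ * Q * (a + τ) ^ (γ - δ) := by
          rw [hC₃, hc]; ring
      _ ≤ 1 / 4 * ((2 * (a + τ)) * D τ) + C₃ * Q * (a + τ) ^ (γ - δ) := by gcongr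
      _ = _ := by ring
  have hwc : ∀ b : ℝ, ContinuousOn (fun τ : ℝ => (a + τ) ^ b) (Icc 0 T) :=
    fun b => continuousOn_rpow_shift a ha0 b T
  have hIcc : Icc 0 t ⊆ Icc 0 T := fun τ hτ => hsub τ hτ
  have hder : ∀ τ ∈ Ioo 0 t, HasDerivAt (fun τ => (a + τ) ^ α * e τ)
      (α * (a + τ) ^ (α - 1) * e τ - (a + τ) ^ α * D τ) τ := by
    intro τ hτ
    have haτ : 0 < a + τ := by linarith [hτ.1]
    have hT : Icc 0 T ∈ nhds τ := Icc_mem_nhds hτ.1 (hτ.2.trans_le ht.2)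
    have h1 : HasDerivAt (fun τ => (a + τ) ^ α) (α * (a + τ) ^ (α - 1)) τ := by
      have := ((hasDerivAt_id τ).const_add a).rpow_const (p := α) (Or.inl haτ.ne')
      simpa using this
    have h2 : HasDerivAt (fun τ => ∫ x in (0)..τ, D x) (D τ) τ := by
      refine intervalIntegral.integral_hasDerivAt_right
        (intervalIntegrable h.continuousOn_dissipation (hsub τ ⟨hτ.1.le, hτ.2.le⟩)) ?_
        (h.continuousOn_dissipation.continuousAt hT)
      exact h.continuousOn_dissipation.stronglyMeasurableAtFilter_nhdsWithin measurableSet_Icc τ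
        |>.filter_mono (by rw [nhdsWithin_eq_nhds.2 hT])
    have h3 : HasDerivAt e (-D τ) τ := by
      have h4 := h2.const_sub (e 0)
      refine h4.congr_of_eventuallyEq ?_
      filter_upwards [hT] with x hx using h.balance x hx
    exact (h1.mul h3).congr_deriv (by ring)
  have hcy : ContinuousOn (fun τ => (a + τ) ^ α * e τ) (Icc 0 T) :=
    (hwc α).mul h.continuousOn_energy
  have hcD : ContinuousOn (fun τ => (a + τ) ^ α * D τ) (Icc 0 T) :=
    (hwc α).mul h.continuousOn_dissipation
  have hcd : ContinuousOn (fun τ => α * (a + τ) ^ (α - 1) * e τ - (a + τ) ^ α * D τ) (Icc 0 T) :=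
    ((continuousOn_const.mul (hwc _)).mul h.continuousOn_energy).sub hcD
  have hFTC := intervalIntegral.integral_eq_sub_of_hasDerivAt_of_le ht.1 (hcy.mono hIcc) hder
    (intervalIntegrable hcd ht)
  have hle : ∫ τ in (0)..t, (α * (a + τ) ^ (α - 1) * e τ - (a + τ) ^ α * D τ)
      ≤ ∫ τ in (0)..t, (C₃ * Q * (a + τ) ^ (-1 - η) - 1 / 2 * ((a + τ) ^ α * D τ)) := by
    refine intervalIntegral.integral_mono_on ht.1 (intervalIntegrable hcd ht)
      (((intervalIntegrable (hwc _) ht).const_mul _).sub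
        ((intervalIntegrable hcD ht).const_mul _)) fun τ hτ => ?_
    have haτ : 0 < a + τ := by linarith [hτ.1]
    have h1 := mul_le_mul_of_nonneg_left (hpt τ (hsub τ hτ))
      (Real.rpow_nonneg haτ.le (α - 1))
    have h2 : (a + τ) ^ (α - 1) * (a + τ) ^ (γ - δ) = (a + τ) ^ (-1 - η) := by
      rw [← Real.rpow_add haτ, hη]
      congr 1
      ring
    have h3 : (a + τ) ^ (α - 1) * (a + τ) = (a + τ) ^ α := by
      rw [Real.rpow_sub_one haτ.ne', div_mul_cancel₀ _ haτ.ne']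
    rw [← h2, ← h3]
    linear_combination h1
  have hint : ∫ τ in (0)..t, (a + τ) ^ (-1 - η) ≤ 1 / η := by
    have hd : ∀ τ ∈ Ioo 0 t, HasDerivAt (fun τ => -(a + τ) ^ (-η) / η) ((a + τ) ^ (-1 - η)) τ := by
      intro τ hτ
      have haτ : 0 < a + τ := by linarith [hτ.1]
      have := ((((hasDerivAt_id τ).const_add a).rpow_const (p := -η)
        (Or.inl haτ.ne')).neg).div_const η
      refine this.congr_deriv ?_
      rw [show -η - 1 = -1 - η by ring]
      simp only [id]
      field_simp
    rw [intervalIntegral.integral_eq_sub_of_hasDerivAt_of_le ht.1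
      ((((hwc (-η)).fun_neg).div_const η).mono hIcc) hd (intervalIntegrable (hwc _) ht)]
    have h1 : a ^ (-η) ≤ 1 := Real.rpow_le_one_of_one_le_of_nonpos ha1 (by linarith)
    have h2 : 0 ≤ (a + t) ^ (-η) := Real.rpow_nonneg (by linarith [ht.1]) _
    rw [add_zero, ← sub_div]
    gcongr
    linarith
  rw [intervalIntegral.integral_sub ((intervalIntegrable (hwc _) ht).const_mul _)
    ((intervalIntegrable hcD ht).const_mul _), intervalIntegral.integral_const_mul,
    intervalIntegral.integral_const_mul, hFTC, add_zero] at hle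
  have hfin1 : C₃ * Q * ∫ τ in (0)..t, (a + τ) ^ (-1 - η) ≤ C₃ * Q * (1 / η) :=
    mul_le_mul_of_nonneg_left hint (by positivity)
  have hfin2 : a ^ α * e 0 ≤ a ^ α * Q :=
    mul_le_mul_of_nonneg_left h.energy_zero_le (by positivity)
  have hfin3 : (1 + t) ^ α * e t ≤ (a + t) ^ α * e t := by
    have := h.energy_nonneg t ht
    have := ht.1
    gcongr
  have hfin4 : ∫ τ in (0)..t, (1 + τ) ^ α * D τ ≤ ∫ τ in (0)..t, (a + τ) ^ α * D τ := by
    refine intervalIntegral.integral_mono_on ht.1 (intervalIntegrable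
      ((continuousOn_rpow_shift 1 one_pos α T).mul h.continuousOn_dissipation) ht)
      (intervalIntegrable hcD ht) fun τ hτ => ?_
    have := h.dissipation_nonneg τ (hsub τ hτ)
    have := hτ.1
    gcongr
  have hfin5 : 0 ≤ (a + t) ^ α * e t :=
    mul_nonneg (Real.rpow_nonneg (by linarith [ht.1]) _) (h.energy_nonneg t ht)
  linear_combination 2 * hle + 2 * hfin1 + 2 * hfin2 + hfin3 + hfin4 + hfin5

/-- The time integral of a decay rate `β` grows at the rate `max (1 - β) 0`; at `β = 1` the growth is
logarithmic, hence the exclusion. -/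
theorem integral_one_add_rpow_neg_le {β : ℝ} (hβ : β ≠ 1) {t : ℝ} (ht : 0 ≤ t) :
    ∫ τ in (0)..t, (1 + τ) ^ (-β) ≤ |1 - β|⁻¹ * (1 + t) ^ max (1 - β) 0 := by
  have hd : ∀ τ ∈ Ioo 0 t,
      HasDerivAt (fun τ : ℝ => (1 + τ) ^ (1 - β) / (1 - β)) ((1 + τ) ^ (-β)) τ := by
    intro τ hτ
    have haτ : 0 < 1 + τ := by linarith [hτ.1]
    have hβ' : 1 - β ≠ 0 := sub_ne_zero.2 hβ.symm
    have := ((((hasDerivAt_id τ).const_add 1).rpow_const (p := 1 - β)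
      (Or.inl haτ.ne'))).div_const (1 - β)
    refine this.congr_deriv ?_
    rw [show 1 - β - 1 = -β by ring]
    simp only [id]
    field_simp
  rw [intervalIntegral.integral_eq_sub_of_hasDerivAt_of_le ht
    ((continuousOn_rpow_shift 1 one_pos (1 - β) t).div_const _) hd
    (intervalIntegrable (continuousOn_rpow_shift 1 one_pos (-β) t) ⟨ht, le_rfl⟩)]
  have h0 : 0 ≤ (1 + t) ^ (1 - β) := Real.rpow_nonneg (by linarith) _
  rcases lt_or_gt_of_ne hβ with h | h
  · have h1 : 0 < 1 - β := by linarith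
    rw [max_eq_left h1.le, abs_of_pos h1, div_eq_inv_mul]
    simp only [add_zero, Real.one_rpow]
    have := one_div_pos.2 h1
    linarith
  · have h1 : 1 - β < 0 := by linarith
    rw [max_eq_right h1.le, abs_of_neg h1, Real.rpow_zero, add_zero, Real.one_rpow, ← sub_div,
      ← neg_div_neg_eq, mul_one, ← one_div]
    gcongr
    · linarith
    · linarith

/-- Decay at every rate below `δ`. Since `δ ≥ 3/2`, the rates `0`, `2/5`, `4/5` and `6/5` are
reached in succession, and the last one makes `√D` integrable in time uniformly in `T`. -/
theorem decay {δ κ R α : ℝ} (hδ : 3 / 2 ≤ δ) (hκ : 0 < κ) (hR : 0 ≤ R) (hα : 0 < α)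
    (hαδ : α < δ) :
    ∃ C, 0 < C ∧ ∀ {T Q m : ℝ} {e D : ℝ → ℝ}, FourierSplitting δ κ R T Q m e D →
      ∀ t ∈ Icc 0 T, (1 + t) ^ α * e t + ∫ τ in (0)..t, (1 + τ) ^ α * D τ ≤ C * Q := by
  have step : ∀ {β : ℝ} (α' : ℝ), 0 ≤ β → β ≠ 1 → 0 < α' → α' < δ - max (1 - β) 0 →
      (∃ C, 0 < C ∧ ∀ {T Q m : ℝ} {e D : ℝ → ℝ}, FourierSplitting δ κ R T Q m e D →
        ∀ t ∈ Icc 0 T, (1 + t) ^ β * e t + ∫ τ in (0)..t, (1 + τ) ^ β * D τ ≤ C * Q) →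
      ∃ C, 0 < C ∧ ∀ {T Q m : ℝ} {e D : ℝ → ℝ}, FourierSplitting δ κ R T Q m e D →
        ∀ t ∈ Icc 0 T, (1 + t) ^ α' * e t + ∫ τ in (0)..t, (1 + τ) ^ α' * D τ ≤ C * Q := by
    rintro β α' hβ0 hβ1 hα' hlt ⟨B, hB, hprev⟩
    obtain ⟨C, hC, hstep⟩ := improve_rate (δ := δ) (R := R) (β := β) hκ hR hα' (le_max_right _ _)
      (max_le (by linarith) zero_le_one) hlt (by positivity) hB.le
      (fun t ht => integral_one_add_rpow_neg_le hβ1 ht)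
    refine ⟨C, hC, fun h => hstep h (fun t ht => ?_) (fun t ht => ?_)⟩
    · have h1 := hprev h t ht
      have h2 : 0 ≤ ∫ τ in (0)..t, (1 + τ) ^ β * _ := intervalIntegral.integral_nonneg ht.1
        fun τ hτ => mul_nonneg (Real.rpow_nonneg (by linarith [hτ.1]) _)
          (h.dissipation_nonneg τ ⟨hτ.1, hτ.2.trans ht.2⟩)
      linarith
    · have h1 := hprev h t ht
      have h2 := mul_nonneg (Real.rpow_nonneg (show 0 ≤ 1 + t by linarith [ht.1]) β)
        (h.energy_nonneg t ht)
      linarith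
  refine step (β := 6 / 5) α (by norm_num) (by norm_num) hα (by norm_num; exact hαδ) ?_
  refine step (β := 4 / 5) _ (by norm_num) (by norm_num) (by norm_num)
    (by norm_num; linarith) ?_
  refine step (β := 2 / 5) _ (by norm_num) (by norm_num) (by norm_num)
    (by norm_num; linarith) ?_
  refine step (β := 0) _ (by norm_num) (by norm_num) (by norm_num) (by norm_num; linarith) ?_
  refine ⟨1, one_pos, fun h t ht => ?_⟩
  have := h.balance t ht
  simp only [Real.rpow_zero, one_mul]
  linarith [h.energy_zero_le]

end FourierSplitting

/-! ### Tempered distributions represented by functions -/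

section FourierGeneralities

open FourierTransform
open scoped ContDiff LineDeriv

variable {E : Type*} [NormedAddCommGroup E] [InnerProductSpace ℝ E] [FiniteDimensional ℝ E]

/-- Multiplication by the dilates `χ (x / (n + 1))` of a bump function approximates a Schwartz
function in the Schwartz topology by compactly supported functions. -/
theorem SchwartzMap.exists_tendsto_of_hasCompactSupport (ψ : 𝓢(E, ℂ)) :
    ∃ φ : ℕ → 𝓢(E, ℂ), (∀ n, HasCompactSupport (φ n)) ∧
      Filter.Tendsto φ Filter.atTop (nhds ψ) := by
  let χ : ContDiffBump (0 : E) := ⟨1, 2, one_pos, one_lt_two⟩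
  have hχs : ContDiff ℝ ∞ (χ : E → ℝ) := χ.contDiff
  have hχc : HasCompactSupport (χ : E → ℝ) := χ.hasCompactSupport
  let c : ℕ → ℝ := fun n => ((n : ℝ) + 1)⁻¹
  have hc0 : ∀ n, 0 < c n := fun n => by positivity
  have hc1 : ∀ n, c n ≤ 1 := fun n => inv_le_one_of_one_le₀ (by linarith [Nat.cast_nonneg (α := ℝ) n])
  have hs : ∀ n, ContDiff ℝ ∞ (fun x => χ (c n • x) • ψ x) := fun n =>
    (hχs.comp (contDiff_const_smul (c n))).smul (ψ.smooth ⊤)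
  have hcs : ∀ n, HasCompactSupport (fun x => χ (c n • x)) := fun n =>
    hχc.comp_homeomorph (Homeomorph.smulOfNeZero (c n) (hc0 n).ne')
  have hcs' : ∀ n, HasCompactSupport (fun x => χ (c n • x) • ψ x) := fun n => (hcs n).smul_right
  refine ⟨fun n => (hcs' n).toSchwartzMap (hs n), hcs', ?_⟩
  rw [(schwartz_withSeminorms ℂ E ℂ).tendsto_nhds _ _]
  rintro ⟨k, m⟩ ε hε
  -- the derivatives of `1 - χ (x / (n + 1))` are bounded uniformly in `n`
  have hbd : ∃ A : ℝ, 0 ≤ A ∧ ∀ n, ∀ j ≤ m, ∀ x,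
      ‖iteratedFDeriv ℝ j (fun x => χ (c n • x) - 1) x‖ ≤ A := by
    have hj : ∀ j : ℕ, ∃ A : ℝ, ∀ x, ‖iteratedFDeriv ℝ j (fun y : E => χ y - 1) x‖ ≤ A := by
      intro j
      have h1 : ∀ x, iteratedFDeriv ℝ j (fun y : E => χ y - 1) x
          = iteratedFDeriv ℝ j χ x - iteratedFDeriv ℝ j (fun _ : E => (1 : ℝ)) x := fun x => by
        have := iteratedFDeriv_sub_apply (𝕜 := ℝ) (i := j) (f := (χ : E → ℝ))
          (g := fun _ => (1 : ℝ)) (x := x) (hχs.of_le (mod_cast le_top)).contDiffAt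
          contDiff_const.contDiffAt
        exact this
      obtain ⟨A, hA⟩ := ((hχs.of_le (mod_cast le_top) :
        ContDiff ℝ j (χ : E → ℝ)).continuous_iteratedFDeriv').bounded_above_of_compact_support
          (hχc.iteratedFDeriv j)
      refine ⟨A + 1, fun x => ?_⟩
      rw [h1]
      refine (norm_sub_le _ _).trans (add_le_add (hA x) ?_)
      rcases Nat.eq_zero_or_pos j with rfl | hj
      · simp
      · rw [iteratedFDeriv_const_of_ne hj.ne']
        simp
    choose A hA using hj
    have hA0 : ∀ j, 0 ≤ A j := fun j => (norm_nonneg _).trans (hA j 0)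
    refine ⟨∑ j ∈ Finset.range (m + 1), A j, Finset.sum_nonneg fun j _ => hA0 j, ?_⟩
    intro n j hj x
    have hcd : ContDiff ℝ j (fun y : E => χ y - 1) :=
      (hχs.of_le (mod_cast le_top)).sub contDiff_const
    rw [iteratedFDeriv_comp_const_smul (c n) hcd, norm_smul, norm_pow, Real.norm_eq_abs,
      abs_of_pos (hc0 n)]
    calc c n ^ j * ‖iteratedFDeriv ℝ j (fun y => χ y - 1) (c n • x)‖
        ≤ 1 * A j := mul_le_mul (pow_le_one₀ (hc0 n).le (hc1 n)) (hA _ _) (norm_nonneg _) one_pos.le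
      _ = A j := one_mul _
      _ ≤ _ := Finset.single_le_sum (fun j _ => hA0 j) (Finset.mem_range.2 (by omega))
  obtain ⟨A, hA0, hA⟩ := hbd
  set S : ℝ := ∑ i ∈ Finset.range (m + 1), (m.choose i : ℝ) * A *
    SchwartzMap.seminorm ℂ (k + 1) (m - i) ψ with hS
  have hS0 : 0 ≤ S := Finset.sum_nonneg fun i _ => by positivity
  have key : ∀ n, SchwartzMap.seminorm ℂ k m ((hcs' n).toSchwartzMap (hs n) - ψ) ≤ S * c n := by
    intro n
    refine SchwartzMap.seminorm_le_bound ℂ k m _ (mul_nonneg hS0 (hc0 n).le) fun x => ?_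
    have hfun : (((hcs' n).toSchwartzMap (hs n) - ψ : 𝓢(E, ℂ)) : E → ℂ)
        = fun x => (χ (c n • x) - 1) • ψ x := by
      ext y
      simp [sub_mul]
    rw [hfun]
    by_cases hx : c n * ‖x‖ < 1
    · -- near such a point the cutoff equals `1`
      have hev : (fun x => (χ (c n • x) - 1) • ψ x) =ᶠ[nhds x] fun _ => 0 := by
        have hopen : IsOpen {y : E | c n * ‖y‖ < 1} :=
          isOpen_lt (by fun_prop) continuous_const
        filter_upwards [hopen.mem_nhds hx] with y hy
        have : χ (c n • y) = 1 := χ.one_of_mem_closedBall (by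
          rw [mem_closedBall_zero_iff, norm_smul, Real.norm_eq_abs, abs_of_pos (hc0 n)]
          exact le_of_lt hy)
        simp [this]
      rw [(hev.iteratedFDeriv ℝ m).eq_of_nhds]
      have : iteratedFDeriv ℝ m (fun _ : E => (0 : ℂ)) x = 0 := by
        rw [iteratedFDeriv_fun_zero]; rfl
      rw [this]
      simpa using mul_nonneg hS0 (hc0 n).le
    · have hx1 : 1 ≤ c n * ‖x‖ := not_lt.1 hx
      have hle := norm_iteratedFDeriv_smul_le (𝕜 := ℝ) (N := ∞) (n := m)
        ((hχs.comp (contDiff_const_smul (c n))).sub contDiff_const :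
          ContDiff ℝ ∞ (fun x => χ (c n • x) - 1)) (ψ.smooth ⊤) x (mod_cast le_top)
      calc ‖x‖ ^ k * ‖iteratedFDeriv ℝ m (fun x => (χ (c n • x) - 1) • ψ x) x‖
          ≤ ‖x‖ ^ k * (c n * ‖x‖) * ‖iteratedFDeriv ℝ m (fun x => (χ (c n • x) - 1) • ψ x) x‖ := by
            gcongr
            exact le_mul_of_one_le_right (by positivity) hx1
        _ ≤ ‖x‖ ^ k * (c n * ‖x‖) * ∑ i ∈ Finset.range (m + 1), (m.choose i : ℝ) *
              A * ‖iteratedFDeriv ℝ (m - i) ψ x‖ := by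
            have := hc0 n
            gcongr
            refine hle.trans (Finset.sum_le_sum fun i hi => ?_)
            gcongr
            exact hA n i (by have := Finset.mem_range.1 hi; omega) x
        _ = (∑ i ∈ Finset.range (m + 1), (m.choose i : ℝ) * A *
              (‖x‖ ^ (k + 1) * ‖iteratedFDeriv ℝ (m - i) ψ x‖)) * c n := by
            rw [Finset.mul_sum, Finset.sum_mul]
            refine Finset.sum_congr rfl fun i _ => by ring
        _ ≤ S * c n := by
            have := hc0 n
            rw [hS]
            gcongr
            exact SchwartzMap.le_seminorm ℂ (k + 1) (m - _) ψ x
  have hlim : Filter.Tendsto (fun n => S * c n) Filter.atTop (nhds 0) := by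
    have := (tendsto_one_div_add_atTop_nhds_zero_nat (𝕜 := ℝ)).const_mul S
    simpa [c, one_div] using this
  filter_upwards [hlim.eventually_lt_const hε] with n hn
  exact (key n).trans_lt hn

/-- A tempered distribution vanishing on all real-valued compactly supported smooth functions is
zero. -/
theorem TemperedDistribution.eq_zero_of_forall_hasCompactSupport {Λ : 𝓢'(E, ℂ)}
    (h : ∀ (φ : 𝓢(E, ℂ)) (g : E → ℝ), ContDiff ℝ ∞ g → HasCompactSupport g →
      (∀ x, φ x = g x) → Λ φ = 0) : Λ = 0 := by
  have hc : ∀ φ : 𝓢(E, ℂ), HasCompactSupport φ → Λ φ = 0 := by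
    intro φ hφ
    have hre : ContDiff ℝ ∞ (fun x => (φ x).re) := Complex.reCLM.contDiff.comp (φ.smooth ⊤)
    have him : ContDiff ℝ ∞ (fun x => (φ x).im) := Complex.imCLM.contDiff.comp (φ.smooth ⊤)
    have hrec : HasCompactSupport (fun x => (φ x).re) := hφ.comp_left (g := Complex.re) rfl
    have himc : HasCompactSupport (fun x => (φ x).im) := hφ.comp_left (g := Complex.im) rfl
    have hrec' : HasCompactSupport (fun x => ((φ x).re : ℂ)) :=
      hrec.comp_left (g := Complex.ofReal) rfl
    have himc' : HasCompactSupport (fun x => ((φ x).im : ℂ)) :=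
      himc.comp_left (g := Complex.ofReal) rfl
    let φ₁ := hrec'.toSchwartzMap (Complex.ofRealCLM.contDiff.comp hre)
    let φ₂ := himc'.toSchwartzMap (Complex.ofRealCLM.contDiff.comp him)
    have hdec : φ = φ₁ + Complex.I • φ₂ := by
      ext x
      simp only [add_apply, smul_apply]
      change φ x = ((φ x).re : ℂ) + Complex.I * ((φ x).im : ℂ)
      rw [mul_comm, Complex.re_add_im]
    rw [hdec, map_add, map_smul, h φ₁ _ hre hrec (fun _ => rfl), h φ₂ _ him himc (fun _ => rfl)]
    simp
  ext ψ
  obtain ⟨φ, hφ, hlim⟩ := SchwartzMap.exists_tendsto_of_hasCompactSupport ψ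
  have h1 := (Λ.continuous.tendsto ψ).comp hlim
  refine tendsto_nhds_unique h1 (tendsto_const_nhds.congr fun n => ?_)
  exact (hc _ (hφ n)).symm

variable [MeasurableSpace E] [BorelSpace E]

/-- The tempered distribution `Λ` is given by integration against the locally integrable
function `F`. -/
structure TemperedDistribution.IsRepresentedBy (Λ : 𝓢'(E, ℂ)) (F : E → ℂ) : Prop where
  locallyIntegrable : LocallyIntegrable F
  integrable : ∀ φ : 𝓢(E, ℂ), Integrable (fun x => φ x * F x)
  apply_eq : ∀ φ : 𝓢(E, ℂ), Λ φ = ∫ x, φ x * F x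

namespace TemperedDistribution.IsRepresentedBy

variable {Λ Λ' : 𝓢'(E, ℂ)} {F F' : E → ℂ}

theorem add (h : IsRepresentedBy Λ F) (h' : IsRepresentedBy Λ' F') :
    IsRepresentedBy (Λ + Λ') (fun x => F x + F' x) where
  locallyIntegrable := h.locallyIntegrable.add h'.locallyIntegrable
  integrable φ := by
    simp_rw [mul_add]
    exact (h.integrable φ).add (h'.integrable φ)
  apply_eq φ := by
    simp_rw [mul_add]
    rw [integral_add (h.integrable φ) (h'.integrable φ), ← h.apply_eq, ← h'.apply_eq]
    rfl

theorem smul (h : IsRepresentedBy Λ F) (c : ℂ) : IsRepresentedBy (c • Λ) (fun x => c * F x) where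
  locallyIntegrable := h.locallyIntegrable.smul c
  integrable φ := by
    simp_rw [mul_left_comm _ c]
    exact (h.integrable φ).const_mul c
  apply_eq φ := by
    simp_rw [mul_left_comm _ c]
    rw [integral_const_mul, ← h.apply_eq]
    rfl

theorem sub (h : IsRepresentedBy Λ F) (h' : IsRepresentedBy Λ' F') :
    IsRepresentedBy (Λ - Λ') (fun x => F x - F' x) := by
  have := h.add (h'.smul (-1))
  have h1 : Λ + (-1 : ℂ) • Λ' = Λ - Λ' := by
    ext φ
    change Λ φ + (-1 : ℂ) • Λ' φ = Λ φ - Λ' φ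
    simp [sub_eq_add_neg]
  rw [h1] at this
  simpa [sub_eq_add_neg] using this

theorem sum {ι : Type*} {s : Finset ι} {Λ : ι → 𝓢'(E, ℂ)} {F : ι → E → ℂ}
    (h : ∀ i ∈ s, IsRepresentedBy (Λ i) (F i)) :
    IsRepresentedBy (∑ i ∈ s, Λ i) (fun x => ∑ i ∈ s, F i x) := by
  classical
  induction s using Finset.induction_on with
  | empty =>
    simp only [Finset.sum_empty]
    exact ⟨locallyIntegrable_const 0, fun φ => by simp, fun φ => by simp⟩
  | insert i s hi ih =>
    simp only [Finset.sum_insert hi]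
    exact (h i (Finset.mem_insert_self i s)).add
      (ih fun j hj => h j (Finset.mem_insert_of_mem hj))

theorem smulLeftCLM (h : IsRepresentedBy Λ F) {g : E → ℂ} (hg : g.HasTemperateGrowth) :
    IsRepresentedBy (smulLeftCLM ℂ g Λ) (fun x => g x * F x) where
  locallyIntegrable := by
    have := (h.locallyIntegrable.locallyIntegrableOn univ).continuousOn_mul hg.1.continuous.continuousOn
      isOpen_univ.isLocallyClosed
    exact locallyIntegrableOn_univ.1 this
  integrable φ := by
    have := h.integrable (SchwartzMap.smulLeftCLM ℂ g φ)
    refine this.congr (Filter.Eventually.of_forall fun x => ?_)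
    simp only [SchwartzMap.smulLeftCLM_apply_apply hg, smul_eq_mul]
    ring
  apply_eq φ := by
    rw [smulLeftCLM_apply_apply, h.apply_eq]
    refine integral_congr_ae (Filter.Eventually.of_forall fun x => ?_)
    simp only [SchwartzMap.smulLeftCLM_apply_apply hg, smul_eq_mul]
    ring

theorem ae_eq (h : IsRepresentedBy Λ F) (h' : IsRepresentedBy Λ F') : F =ᵐ[volume] F' := by
  refine ae_eq_of_integral_contDiff_smul_eq h.locallyIntegrable h'.locallyIntegrable
    fun g hg hgc => ?_
  have hgc' : HasCompactSupport (fun x => (g x : ℂ)) := hgc.comp_left (g := Complex.ofReal) rfl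
  let φ := hgc'.toSchwartzMap (Complex.ofRealCLM.contDiff.comp hg)
  have h1 := h.apply_eq φ
  rw [h'.apply_eq φ] at h1
  simp only [Complex.real_smul]
  exact h1.symm

theorem of_Lp (f : Lp ℂ 2 (volume : Measure E)) : IsRepresentedBy (f : 𝓢'(E, ℂ)) f where
  locallyIntegrable := (Lp.memLp f).locallyIntegrable (by norm_num)
  integrable φ := (φ.memLp 2).integrable_mul (Lp.memLp f)
  apply_eq φ := by simp [Lp.toTemperedDistribution_apply]

theorem fourier_of_Lp (f : Lp ℂ 2 (volume : Measure E)) :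
    IsRepresentedBy (𝓕 (f : 𝓢'(E, ℂ))) (𝓕 f : Lp ℂ 2 (volume : Measure E)) := by
  rw [Lp.fourier_toTemperedDistribution_eq]
  exact of_Lp _

theorem fourier_lineDerivOp (h : IsRepresentedBy (𝓕 Λ) F) (m : E) :
    IsRepresentedBy (𝓕 (∂_{m} Λ)) (fun ξ => (2 * Real.pi * Complex.I) * ((inner ℝ ξ m : ℝ) * F ξ)) := by
  rw [TemperedDistribution.fourier_lineDerivOp_eq]
  exact (h.smulLeftCLM (by fun_prop)).smul _

end TemperedDistribution.IsRepresentedBy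

/-- On `L¹ ∩ L²` the `L²` Fourier transform is given by the Fourier integral. -/
theorem Lp.fourier_ae_eq_of_integrable (f : Lp ℂ 2 (volume : Measure E)) (hf : Integrable f) :
    (𝓕 f : Lp ℂ 2 (volume : Measure E)) =ᵐ[volume] 𝓕 (f : E → ℂ) := by
  have hcont : Continuous (𝓕 (f : E → ℂ)) :=
    VectorFourier.fourierIntegral_continuous Real.continuous_fourierChar
      (L := innerₗ E) continuous_inner hf
  have hb : ∀ x, ‖𝓕 (f : E → ℂ) x‖ ≤ ∫ y, ‖f y‖ := fun x =>
    VectorFourier.norm_fourierIntegral_le_integral_norm _ _ _ _ _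
  refine (TemperedDistribution.IsRepresentedBy.fourier_of_Lp f).ae_eq
    ⟨hcont.locallyIntegrable, fun φ => ?_, fun φ => ?_⟩
  · exact φ.integrable.mul_bdd hcont.aestronglyMeasurable (Filter.Eventually.of_forall hb)
  · rw [TemperedDistribution.fourier_apply, Lp.toTemperedDistribution_apply]
    have := VectorFourier.integral_bilin_fourierIntegral_eq_flip (.lsmul ℂ ℂ) (L := innerₗ E)
      (μ := volume) (ν := volume) Real.continuous_fourierChar continuous_inner φ.integrable hf
    simpa using! this

theorem Lp.norm_fourier_le_integral (f : Lp ℂ 2 (volume : Measure E)) (hf : Integrable f) :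
    ∀ᵐ ξ, ‖(𝓕 f : Lp ℂ 2 (volume : Measure E)) ξ‖ ≤ ∫ x, ‖f x‖ := by
  filter_upwards [Lp.fourier_ae_eq_of_integrable f hf] with ξ hξ
  rw [hξ]
  exact VectorFourier.norm_fourierIntegral_le_integral_norm _ _ _ _ _

/-- A square-integrable function with integrable Fourier transform is essentially bounded. -/
theorem Lp.norm_le_integral_fourier (f : Lp ℂ 2 (volume : Measure E))
    (hf : Integrable (𝓕 f : Lp ℂ 2 (volume : Measure E))) :
    ∀ᵐ x, ‖f x‖ ≤ ∫ ξ, ‖(𝓕 f : Lp ℂ 2 (volume : Measure E)) ξ‖ := by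
  set g : Lp ℂ 2 (volume : Measure E) := 𝓕 f with hg
  have hcont : Continuous (𝓕 (g : E → ℂ)) :=
    VectorFourier.fourierIntegral_continuous Real.continuous_fourierChar
      (L := innerₗ E) continuous_inner hf
  have hb : ∀ x, ‖𝓕 (g : E → ℂ) x‖ ≤ ∫ y, ‖g y‖ := fun x =>
    VectorFourier.norm_fourierIntegral_le_integral_norm _ _ _ _ _
  have hrep : TemperedDistribution.IsRepresentedBy (f : 𝓢'(E, ℂ)) (𝓕⁻ (g : E → ℂ)) := by
    have hcont' : Continuous (𝓕⁻ (g : E → ℂ)) := by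
      have : (𝓕⁻ (g : E → ℂ)) = fun x => 𝓕 (g : E → ℂ) (-x) := by
        ext x; exact Real.fourierInv_eq_fourier_neg _ _
      rw [this]
      fun_prop
    refine ⟨hcont'.locallyIntegrable, fun φ => ?_, fun φ => ?_⟩
    · refine φ.integrable.mul_bdd hcont'.aestronglyMeasurable (c := ∫ y, ‖g y‖)
        (Filter.Eventually.of_forall fun x => ?_)
      rw [Real.fourierInv_eq_fourier_neg]
      exact hb _
    · have h1 : (f : 𝓢'(E, ℂ)) = 𝓕⁻ (g : 𝓢'(E, ℂ)) := by
        rw [hg, ← Lp.fourier_toTemperedDistribution_eq, fourierInv_fourier_eq]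
      rw [h1, TemperedDistribution.fourierInv_apply, Lp.toTemperedDistribution_apply]
      have := VectorFourier.integral_bilin_fourierIntegral_eq_flip (.lsmul ℂ ℂ) (L := -innerₗ E)
        (μ := volume) (ν := volume) Real.continuous_fourierChar (by
          have : Continuous fun p : E × E => -(inner ℝ p.1 p.2 : ℝ) := by fun_prop
          exact this) φ.integrable hf
      have hflip : (-innerₗ E).flip = -innerₗ E := by
        ext x y; simp [real_inner_comm]
      rw [hflip] at this
      simpa [SchwartzMap.fourierInv_coe] using! this
  filter_upwards [(TemperedDistribution.IsRepresentedBy.of_Lp f).ae_eq hrep] with x hx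
  rw [hx, Real.fourierInv_eq_fourier_neg]
  exact hb _

end FourierGeneralities

/-! ### Continuous paths in L² and in Sobolev spaces -/

section SquareIntegrableFamilies

open FourierTransform

variable {d : ℕ}

/-- The complex-valued `L²` class of a real function, with the junk value `0` for a function that
is not square integrable. -/
noncomputable def toL2 (f : Rd d → ℝ) : Lp ℂ 2 (volume : Measure (Rd d)) :=
  open Classical in
  if h : MemLp (fun x => (f x : ℂ)) 2 volume then h.toLp _ else 0

theorem coeFn_toL2 {f : Rd d → ℝ} (hf : MemLp f 2) : toL2 f =ᵐ[volume] fun x => (f x : ℂ) := by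
  have h : MemLp (fun x => (f x : ℂ)) 2 volume := hf.ofReal
  rw [toL2, dif_pos h]
  exact h.coeFn_toLp

theorem toL2_eq_of_ae_eq {f : Rd d → ℝ} (hf : MemLp f 2) {F : Lp ℂ 2 (volume : Measure (Rd d))}
    (h : ∀ᵐ x, (f x : ℂ) = F x) : toL2 f = F :=
  Lp.ext ((coeFn_toL2 hf).trans h)

theorem toL2_add {f g : Rd d → ℝ} (hf : MemLp f 2) (hg : MemLp g 2) :
    toL2 (fun x => f x + g x) = toL2 f + toL2 g := by
  refine toL2_eq_of_ae_eq (hf.add hg) ?_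
  filter_upwards [coeFn_toL2 hf, coeFn_toL2 hg, Lp.coeFn_add (toL2 f) (toL2 g)] with x h1 h2 h3
  have h4 : (toL2 f + toL2 g) x = toL2 f x + toL2 g x := h3
  rw [h4, h1, h2]; exact Complex.ofReal_add _ _

theorem toL2_sub {f g : Rd d → ℝ} (hf : MemLp f 2) (hg : MemLp g 2) :
    toL2 (fun x => f x - g x) = toL2 f - toL2 g := by
  refine toL2_eq_of_ae_eq (hf.sub hg) ?_
  filter_upwards [coeFn_toL2 hf, coeFn_toL2 hg, Lp.coeFn_sub (toL2 f) (toL2 g)] with x h1 h2 h3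
  have h4 : (toL2 f - toL2 g) x = toL2 f x - toL2 g x := h3
  rw [h4, h1, h2]; exact Complex.ofReal_sub _ _

theorem norm_toL2_mul_le {f g : Rd d → ℝ} {B : ℝ} (hB : ∀ᵐ x, |f x| ≤ B) (hg : MemLp g 2)
    (hfg : MemLp (fun x => f x * g x) 2) : ‖toL2 (fun x => f x * g x)‖ ≤ B * ‖toL2 g‖ := by
  refine Lp.norm_le_mul_norm_of_ae_le_mul ?_
  filter_upwards [coeFn_toL2 hfg, coeFn_toL2 hg, hB] with x h1 h2 h3
  rw [h1, h2]
  simp only [Complex.norm_real, norm_mul, Real.norm_eq_abs]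
  gcongr

theorem re_inner_toL2 {f g : Rd d → ℝ} (hf : MemLp f 2) (hg : MemLp g 2) :
    (inner ℂ (toL2 f) (toL2 g)).re = ∫ x, f x * g x := by
  rw [L2.inner_def]
  have : ∫ x, inner ℂ (toL2 f x) (toL2 g x) = ∫ x, ((f x * g x : ℝ) : ℂ) := by
    refine integral_congr_ae ?_
    filter_upwards [coeFn_toL2 hf, coeFn_toL2 hg] with x h1 h2
    rw [h1, h2]
    simp [mul_comm]
  rw [this, integral_complex_ofReal, Complex.ofReal_re]

theorem norm_sq_eq_integral (F : Lp ℂ 2 (volume : Measure (Rd d))) :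
    ‖F‖ ^ 2 = ∫ ξ, ‖F ξ‖ ^ 2 := by
  have h1 := inner_self_eq_norm_sq_to_K (𝕜 := ℂ) F
  rw [L2.inner_def] at h1
  have h2 : ∫ ξ, inner ℂ (F ξ) (F ξ) = ∫ ξ, ((‖F ξ‖ ^ 2 : ℝ) : ℂ) :=
    integral_congr_ae (Filter.Eventually.of_forall fun ξ => by
      simp [inner_self_eq_norm_sq_to_K])
  rw [h2, integral_complex_ofReal] at h1
  have h3 := congrArg Complex.re h1
  rw [Complex.ofReal_re] at h3
  rw [h3]
  norm_cast

theorem norm_sq_toL2 {f : Rd d → ℝ} (hf : MemLp f 2) : ‖toL2 f‖ ^ 2 = ∫ x, f x ^ 2 := by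
  have := re_inner_toL2 hf hf
  rw [inner_self_eq_norm_sq_to_K] at this
  simp_rw [← sq] at this
  rw [← this]
  norm_cast

/-- A family of functions on `ℝᵈ` that is continuous in time with values in `L²` and essentially
bounded, uniformly in time. Such families are closed under products. -/
structure BoundedL2Path (T : ℝ) (f : ℝ → Rd d → ℝ) : Prop where
  memLp : ∀ t ∈ Icc 0 T, MemLp (f t) 2
  bounded : ∃ B, 0 ≤ B ∧ ∀ t ∈ Icc 0 T, ∀ᵐ x, |f t x| ≤ B
  continuousOn : ContinuousOn (fun t => toL2 (f t)) (Icc 0 T)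

namespace BoundedL2Path

variable {T : ℝ} {f g : ℝ → Rd d → ℝ}

theorem const {φ : Rd d → ℝ} (hφ : MemLp φ 2) {B : ℝ} (hB : ∀ x, |φ x| ≤ B) :
    BoundedL2Path T (fun _ => φ) :=
  ⟨fun _ _ => hφ, ⟨B, (abs_nonneg _).trans (hB 0), fun _ _ => Filter.Eventually.of_forall hB⟩,
    continuousOn_const⟩

theorem add (hf : BoundedL2Path T f) (hg : BoundedL2Path T g) :
    BoundedL2Path T (fun t x => f t x + g t x) := by
  refine ⟨fun t ht => (hf.memLp t ht).add (hg.memLp t ht), ?_, ?_⟩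
  · obtain ⟨B, hB0, hB⟩ := hf.bounded
    obtain ⟨B', hB0', hB'⟩ := hg.bounded
    refine ⟨B + B', by positivity, fun t ht => ?_⟩
    filter_upwards [hB t ht, hB' t ht] with x h1 h2
    exact (abs_add_le _ _).trans (add_le_add h1 h2)
  · exact (hf.continuousOn.add hg.continuousOn).congr fun t ht =>
      toL2_add (hf.memLp t ht) (hg.memLp t ht)

theorem sub (hf : BoundedL2Path T f) (hg : BoundedL2Path T g) :
    BoundedL2Path T (fun t x => f t x - g t x) := by
  refine ⟨fun t ht => (hf.memLp t ht).sub (hg.memLp t ht), ?_, ?_⟩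
  · obtain ⟨B, hB0, hB⟩ := hf.bounded
    obtain ⟨B', hB0', hB'⟩ := hg.bounded
    refine ⟨B + B', by positivity, fun t ht => ?_⟩
    filter_upwards [hB t ht, hB' t ht] with x h1 h2
    rw [← Real.norm_eq_abs]
    exact (norm_sub_le _ _).trans (add_le_add h1 h2)
  · exact (hf.continuousOn.sub hg.continuousOn).congr fun t ht =>
      toL2_sub (hf.memLp t ht) (hg.memLp t ht)

theorem memLp_top (hf : BoundedL2Path T f) {t : ℝ} (ht : t ∈ Icc 0 T) : MemLp (f t) ∞ := by
  obtain ⟨B, -, hB⟩ := hf.bounded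
  exact memLp_top_of_bound (hf.memLp t ht).1 B (hB t ht)

theorem memLp_mul (hf : BoundedL2Path T f) {t : ℝ} (ht : t ∈ Icc 0 T) {φ : Rd d → ℝ}
    (hφ : MemLp φ 2) : MemLp (fun x => f t x * φ x) 2 :=
  hφ.mul' (hf.memLp_top ht)

theorem mul (hf : BoundedL2Path T f) (hg : BoundedL2Path T g) :
    BoundedL2Path T (fun t x => f t x * g t x) := by
  have hmem : ∀ t ∈ Icc 0 T, MemLp (fun x => f t x * g t x) 2 :=
    fun t ht => hf.memLp_mul ht (hg.memLp t ht)
  obtain ⟨B, hB0, hB⟩ := hf.bounded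
  obtain ⟨B', hB0', hB'⟩ := hg.bounded
  refine ⟨hmem, ⟨B * B', by positivity, fun t ht => ?_⟩, fun t ht => ?_⟩
  · filter_upwards [hB t ht, hB' t ht] with x h1 h2
    rw [abs_mul]
    gcongr
  · have hle : ∀ s ∈ Icc 0 T, ‖toL2 (fun x => f s x * g s x) - toL2 (fun x => f t x * g t x)‖
        ≤ B * ‖toL2 (g s) - toL2 (g t)‖ + B' * ‖toL2 (f s) - toL2 (f t)‖ := by
      intro s hs
      have h1 : MemLp (fun x => f s x * (g s x - g t x)) 2 :=
        hf.memLp_mul hs ((hg.memLp s hs).sub (hg.memLp t ht))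
      have h2 : MemLp (fun x => g t x * (f s x - f t x)) 2 :=
        hg.memLp_mul ht ((hf.memLp s hs).sub (hf.memLp t ht))
      have h3 : toL2 (fun x => f s x * g s x) - toL2 (fun x => f t x * g t x)
          = toL2 (fun x => f s x * (g s x - g t x)) + toL2 (fun x => g t x * (f s x - f t x)) := by
        rw [← toL2_sub (hmem s hs) (hmem t ht), ← toL2_add h1 h2]
        congr 1
        ext x
        ring
      rw [h3, ← toL2_sub (hg.memLp s hs) (hg.memLp t ht), ← toL2_sub (hf.memLp s hs) (hf.memLp t ht)]
      exact (norm_add_le _ _).trans (add_le_add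
        (norm_toL2_mul_le (hB s hs) ((hg.memLp s hs).sub (hg.memLp t ht)) h1)
        (norm_toL2_mul_le (hB' t ht) ((hf.memLp s hs).sub (hf.memLp t ht)) h2))
    refine tendsto_iff_norm_sub_tendsto_zero.2 (squeeze_zero'
      (Filter.Eventually.of_forall fun _ => norm_nonneg _)
      (eventually_nhdsWithin_of_forall hle) ?_)
    have h1 := (tendsto_iff_norm_sub_tendsto_zero.1 (hg.continuousOn t ht)).const_mul B
    have h2 := (tendsto_iff_norm_sub_tendsto_zero.1 (hf.continuousOn t ht)).const_mul B'
    simpa using h1.add h2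

theorem integrable_mul (hf : BoundedL2Path T f) (hg : BoundedL2Path T g) {t : ℝ}
    (ht : t ∈ Icc 0 T) : Integrable (fun x => f t x * g t x) :=
  (hf.memLp t ht).integrable_mul (hg.memLp t ht)

theorem continuousOn_integral_mul (hf : BoundedL2Path T f) (hg : BoundedL2Path T g) :
    ContinuousOn (fun t => ∫ x, f t x * g t x) (Icc 0 T) := by
  have : ContinuousOn (fun t => (inner ℂ (toL2 (f t)) (toL2 (g t))).re) (Icc 0 T) :=
    Complex.continuous_re.comp_continuousOn (ContinuousOn.inner (𝕜 := ℂ) hf.continuousOn hg.continuousOn)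
  exact this.congr fun t ht => (re_inner_toL2 (hf.memLp t ht) (hg.memLp t ht)).symm

end BoundedL2Path

/-- Multiplication by a bounded function, as an operator on `L²`. -/
noncomputable def mulL2 (m : Rd d → ℂ) (hm : MemLp m ∞) :
    Lp ℂ 2 (volume : Measure (Rd d)) →L[ℂ] Lp ℂ 2 (volume : Measure (Rd d)) :=
  (ContinuousLinearMap.mul ℂ ℂ).holderL volume ∞ 2 2 (hm.toLp m)

theorem coeFn_mulL2 {m : Rd d → ℂ} (hm : MemLp m ∞) (f : Lp ℂ 2 (volume : Measure (Rd d))) :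
    mulL2 m hm f =ᵐ[volume] fun x => m x * f x := by
  have h := (ContinuousLinearMap.mul ℂ ℂ).coeFn_holder (r := 2) (hm.toLp m) f
  filter_upwards [h, hm.coeFn_toLp] with x h1 h2
  change ((ContinuousLinearMap.mul ℂ ℂ).holder 2 (hm.toLp m) f) x = _
  rw [h1, h2]
  rfl

theorem memLp_top_of_continuous {m : Rd d → ℂ} (hm : Continuous m) {C : ℝ}
    (hC : ∀ x, ‖m x‖ ≤ C) : MemLp m ∞ :=
  memLp_top_of_bound hm.aestronglyMeasurable C (Filter.Eventually.of_forall hC)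

theorem ContinuousInSobolev.memLp {s T : ℝ} {f : ℝ → Rd d → ℝ} (h : ContinuousInSobolev s T f)
    {t : ℝ} (ht : t ∈ Icc 0 T) : MemLp (f t) 2 := by
  obtain ⟨G, -, hG⟩ := h
  obtain ⟨hf, -⟩ := hG t ht
  simpa using hf.re

/-- The weighted Fourier transform `(1 + |ξ|²) ^ (s/2) f̂(t, ξ)` of a path in `Hˢ` is a continuous
path in `L²`. -/
theorem ContinuousInSobolev.exists_weighted_fourier {s T : ℝ} {f : ℝ → Rd d → ℝ}
    (h : ContinuousInSobolev s T f) :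
    ∃ G : ℝ → Lp ℂ 2 (volume : Measure (Rd d)), ContinuousOn G (Icc 0 T) ∧
      ∀ t ∈ Icc 0 T, ∀ᵐ ξ, (𝓕 (toL2 (f t)) : Lp ℂ 2 (volume : Measure (Rd d))) ξ
        = (((1 + ‖ξ‖ ^ 2) ^ (-s / 2) : ℝ) : ℂ) * G t ξ := by
  have h0 := h
  obtain ⟨G, hGc, hG⟩ := h
  refine ⟨fun t => 𝓕 (G t),
    (Lp.fourierTransformₗᵢ (Rd d) ℂ).continuous.comp_continuousOn hGc, fun t ht => ?_⟩
  obtain ⟨hf, hfG⟩ := hG t ht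
  have hto : hf.toLp _ = toL2 (f t) := by rw [toL2, dif_pos hf]
  rw [hto] at hfG
  have h1 : TemperedDistribution.IsRepresentedBy
      (𝓕 (TemperedDistribution.besselPotential (Rd d) ℂ s (toL2 (f t) : 𝓢'(Rd d, ℂ))))
      (fun ξ => (((1 + ‖ξ‖ ^ 2) ^ (s / 2) : ℝ) : ℂ) *
        (𝓕 (toL2 (f t)) : Lp ℂ 2 (volume : Measure (Rd d))) ξ) := by
    rw [TemperedDistribution.fourier_besselPotential_eq_smulLeftCLM_fourier_apply]
    exact (TemperedDistribution.IsRepresentedBy.fourier_of_Lp (toL2 (f t))).smulLeftCLM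
      (by fun_prop)
  rw [hfG] at h1
  filter_upwards [h1.ae_eq (TemperedDistribution.IsRepresentedBy.fourier_of_Lp (G t))] with ξ hξ
  rw [← hξ, ← mul_assoc, ← Complex.ofReal_mul, ← Real.rpow_add (by positivity)]
  simp [neg_div]

theorem norm_one_add_rpow_le {s : ℝ} (hs : 0 ≤ s) (ξ : Rd d) :
    ‖(((1 + ‖ξ‖ ^ 2) ^ (-s / 2) : ℝ) : ℂ)‖ ≤ 1 := by
  rw [Complex.norm_real, Real.norm_eq_abs, abs_of_nonneg (by positivity)]
  exact Real.rpow_le_one_of_one_le_of_nonpos (by simp) (by linarith)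

theorem continuous_one_add_rpow (s : ℝ) :
    Continuous fun ξ : Rd d => (((1 + ‖ξ‖ ^ 2) ^ (-s / 2) : ℝ) : ℂ) :=
  Complex.continuous_ofReal.comp (Continuous.rpow_const (by fun_prop)
    fun x => Or.inl (by positivity))

/-- A continuous path in `Hˢ`, `s > d/2`, is uniformly bounded: its Fourier transform is integrable,
by the Cauchy–Schwarz inequality against the weight. -/
theorem ContinuousInSobolev.boundedL2Path {s T : ℝ} {f : ℝ → Rd d → ℝ}
    (h : ContinuousInSobolev s T f) (hs : (d : ℝ) < 2 * s) : BoundedL2Path T f := by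
  obtain ⟨G, hGc, hG⟩ := h.exists_weighted_fourier
  have hs0 : 0 ≤ s := by have := Nat.cast_nonneg (α := ℝ) d; linarith
  set w : Rd d → ℂ := fun ξ => (((1 + ‖ξ‖ ^ 2) ^ (-s / 2) : ℝ) : ℂ) with hw
  have hwtop : MemLp w ∞ :=
    memLp_top_of_continuous (continuous_one_add_rpow s) (norm_one_add_rpow_le hs0)
  have hw2 : MemLp w 2 := by
    rw [memLp_two_iff_integrable_sq_norm (continuous_one_add_rpow s).aestronglyMeasurable]
    have h1 : Integrable (fun ξ : Rd d => (1 + ‖ξ‖ ^ 2) ^ (-(2 * s) / 2)) :=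
      integrable_rpow_neg_one_add_norm_sq (by simpa using hs)
    refine h1.congr (Filter.Eventually.of_forall fun ξ => ?_)
    simp only [Complex.norm_real, Real.norm_eq_abs, sq_abs]
    rw [← Real.rpow_natCast ((1 + ‖ξ‖ ^ 2) ^ (-s / 2)), ← Real.rpow_mul (by positivity)]
    congr 1
    push_cast
    ring
  have hhat : ∀ t ∈ Icc 0 T, 𝓕 (toL2 (f t)) = mulL2 w hwtop (G t) := fun t ht =>
    Lp.ext (Filter.EventuallyEq.trans (hG t ht) (coeFn_mulL2 hwtop (G t)).symm)
  refine ⟨fun t ht => h.memLp ht, ?_, ?_⟩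
  · obtain ⟨A, hA⟩ := isCompact_Icc.exists_bound_of_continuousOn hGc
    refine ⟨‖hw2.toLp w‖ * max A 0, by positivity, fun t ht => ?_⟩
    have hprod : Integrable (fun ξ => w ξ * G t ξ) := hw2.integrable_mul (Lp.memLp (G t))
    have hae : (𝓕 (toL2 (f t)) : Lp ℂ 2 (volume : Measure (Rd d))) =ᵐ[volume]
        fun ξ => w ξ * G t ξ := hG t ht
    have hint : Integrable (𝓕 (toL2 (f t)) : Lp ℂ 2 (volume : Measure (Rd d))) :=
      hprod.congr hae.symm
    have hbound : ∫ ξ, ‖(𝓕 (toL2 (f t)) : Lp ℂ 2 (volume : Measure (Rd d))) ξ‖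
        ≤ ‖hw2.toLp w‖ * ‖G t‖ := by
      have e1 : ∫ ξ, ‖(𝓕 (toL2 (f t)) : Lp ℂ 2 (volume : Measure (Rd d))) ξ‖
          = ∫ ξ, ‖w ξ‖ * ‖G t ξ‖ := by
        refine integral_congr_ae ?_
        filter_upwards [hae] with ξ hξ
        rw [hξ, norm_mul]
      have hcs := sq_integral_mul_le (μ := volume) (f := fun ξ => ‖w ξ‖) (g := fun ξ => ‖G t ξ‖)
        ((memLp_two_iff_integrable_sq_norm hw2.1).1 hw2)
        ((memLp_two_iff_integrable_sq_norm (Lp.memLp (G t)).1).1 (Lp.memLp (G t)))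
        (hprod.norm.congr (Filter.Eventually.of_forall fun ξ => norm_mul _ _))
      have e3 : ∫ ξ, ‖w ξ‖ ^ 2 = ‖hw2.toLp w‖ ^ 2 := by
        rw [norm_sq_eq_integral]
        refine integral_congr_ae ?_
        filter_upwards [hw2.coeFn_toLp] with ξ hξ
        rw [hξ]
      rw [e1]
      refine abs_le_of_sq_le_sq' ?_ (by positivity) |>.2
      rw [mul_pow, ← e3, norm_sq_eq_integral]
      exact hcs
    filter_upwards [Lp.norm_le_integral_fourier (toL2 (f t)) hint, coeFn_toL2 (h.memLp ht)]
      with x h1 h2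
    rw [h2, Complex.norm_real, Real.norm_eq_abs] at h1
    refine h1.trans (hbound.trans ?_)
    gcongr
    exact (hA t ht).trans (le_max_left _ _)
  · have : ContinuousOn (fun t => 𝓕⁻ (mulL2 w hwtop (G t))) (Icc 0 T) :=
      (Lp.fourierTransformₗᵢ (Rd d) ℂ).symm.continuous.comp_continuousOn
        ((mulL2 w hwtop).continuous.comp_continuousOn hGc)
    refine this.congr fun t ht => ?_
    simp only
    rw [← hhat t ht, fourierInv_fourier_eq]

/-- The Fourier transform `2πi ξⱼ f̂(t, ξ)` of the `j`-th derivative of a path in `Hˢ`, `s ≥ 1`, is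
a continuous path in `L²`. -/
theorem ContinuousInSobolev.exists_fourier_deriv {s T : ℝ} {f : ℝ → Rd d → ℝ}
    (h : ContinuousInSobolev s T f) (hs : 1 ≤ s) (j : Fin d) :
    ∃ G : ℝ → Lp ℂ 2 (volume : Measure (Rd d)), ContinuousOn G (Icc 0 T) ∧
      ∀ t ∈ Icc 0 T, ∀ᵐ ξ, G t ξ = (2 * Real.pi * Complex.I) * ((ξ j : ℝ) *
        (𝓕 (toL2 (f t)) : Lp ℂ 2 (volume : Measure (Rd d))) ξ) := by
  obtain ⟨G, hGc, hG⟩ := h.exists_weighted_fourier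
  set m : Rd d → ℂ := fun ξ => (2 * Real.pi * Complex.I) * ((ξ j : ℝ) *
    (((1 + ‖ξ‖ ^ 2) ^ (-s / 2) : ℝ) : ℂ)) with hm
  have hmtop : MemLp m ∞ := by
    refine memLp_top_of_continuous (C := 2 * Real.pi) ?_ fun ξ => ?_
    · have := continuous_one_add_rpow (d := d) s
      fun_prop
    · have h1 : |ξ j| ≤ (1 + ‖ξ‖ ^ 2) ^ (1 / 2 : ℝ) := by
        rw [← Real.sqrt_eq_rpow]
        refine Real.le_sqrt_of_sq_le ?_
        rw [sq_abs]
        have := EuclideanSpace.real_norm_sq_eq ξ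
        have h2 := Finset.single_le_sum (f := fun i => ξ i ^ 2) (fun i _ => sq_nonneg _)
          (Finset.mem_univ j)
        simp only at h2
        linarith
      have h2 : |(1 + ‖ξ‖ ^ 2) ^ (-s / 2)| ≤ (1 + ‖ξ‖ ^ 2) ^ (-(1 / 2) : ℝ) := by
        rw [abs_of_nonneg (by positivity)]
        exact Real.rpow_le_rpow_of_exponent_le (by simp) (by linarith)
      have h3 : |ξ j| * |(1 + ‖ξ‖ ^ 2) ^ (-s / 2)| ≤ 1 := by
        calc _ ≤ (1 + ‖ξ‖ ^ 2) ^ (1 / 2 : ℝ) * (1 + ‖ξ‖ ^ 2) ^ (-(1 / 2) : ℝ) := by gcongr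
          _ = 1 := by rw [← Real.rpow_add (by positivity)]; simp
      have h4 : ‖(2 * Real.pi * Complex.I : ℂ)‖ = 2 * Real.pi := by
        simp [abs_of_pos Real.pi_pos]
      rw [hm, norm_mul, h4, norm_mul, Complex.norm_real, Complex.norm_real, Real.norm_eq_abs,
        Real.norm_eq_abs]
      exact mul_le_of_le_one_right (by positivity) h3
  refine ⟨fun t => mulL2 m hmtop (G t), (mulL2 m hmtop).continuous.comp_continuousOn hGc,
    fun t ht => ?_⟩
  filter_upwards [coeFn_mulL2 hmtop (G t), hG t ht] with ξ h1 h2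
  rw [h1, h2, hm]
  ring

end SquareIntegrableFamilies

/-! ### Balance laws on Euclidean space -/

section Calculus

open scoped ContDiff

variable {d : ℕ} {G : Type*} [NormedAddCommGroup G] [NormedSpace ℝ G]

theorem hasDerivAt_time {T : ℝ} {f : ℝ → Rd d → G}
    (hf : ContDiffOn ℝ 1 (fun z : ℝ × Rd d => f z.1 z.2) (Ioo 0 T ×ˢ univ)) {t : ℝ}
    (ht : t ∈ Ioo 0 T) (x : Rd d) :
    HasDerivAt (fun τ => f τ x) (fderiv ℝ (fun z : ℝ × Rd d => f z.1 z.2) (t, x) (1, 0)) t := by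
  have hU : IsOpen (Ioo 0 T ×ˢ (univ : Set (Rd d))) := isOpen_Ioo.prod isOpen_univ
  have h1 : DifferentiableAt ℝ (fun z : ℝ × Rd d => f z.1 z.2) (t, x) :=
    (hf.differentiableOn one_ne_zero).differentiableAt (hU.mem_nhds ⟨ht, mem_univ x⟩)
  have h2 : HasDerivAt (fun τ : ℝ => (τ, x)) ((1 : ℝ), (0 : Rd d)) t :=
    (hasDerivAt_id t).prodMk (hasDerivAt_const t x)
  exact h1.hasFDerivAt.comp_hasDerivAt t h2

theorem continuousOn_deriv_time {T : ℝ} {f : ℝ → Rd d → G}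
    (hf : ContDiffOn ℝ 1 (fun z : ℝ × Rd d => f z.1 z.2) (Ioo 0 T ×ˢ univ)) :
    ContinuousOn (fun z : ℝ × Rd d => deriv (fun τ => f τ z.2) z.1) (Ioo 0 T ×ˢ univ) := by
  have hU : IsOpen (Ioo 0 T ×ˢ (univ : Set (Rd d))) := isOpen_Ioo.prod isOpen_univ
  have h1 := (hf.continuousOn_fderiv_of_isOpen hU le_rfl).clm_apply
    (continuousOn_const (c := ((1 : ℝ), (0 : Rd d))))
  exact h1.congr fun z hz => (hasDerivAt_time hf hz.1 z.2).deriv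

theorem contDiff_slice {T : ℝ} {f : ℝ → Rd d → G}
    (hf : ContDiffOn ℝ 1 (fun z : ℝ × Rd d => f z.1 z.2) (Ioo 0 T ×ˢ univ)) {t : ℝ}
    (ht : t ∈ Ioo 0 T) : ContDiff ℝ 1 (f t) := by
  rw [← contDiffOn_univ]
  exact hf.comp (s := univ) (f := fun x => (t, x))
    (contDiff_const.prodMk contDiff_id).contDiffOn fun x _ => ⟨ht, mem_univ _⟩

theorem pderiv_mul {j : Fin d} {f g : Rd d → ℝ} {x : Rd d} (hf : DifferentiableAt ℝ f x)
    (hg : DifferentiableAt ℝ g x) :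
    pderiv j (fun y => f y * g y) x = f x * pderiv j g x + pderiv j f x * g x := by
  rw [pderiv, fderiv_fun_mul hf hg]
  simp only [pderiv, add_apply, smul_apply, smul_eq_mul]
  ring

theorem pderiv_apply {j i : Fin d} {f : Rd d → Rd d} {x : Rd d} (hf : DifferentiableAt ℝ f x) :
    pderiv j f x i = pderiv j (fun y => f y i) x := by
  have h := ((EuclideanSpace.proj (𝕜 := ℝ) i).hasFDerivAt.comp x hf.hasFDerivAt).fderiv
  have h2 : fderiv ℝ (fun y => f y i) x = (EuclideanSpace.proj (𝕜 := ℝ) i).comp (fderiv ℝ f x) := h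
  rw [pderiv, pderiv, h2]
  rfl

theorem continuous_pderiv {j : Fin d} {f : Rd d → G} (hf : ContDiff ℝ 1 f) :
    Continuous (pderiv j f) :=
  (hf.continuous_fderiv one_ne_zero).clm_apply continuous_const

theorem HasCompactSupport.pderiv {j : Fin d} {f : Rd d → G} (hf : HasCompactSupport f) :
    HasCompactSupport (pderiv j f) :=
  hf.fderiv_apply ℝ _

/-- Integration by parts against a compactly supported function. -/
theorem integral_mul_pderiv_eq_neg {j : Fin d} {φ g : Rd d → ℝ} (hφ : ContDiff ℝ 1 φ)
    (hφc : HasCompactSupport φ) (hg : ContDiff ℝ 1 g) :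
    ∫ x, φ x * pderiv j g x = -∫ x, pderiv j φ x * g x := by
  refine integral_mul_fderiv_eq_neg_fderiv_mul_of_integrable ?_ ?_ ?_
    (fun x _ => hφ.differentiable one_ne_zero x) (fun x _ => hg.differentiable one_ne_zero x)
  · exact ((continuous_pderiv hφ).mul hg.continuous).integrable_of_hasCompactSupport
      (hφc.pderiv.mul_right)
  · exact (hφ.continuous.mul (continuous_pderiv hg)).integrable_of_hasCompactSupport hφc.mul_right
  · exact (hφ.continuous.mul hg.continuous).integrable_of_hasCompactSupport hφc.mul_right

/-- Differentiation under the integral sign against a compactly supported weight. -/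
theorem hasDerivAt_integral_mul {T : ℝ} {q : ℝ → Rd d → ℝ}
    (hq : ContDiffOn ℝ 1 (fun z : ℝ × Rd d => q z.1 z.2) (Ioo 0 T ×ˢ univ)) {φ : Rd d → ℝ}
    (hφ : Continuous φ) (hφc : HasCompactSupport φ) {t : ℝ} (ht : t ∈ Ioo 0 T) :
    HasDerivAt (fun τ => ∫ x, φ x * q τ x) (∫ x, φ x * deriv (fun τ => q τ x) t) t := by
  obtain ⟨ε, hε, hball⟩ := Metric.nhds_basis_closedBall.mem_iff.1 (isOpen_Ioo.mem_nhds ht)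
  have hcont : ∀ τ ∈ Ioo 0 T, Continuous (q τ) := fun τ hτ => (contDiff_slice hq hτ).continuous
  have hdc : ∀ τ ∈ Ioo 0 T, Continuous fun x => deriv (fun s => q s x) τ := by
    intro τ hτ
    rw [← continuousOn_univ]
    exact (continuousOn_deriv_time hq).comp (f := fun x => (τ, x)) (by fun_prop)
      fun x _ => ⟨hτ, mem_univ x⟩
  obtain ⟨A, hA⟩ := ((isCompact_closedBall t ε).prod hφc).exists_bound_of_continuousOn
    ((continuousOn_deriv_time hq).mono (prod_mono hball (subset_univ _)))
  refine (hasDerivAt_integral_of_dominated_loc_of_deriv_le (𝕜 := ℝ) (μ := volume)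
    (F := fun τ x => φ x * q τ x) (F' := fun τ x => φ x * deriv (fun s => q s x) τ)
    (s := Metric.closedBall t ε) (bound := fun x => A * |φ x|) (Metric.closedBall_mem_nhds t hε)
    ?_ ?_ ?_ ?_ ?_ ?_).2
  · filter_upwards [isOpen_Ioo.mem_nhds ht] with τ hτ
    exact (hφ.mul (hcont τ hτ)).aestronglyMeasurable
  · exact (hφ.mul (hcont t ht)).integrable_of_hasCompactSupport hφc.mul_right
  · exact (hφ.mul (hdc t ht)).aestronglyMeasurable
  · refine Filter.Eventually.of_forall fun x τ hτ => ?_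
    by_cases hx : x ∈ tsupport φ
    · rw [norm_mul, mul_comm, Real.norm_eq_abs (φ x)]
      exact mul_le_mul_of_nonneg_right (hA (τ, x) ⟨hτ, hx⟩) (abs_nonneg _)
    · simp [image_eq_zero_of_notMem_tsupport hx]
  · exact (hφ.abs.integrable_of_hasCompactSupport hφc.abs).const_mul A
  · refine Filter.Eventually.of_forall fun x τ hτ => ?_
    exact ((hasDerivAt_time hq (hball hτ) x).differentiableAt.hasDerivAt).const_mul (φ x)

/-- Cutoff functions converging to `1` whose gradients tend uniformly to zero. -/
theorem exists_cutoff (d : ℕ) : ∃ (χ : ℕ → Rd d → ℝ) (A : ℝ), 0 ≤ A ∧ (∀ n, ContDiff ℝ ∞ (χ n)) ∧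
    (∀ n, HasCompactSupport (χ n)) ∧ (∀ n x, 0 ≤ χ n x) ∧ (∀ n x, χ n x ≤ 1) ∧
    (∀ x, Filter.Tendsto (fun n => χ n x) Filter.atTop (nhds 1)) ∧
    ∀ n j x, |pderiv j (χ n) x| ≤ A * (1 / ((n : ℝ) + 1)) := by
  let χ : ContDiffBump (0 : Rd d) := ⟨1, 2, one_pos, one_lt_two⟩
  have hχs : ContDiff ℝ ∞ (χ : Rd d → ℝ) := χ.contDiff
  let c : ℕ → ℝ := fun n => 1 / ((n : ℝ) + 1)
  have hc0 : ∀ n, 0 < c n := fun n => by positivity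
  obtain ⟨A, hA⟩ := (hχs.continuous_fderiv (by simp)).bounded_above_of_compact_support
    (χ.hasCompactSupport.fderiv ℝ)
  refine ⟨fun n x => χ (c n • x), A, (norm_nonneg _).trans (hA 0),
    fun n => hχs.comp (contDiff_const_smul (c n)),
    fun n => χ.hasCompactSupport.comp_homeomorph (Homeomorph.smulOfNeZero (c n) (hc0 n).ne'),
    fun n x => χ.nonneg, fun n x => χ.le_one, fun x => ?_, fun n j x => ?_⟩
  · have h1 : Filter.Tendsto (fun n => c n * ‖x‖) Filter.atTop (nhds 0) := by
      simpa [c] using (tendsto_one_div_add_atTop_nhds_zero_nat (𝕜 := ℝ)).mul_const ‖x‖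
    refine tendsto_const_nhds.congr' ?_
    filter_upwards [h1.eventually_lt_const one_pos] with n hn
    refine (χ.one_of_mem_closedBall ?_).symm
    rw [mem_closedBall_zero_iff, norm_smul, Real.norm_eq_abs, abs_of_pos (hc0 n)]
    exact hn.le
  · have h1 : HasFDerivAt (fun x => χ (c n • x))
        ((fderiv ℝ χ (c n • x)).comp (c n • ContinuousLinearMap.id ℝ (Rd d))) x :=
      (hχs.differentiable (by simp) _).hasFDerivAt.comp x ((hasFDerivAt_id x).const_smul (c n))
    rw [pderiv, h1.fderiv, ← Real.norm_eq_abs]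
    simp only [ContinuousLinearMap.comp_apply, smul_apply, map_smul, norm_smul, Real.norm_eq_abs,
      abs_of_pos (hc0 n)]
    rw [mul_comm]
    refine mul_le_mul_of_nonneg_right ?_ (hc0 n).le
    refine ((fderiv ℝ χ (c n • x)).le_opNorm _).trans ?_
    simpa using hA (c n • x)

/-- Fundamental theorem of calculus for a function differentiable in the open interval whose
derivative extends continuously to the closed one. -/
theorem integral_eq_sub_of_hasDerivAt_Ioo {T : ℝ} {f g : ℝ → ℝ} (hf : ContinuousOn f (Icc 0 T))
    (hg : ContinuousOn g (Icc 0 T)) (h : ∀ t ∈ Ioo 0 T, HasDerivAt f (g t) t) {a b : ℝ}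
    (ha : 0 ≤ a) (hab : a ≤ b) (hb : b ≤ T) : ∫ τ in a..b, g τ = f b - f a := by
  have hsub : Icc a b ⊆ Icc 0 T := Icc_subset_Icc ha hb
  exact intervalIntegral.integral_eq_sub_of_hasDerivAt_of_le hab (hf.mono hsub)
    (fun t ht => h t ⟨ha.trans_lt ht.1, ht.2.trans_le hb⟩)
    ((hg.mono (by rwa [uIcc_of_le hab])).intervalIntegrable)

end Calculus

section BalanceLaws

open scoped ContDiff

variable {d : ℕ} {T : ℝ} {q S : ℝ → Rd d → ℝ} {J : Fin d → ℝ → Rd d → ℝ}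

theorem Continuous.boundedL2Path {φ : Rd d → ℝ} (hφ : Continuous φ) (hφc : HasCompactSupport φ) :
    BoundedL2Path T (fun _ => φ) := by
  obtain ⟨B, hB⟩ := hφ.bounded_above_of_compact_support hφc
  exact BoundedL2Path.const (hφ.memLp_of_hasCompactSupport hφc) hB

/-- A balance law `∂ₜ q + ∇ · J = S`, tested with a compactly supported function and integrated in
time. -/
theorem balance_law_local (hqc : ContDiffOn ℝ 1 (fun z : ℝ × Rd d => q z.1 z.2) (Ioo 0 T ×ˢ univ))
    (hJc : ∀ j, ∀ t ∈ Ioo 0 T, ContDiff ℝ 1 (J j t)) (hSc : ∀ t ∈ Ioo 0 T, Continuous (S t))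
    (heq : ∀ t ∈ Ioo 0 T, ∀ x, deriv (fun τ => q τ x) t + ∑ j, pderiv j (J j t) x = S t x)
    (hq : BoundedL2Path T q) (hJ : ∀ j, BoundedL2Path T (J j)) (hS : BoundedL2Path T S)
    {φ : Rd d → ℝ} (hφ : ContDiff ℝ 1 φ) (hφc : HasCompactSupport φ) {a b : ℝ} (ha : 0 ≤ a)
    (hab : a ≤ b) (hb : b ≤ T) :
    (∫ x, φ x * q b x) - ∫ x, φ x * q a x
      = ∫ τ in a..b, ((∑ j, ∫ x, pderiv j φ x * J j τ x) + ∫ x, φ x * S τ x) := by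
  have hφp : BoundedL2Path T (fun _ => φ) := Continuous.boundedL2Path hφ.continuous hφc
  have hφp' : ∀ j, BoundedL2Path T (fun _ => pderiv j φ) := fun j =>
    Continuous.boundedL2Path (continuous_pderiv hφ) hφc.pderiv
  refine (integral_eq_sub_of_hasDerivAt_Ioo (T := T) (f := fun τ => ∫ x, φ x * q τ x)
    (hφp.continuousOn_integral_mul hq) ?_ (fun t ht => ?_) ha hab hb).symm
  · exact (continuousOn_finsetSum _ fun j _ => (hφp' j).continuousOn_integral_mul (hJ j)).add
      (hφp.continuousOn_integral_mul hS)
  · have h1 := hasDerivAt_integral_mul hqc hφ.continuous hφc ht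
    refine h1.congr_deriv ?_
    have hint : ∀ j, Integrable (fun x => φ x * pderiv j (J j t) x) := fun j =>
      (hφ.continuous.mul (continuous_pderiv (hJc j t ht))).integrable_of_hasCompactSupport
        hφc.mul_right
    have hintS : Integrable (fun x => φ x * S t x) :=
      (hφ.continuous.mul (hSc t ht)).integrable_of_hasCompactSupport hφc.mul_right
    have h2 : ∀ x, φ x * deriv (fun τ => q τ x) t
        = φ x * S t x - ∑ j, φ x * pderiv j (J j t) x := fun x => by
      rw [← heq t ht x, ← Finset.mul_sum]
      ring
    simp_rw [h2]
    rw [integral_sub hintS (integrable_finsetSum _ fun j _ => hint j),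
      integral_finsetSum _ fun j _ => hint j]
    simp_rw [integral_mul_pderiv_eq_neg hφ hφc (hJc _ t ht)]
    rw [Finset.sum_neg_distrib]
    ring

theorem BoundedL2Path.exists_integral_abs_mul_le {f g : ℝ → Rd d → ℝ} (hf : BoundedL2Path T f)
    (hg : BoundedL2Path T g) :
    ∃ B, 0 ≤ B ∧ ∀ t ∈ Icc 0 T, ∫ x, |f t x * g t x| ≤ B := by
  obtain ⟨A, hA⟩ := isCompact_Icc.exists_bound_of_continuousOn
    ((hf.continuousOn_integral_mul hf).add (hg.continuousOn_integral_mul hg))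
  refine ⟨max A 0, le_max_right _ _, fun t ht => ?_⟩
  refine le_trans ?_ ((Real.le_norm_self _).trans ((hA t ht).trans (le_max_left _ _)))
  simp only [Pi.add_apply]
  rw [← integral_add (hf.integrable_mul hf ht) (hg.integrable_mul hg ht)]
  refine integral_mono (hf.integrable_mul hg ht).abs
    ((hf.integrable_mul hf ht).add (hg.integrable_mul hg ht)) fun x => ?_
  rw [abs_le]
  constructor <;> simp only <;>
  nlinarith [sq_nonneg (f t x + g t x), sq_nonneg (f t x - g t x), sq_nonneg (f t x),
    sq_nonneg (g t x)]

/-- The flux terms of a balance law tested with the cutoffs of `exists_cutoff` vanish in the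
limit. -/
theorem abs_sum_flux_le {J : Fin d → Rd d → ℝ} {φ : Rd d → ℝ} {A B : ℝ}
    (hJi : ∀ j, Integrable (J j)) (hB : ∀ j, ∫ x, |J j x| ≤ B)
    (hA : ∀ j x, |pderiv j φ x| ≤ A) (hA0 : 0 ≤ A) :
    |∑ j, ∫ x, pderiv j φ x * J j x| ≤ d * (A * B) := by
  refine (Finset.abs_sum_le_sum_abs _ _).trans ?_
  have : ∀ j ∈ (Finset.univ : Finset (Fin d)), |∫ x, pderiv j φ x * J j x| ≤ A * B := by
    intro j _
    calc |∫ x, pderiv j φ x * J j x| ≤ ∫ x, A * |J j x| := by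
          rw [← Real.norm_eq_abs]
          refine norm_integral_le_of_norm_le ((hJi j).abs.const_mul A)
            (Filter.Eventually.of_forall fun x => ?_)
          rw [norm_mul, Real.norm_eq_abs, Real.norm_eq_abs]
          exact mul_le_mul_of_nonneg_right (hA j x) (abs_nonneg _)
      _ = A * ∫ x, |J j x| := integral_const_mul _ _
      _ ≤ A * B := mul_le_mul_of_nonneg_left (hB j) hA0
  refine (Finset.sum_le_card_nsmul _ _ _ this).trans_eq ?_
  simp

/-- A balance law `∂ₜ q + ∇ · J = S` with integrable density, flux and source, integrated over the
whole space. -/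
theorem balance_law_global
    (hqc : ContDiffOn ℝ 1 (fun z : ℝ × Rd d => q z.1 z.2) (Ioo 0 T ×ˢ univ))
    (hJc : ∀ j, ∀ t ∈ Ioo 0 T, ContDiff ℝ 1 (J j t)) (hSc : ∀ t ∈ Ioo 0 T, Continuous (S t))
    (heq : ∀ t ∈ Ioo 0 T, ∀ x, deriv (fun τ => q τ x) t + ∑ j, pderiv j (J j t) x = S t x)
    (hq : BoundedL2Path T q) (hJ : ∀ j, BoundedL2Path T (J j)) (hS : BoundedL2Path T S)
    (hqi : ∀ t ∈ Icc 0 T, Integrable (q t)) (hJi : ∀ j, ∀ t ∈ Icc 0 T, Integrable (J j t))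
    (hSi : ∀ t ∈ Icc 0 T, Integrable (S t)) {B : ℝ}
    (hJB : ∀ j, ∀ t ∈ Icc 0 T, ∫ x, |J j t x| ≤ B) (hSB : ∀ t ∈ Icc 0 T, ∫ x, |S t x| ≤ B)
    {a b : ℝ} (ha : 0 ≤ a) (hab : a ≤ b) (hb : b ≤ T) :
    (∫ x, q b x) - ∫ x, q a x = ∫ τ in a..b, ∫ x, S τ x := by
  obtain ⟨χ, A, hA0, hχs, hχc, hχ0, hχ1, hχlim, hχd⟩ := exists_cutoff d
  have hχs1 : ∀ n, ContDiff ℝ 1 (χ n) := fun n => (hχs n).of_le (by simp)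
  have hloc := fun n => balance_law_local hqc hJc hSc heq hq hJ hS (hχs1 n) (hχc n) ha hab hb
  have hab' : Icc a b ⊆ Icc 0 T := Icc_subset_Icc ha hb
  have hlim : ∀ f : Rd d → ℝ, Integrable f →
      Filter.Tendsto (fun n => ∫ x, χ n x * f x) Filter.atTop (nhds (∫ x, f x)) := by
    intro f hf
    refine tendsto_integral_of_dominated_convergence (fun x => |f x|)
      (fun n => ((hχs n).continuous.aestronglyMeasurable).mul hf.1) hf.abs
      (fun n => Filter.Eventually.of_forall fun x => ?_)
      (Filter.Eventually.of_forall fun x => ?_)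
    · rw [norm_mul, Real.norm_eq_abs, Real.norm_eq_abs, abs_of_nonneg (hχ0 n x)]
      exact mul_le_of_le_one_left (abs_nonneg _) (hχ1 n x)
    · simpa using (hχlim x).mul_const (f x)
  have hleft := (hlim _ (hqi b (hab' ⟨hab, le_rfl⟩))).sub (hlim _ (hqi a (hab' ⟨le_rfl, hab⟩)))
  refine tendsto_nhds_unique hleft ?_
  simp_rw [hloc]
  have hc0 : ∀ n : ℕ, (0 : ℝ) ≤ 1 / ((n : ℝ) + 1) := fun n => by positivity
  have hc1 : ∀ n : ℕ, 1 / ((n : ℝ) + 1) ≤ 1 := fun n => by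
    rw [div_le_one (by positivity)]
    linarith [Nat.cast_nonneg (α := ℝ) n]
  have hflux : ∀ n, ∀ τ ∈ Icc a b, |∑ j, ∫ x, pderiv j (χ n) x * J j τ x|
      ≤ d * (A * (1 / ((n : ℝ) + 1)) * B) := fun n τ hτ =>
    abs_sum_flux_le (fun j => hJi j τ (hab' hτ)) (fun j => hJB j τ (hab' hτ))
      (fun j x => hχd n j x) (mul_nonneg hA0 (hc0 n))
  have hB0 : 0 ≤ B := (integral_nonneg fun x => abs_nonneg _).trans (hSB a (hab' ⟨le_rfl, hab⟩))
  have hsrc : ∀ n, ∀ τ ∈ Icc a b, |∫ x, χ n x * S τ x| ≤ B := by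
    intro n τ hτ
    refine le_trans ?_ (hSB τ (hab' hτ))
    rw [← Real.norm_eq_abs]
    refine norm_integral_le_of_norm_le (hSi τ (hab' hτ)).abs
      (Filter.Eventually.of_forall fun x => ?_)
    rw [norm_mul, Real.norm_eq_abs, Real.norm_eq_abs, abs_of_nonneg (hχ0 n x)]
    exact mul_le_of_le_one_left (abs_nonneg _) (hχ1 n x)
  have hIoc : ∀ τ, τ ∈ uIoc a b → τ ∈ Icc a b := fun τ hτ => by
    rw [uIoc_of_le hab] at hτ
    exact Ioc_subset_Icc_self hτ
  refine intervalIntegral.tendsto_integral_filter_of_dominated_convergence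
    (fun _ => d * (A * 1 * B) + B) (Filter.Eventually.of_forall fun n => ?_)
    (Filter.Eventually.of_forall fun n => Filter.Eventually.of_forall fun τ hτ => ?_)
    intervalIntegrable_const (Filter.Eventually.of_forall fun τ hτ => ?_)
  · have hc : ContinuousOn (fun τ => (∑ j, ∫ x, pderiv j (χ n) x * J j τ x) + ∫ x, χ n x * S τ x)
        (Icc 0 T) :=
      (continuousOn_finsetSum _ fun j _ => (Continuous.boundedL2Path
        (continuous_pderiv (hχs1 n)) (hχc n).pderiv).continuousOn_integral_mul (hJ j)).add
      ((Continuous.boundedL2Path (hχs n).continuous (hχc n)).continuousOn_integral_mul hS)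
    rw [uIoc_of_le hab]
    exact (hc.mono (Ioc_subset_Icc_self.trans hab')).aestronglyMeasurable measurableSet_Ioc
  · rw [Real.norm_eq_abs]
    refine (abs_add_le _ _).trans (add_le_add ((hflux n τ (hIoc τ hτ)).trans ?_)
      (hsrc n τ (hIoc τ hτ)))
    gcongr
    exact hc1 n
  · have h1 : Filter.Tendsto (fun n => ∑ j, ∫ x, pderiv j (χ n) x * J j τ x) Filter.atTop
        (nhds 0) := by
      refine squeeze_zero_norm (fun n => hflux n τ (hIoc τ hτ)) ?_
      have := ((tendsto_one_div_add_atTop_nhds_zero_nat (𝕜 := ℝ)).const_mul A).mul_const B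
      simpa using this.const_mul (d : ℝ)
    simpa using h1.add (hlim _ (hSi τ (hab' (hIoc τ hτ))))

/-- A nonnegative density transported by an integrable flux keeps its mass bounded by the initial
one. -/
theorem balance_law_mass
    (hqc : ContDiffOn ℝ 1 (fun z : ℝ × Rd d => q z.1 z.2) (Ioo 0 T ×ˢ univ))
    (hJc : ∀ j, ∀ t ∈ Ioo 0 T, ContDiff ℝ 1 (J j t))
    (heq : ∀ t ∈ Ioo 0 T, ∀ x, deriv (fun τ => q τ x) t + ∑ j, pderiv j (J j t) x = 0)
    (hq : BoundedL2Path T q) (hJ : ∀ j, BoundedL2Path T (J j))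
    (hq0 : ∀ t ∈ Icc 0 T, ∀ x, 0 ≤ q t x) (hi : Integrable (q 0))
    (hJi : ∀ j, ∀ t ∈ Icc 0 T, Integrable (J j t)) {B : ℝ}
    (hJB : ∀ j, ∀ t ∈ Icc 0 T, ∫ x, |J j t x| ≤ B) {t : ℝ} (ht : t ∈ Icc 0 T) :
    Integrable (q t) ∧ ∫ x, q t x ≤ ∫ x, q 0 x := by
  obtain ⟨χ, A, hA0, hχs, hχc, hχ0, hχ1, hχlim, hχd⟩ := exists_cutoff d
  have hχs1 : ∀ n, ContDiff ℝ 1 (χ n) := fun n => (hχs n).of_le (by simp)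
  have hS : BoundedL2Path T (fun _ (_ : Rd d) => (0 : ℝ)) :=
    BoundedL2Path.const MemLp.zero (B := 0) (by simp)
  have hT0 : (0 : ℝ) ∈ Icc 0 T := ⟨le_rfl, ht.1.trans ht.2⟩
  have hm0 : 0 ≤ ∫ x, q 0 x := integral_nonneg (hq0 0 hT0)
  have hle : ∀ n : ℕ, ∫ x, χ n x * q t x
      ≤ (∫ x, q 0 x) + d * (A * (1 / ((n : ℝ) + 1)) * B) * t := by
    intro n
    have hloc := balance_law_local hqc hJc (fun _ _ => continuous_const) heq hq hJ hS
      (hχs1 n) (hχc n) le_rfl ht.1 ht.2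
    have h1 : ∫ x, χ n x * q 0 x ≤ ∫ x, q 0 x := by
      refine integral_mono_of_nonneg (Filter.Eventually.of_forall fun x =>
        mul_nonneg (hχ0 n x) (hq0 0 hT0 x)) hi (Filter.Eventually.of_forall fun x => ?_)
      exact mul_le_of_le_one_left (hq0 0 hT0 x) (hχ1 n x)
    have h2 : ‖∫ τ in (0)..t, ((∑ j, ∫ x, pderiv j (χ n) x * J j τ x) + ∫ x, χ n x * 0)‖
        ≤ d * (A * (1 / ((n : ℝ) + 1)) * B) * |t - 0| := by
      refine intervalIntegral.norm_integral_le_of_norm_le_const fun τ hτ => ?_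
      rw [uIoc_of_le ht.1] at hτ
      have hτT : τ ∈ Icc 0 T := ⟨hτ.1.le, hτ.2.trans ht.2⟩
      simp only [mul_zero, integral_zero, add_zero, Real.norm_eq_abs]
      exact abs_sum_flux_le (fun j => hJi j τ hτT) (fun j => hJB j τ hτT)
        (fun j x => hχd n j x) (mul_nonneg hA0 (by positivity))
    rw [sub_zero, abs_of_nonneg ht.1] at h2
    have h3 := (Real.le_norm_self _).trans h2
    linarith
  have hlimb : Filter.Tendsto (fun n : ℕ => (∫ x, q 0 x) + d * (A * (1 / ((n : ℝ) + 1)) * B) * t)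
      Filter.atTop (nhds (∫ x, q 0 x)) := by
    have := (((tendsto_one_div_add_atTop_nhds_zero_nat (𝕜 := ℝ)).const_mul A).mul_const B)
    have := ((this.const_mul (d : ℝ)).mul_const t).const_add (∫ x, q 0 x)
    simpa using this
  have hqm := (hq.memLp t ht).1
  have hfatou : ∫⁻ x, ENNReal.ofReal (q t x) ≤ ENNReal.ofReal (∫ x, q 0 x) := by
    calc ∫⁻ x, ENNReal.ofReal (q t x)
        = ∫⁻ x, Filter.liminf (fun n => ENNReal.ofReal (χ n x * q t x)) Filter.atTop := by
          refine lintegral_congr fun x => (Filter.Tendsto.liminf_eq ?_).symm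
          have := ENNReal.tendsto_ofReal ((hχlim x).mul_const (q t x))
          simpa using this
      _ ≤ Filter.liminf (fun n => ∫⁻ x, ENNReal.ofReal (χ n x * q t x)) Filter.atTop :=
          lintegral_liminf_le' fun n =>
            (((hχs n).continuous.aestronglyMeasurable.mul hqm).aemeasurable).ennreal_ofReal
      _ ≤ Filter.liminf (fun n : ℕ => ENNReal.ofReal
            ((∫ x, q 0 x) + d * (A * (1 / ((n : ℝ) + 1)) * B) * t)) Filter.atTop := by
          refine Filter.liminf_le_liminf (Filter.Eventually.of_forall fun n => ?_)
          rw [← ofReal_integral_eq_lintegral_ofReal]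
          · exact ENNReal.ofReal_le_ofReal (hle n)
          · exact (Continuous.boundedL2Path (hχs n).continuous (hχc n)).integrable_mul hq ht
          · exact Filter.Eventually.of_forall fun x => mul_nonneg (hχ0 n x) (hq0 t ht x)
      _ = ENNReal.ofReal (∫ x, q 0 x) := (ENNReal.tendsto_ofReal hlimb).liminf_eq
  have hint : Integrable (q t) := by
    refine ⟨hqm, ?_⟩
    rw [hasFiniteIntegral_iff_ofReal (Filter.Eventually.of_forall (hq0 t ht))]
    exact hfatou.trans_lt ENNReal.ofReal_lt_top
  refine ⟨hint, ?_⟩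
  rw [← ofReal_integral_eq_lintegral_ofReal hint (Filter.Eventually.of_forall (hq0 t ht))] at hfatou
  exact (ENNReal.ofReal_le_ofReal_iff hm0).1 hfatou

end BalanceLaws

/-! ### Componentwise equations, mass and momentum -/

namespace IsClassicalSolution

open scoped ContDiff

variable {d s : ℕ} {T : ℝ} {ρ : ℝ → Rd d → ℝ} {u v : ℝ → Rd d → Rd d} {p : ℝ → Rd d → ℝ}

theorem contDiff_u_apply (h : IsClassicalSolution d s T ρ u v p) (i : Fin d) :
    ContDiffOn ℝ 1 (fun z : ℝ × Rd d => u z.1 z.2 i) (Ioo 0 T ×ˢ univ) :=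
  (EuclideanSpace.proj (𝕜 := ℝ) i).contDiff.comp_contDiffOn h.contDiff_u

theorem contDiff_v_apply (h : IsClassicalSolution d s T ρ u v p) (i : Fin d) :
    ContDiffOn ℝ 1 (fun z : ℝ × Rd d => v z.1 z.2 i) (Ioo 0 T ×ˢ univ) :=
  (EuclideanSpace.proj (𝕜 := ℝ) i).contDiff.comp_contDiffOn h.contDiff_v

theorem contDiff_u_slice (h : IsClassicalSolution d s T ρ u v p) {t : ℝ} (ht : t ∈ Ioo 0 T)
    (i : Fin d) : ContDiff ℝ 1 (fun x => u t x i) :=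
  contDiff_slice (f := fun t x => u t x i) (h.contDiff_u_apply i) ht

theorem contDiff_v_slice (h : IsClassicalSolution d s T ρ u v p) {t : ℝ} (ht : t ∈ Ioo 0 T)
    (i : Fin d) : ContDiff ℝ 1 (fun x => v t x i) :=
  contDiff_slice (f := fun t x => v t x i) (h.contDiff_v_apply i) ht

theorem deriv_apply {f : ℝ → Rd d} {t : ℝ} (hf : DifferentiableAt ℝ f t) (i : Fin d) :
    deriv f t i = deriv (fun τ => f τ i) t :=
  ((EuclideanSpace.proj (𝕜 := ℝ) i).hasFDerivAt.comp_hasDerivAt t hf.hasDerivAt).deriv.symm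

theorem sum_apply {ι : Type*} (s : Finset ι) (f : ι → Rd d) (i : Fin d) :
    (∑ j ∈ s, f j) i = ∑ j ∈ s, f j i := by
  simp

theorem continuity_equation_apply (h : IsClassicalSolution d s T ρ u v p) {t : ℝ}
    (ht : t ∈ Ioo 0 T) (x : Rd d) :
    deriv (fun τ => ρ τ x) t + ∑ j, pderiv j (fun y => ρ t y * u t y j) x = 0 := by
  simpa [divergence] using h.continuity_equation t ht x

theorem euler_momentum_apply (h : IsClassicalSolution d s T ρ u v p) {t : ℝ}
    (ht : t ∈ Ioo 0 T) (x : Rd d) (i : Fin d) :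
    deriv (fun τ => ρ τ x * u τ x i) t + ∑ j, pderiv j (fun y => ρ t y * u t y j * u t y i) x
      = -(ρ t x * (u t x i - v t x i)) := by
  have h1 := congrArg (fun w : Rd d => w i) (h.euler_momentum t ht x)
  have hρ := (contDiff_slice h.contDiff_density ht).differentiable one_ne_zero
  have hu := (contDiff_slice h.contDiff_u ht).differentiable one_ne_zero
  have hui := fun i => (h.contDiff_u_slice ht i).differentiable one_ne_zero
  have hd : DifferentiableAt ℝ (fun τ => ρ τ x • u τ x) t :=
    (hasDerivAt_time h.contDiff_density ht x).differentiableAt.smul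
      (hasDerivAt_time h.contDiff_u ht x).differentiableAt
  simp only [PiLp.add_apply, PiLp.neg_apply, PiLp.smul_apply, PiLp.sub_apply, divTensor, sum_apply,
    smul_eq_mul] at h1
  rw [deriv_apply hd] at h1
  rw [← h1]
  congr 1
  refine Finset.sum_congr rfl fun j _ => ?_
  rw [pderiv_apply (((hρ x).fun_mul (hui j x)).fun_smul (hu x))]
  rfl

theorem incompressible_apply (h : IsClassicalSolution d s T ρ u v p) {t : ℝ}
    (ht : t ∈ Ioo 0 T) (x : Rd d) : ∑ j, pderiv j (fun y => v t y j) x = 0 :=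
  h.incompressible t ht x

theorem contDiff_v_space_apply (h : IsClassicalSolution d s T ρ u v p) {t : ℝ}
    (ht : t ∈ Ioo 0 T) (i : Fin d) : ContDiff ℝ 2 (fun x => v t x i) :=
  (EuclideanSpace.proj (𝕜 := ℝ) i).contDiff.comp (h.contDiff_v_space t ht)

theorem gradient_apply (f : Rd d → ℝ) (x : Rd d) (i : Fin d) :
    gradient f x i = pderiv i f x := by
  have h1 : inner ℝ (gradient f x) (EuclideanSpace.single i (1 : ℝ)) = pderiv i f x := by
    rw [gradient, InnerProductSpace.toDual_symm_apply]
    rfl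
  rw [← h1, EuclideanSpace.inner_single_right]
  simp

theorem laplacian_eq_sum_pderiv {f : Rd d → ℝ} (hf : ContDiff ℝ 2 f) (x : Rd d) :
    Laplacian.laplacian f x = ∑ j, pderiv j (pderiv j f) x := by
  have h1 := congrFun (InnerProductSpace.laplacian_eq_iteratedFDeriv_orthonormalBasis f
    (EuclideanSpace.basisFun (Fin d) ℝ)) x
  rw [h1]
  refine Finset.sum_congr rfl fun j _ => ?_
  have hd : DifferentiableAt ℝ (fderiv ℝ f) x :=
    (hf.fderiv_right (m := 1) (by norm_num)).differentiable one_ne_zero x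
  have h2 : fderiv ℝ (pderiv j f) x = _ :=
    (hd.hasFDerivAt.clm_apply (hasFDerivAt_const (EuclideanSpace.single j (1 : ℝ)) x)).fderiv
  rw [iteratedFDeriv_two_apply]
  conv_rhs => rw [pderiv, h2]
  simp

theorem navier_stokes_apply (h : IsClassicalSolution d s T ρ u v p) {t : ℝ}
    (ht : t ∈ Ioo 0 T) (x : Rd d) (i : Fin d) :
    deriv (fun τ => v τ x i) t + (∑ j, v t x j * pderiv j (fun y => v t y i) x) + pderiv i (p t) x
      - ∑ j, pderiv j (pderiv j (fun y => v t y i)) x = ρ t x * (u t x i - v t x i) := by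
  have h1 := congrArg (fun w : Rd d => w i) (h.navier_stokes t ht x)
  have hv := (contDiff_slice h.contDiff_v ht).differentiable one_ne_zero
  simp only [PiLp.add_apply, PiLp.smul_apply, PiLp.sub_apply, convection, sum_apply,
    smul_eq_mul] at h1
  rw [deriv_apply (hasDerivAt_time h.contDiff_v ht x).differentiableAt,
    gradient_apply] at h1
  have h2 : Laplacian.laplacian (v t) x i = ∑ j, pderiv j (pderiv j (fun y => v t y i)) x := by
    rw [← laplacian_eq_sum_pderiv (h.contDiff_v_space_apply ht i)]
    have := (h.contDiff_v_space t ht).contDiffAt.laplacian_CLM_comp_left (x := x)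
      (l := EuclideanSpace.proj (𝕜 := ℝ) i)
    exact this.symm
  rw [h2] at h1
  simp_rw [pderiv_apply (hv x)] at h1
  exact h1

/-- The balance law of the `i`-th component of `ρ u²`, in which the drag is the only source. -/
theorem momentum_sq_balance (h : IsClassicalSolution d s T ρ u v p) {t : ℝ}
    (ht : t ∈ Ioo 0 T) (x : Rd d) (i : Fin d) :
    deriv (fun τ => ρ τ x * u τ x i * u τ x i) t
      + ∑ j, pderiv j (fun y => ρ t y * u t y j * u t y i * u t y i) x
      = -2 * (ρ t x * (u t x i - v t x i) * u t x i) := by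
  have hρ := (contDiff_slice h.contDiff_density ht).differentiable one_ne_zero
  have hui := fun i => (h.contDiff_u_slice ht i).differentiable one_ne_zero
  have e1 := h.continuity_equation_apply ht x
  have e2 := h.euler_momentum_apply ht x i
  have hdρ := (hasDerivAt_time h.contDiff_density ht x).differentiableAt.hasDerivAt
  have hdu := (hasDerivAt_time (f := fun t x => u t x i)
    (h.contDiff_u_apply i) ht x).differentiableAt.hasDerivAt
  rw [((hdρ.fun_mul hdu).fun_mul hdu).deriv]
  rw [(hdρ.fun_mul hdu).deriv] at e2
  have hJ : ∀ j, pderiv j (fun y => ρ t y * u t y j * u t y i * u t y i) x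
      = 2 * u t x i * pderiv j (fun y => ρ t y * u t y j * u t y i) x
        - u t x i * u t x i * pderiv j (fun y => ρ t y * u t y j) x := by
    intro j
    have h1 := (hρ x).fun_mul (hui j x)
    rw [pderiv_mul (h1.fun_mul (hui i x)) (hui i x), pderiv_mul h1 (hui i x)]
    ring
  simp_rw [hJ]
  rw [Finset.sum_sub_distrib, ← Finset.mul_sum, ← Finset.mul_sum]
  linear_combination 2 * u t x i * e2 - u t x i * u t x i * e1

theorem lt_two_mul {d s : ℕ} (hs : 2 * (d / 2) + 1 ≤ s) : (d : ℝ) < 2 * s := by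
  have : d < 2 * s := by omega
  exact_mod_cast this

theorem path_density (h : IsClassicalSolution d s T ρ u v p) (hs : 2 * (d / 2) + 1 ≤ s) :
    BoundedL2Path T ρ :=
  h.sobolev_density.boundedL2Path (lt_two_mul hs)

theorem path_u (h : IsClassicalSolution d s T ρ u v p) (hs : 2 * (d / 2) + 1 ≤ s)
    (i : Fin d) : BoundedL2Path T (fun t x => u t x i) :=
  (h.sobolev_u i).boundedL2Path (by have := lt_two_mul hs; linarith)

theorem path_v (h : IsClassicalSolution d s T ρ u v p) (hs : 2 * (d / 2) + 1 ≤ s)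
    (i : Fin d) : BoundedL2Path T (fun t x => v t x i) :=
  (h.sobolev_v i).boundedL2Path (by have := lt_two_mul hs; linarith)

/-- The drag force `ρ (u - v)`. -/
theorem path_drag (h : IsClassicalSolution d s T ρ u v p) (hs : 2 * (d / 2) + 1 ≤ s)
    (i : Fin d) : BoundedL2Path T (fun t x => ρ t x * (u t x i - v t x i)) :=
  (h.path_density hs).mul ((h.path_u hs i).sub (h.path_v hs i))

/-- Mass is conserved, but only its monotonicity is needed. -/
theorem mass_le (h : IsClassicalSolution d s T ρ u v p) (hs : 2 * (d / 2) + 1 ≤ s)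
    (hρ0 : Integrable (ρ 0)) {t : ℝ} (ht : t ∈ Icc 0 T) :
    Integrable (ρ t) ∧ ∫ x, ρ t x ≤ ∫ x, ρ 0 x := by
  have hρ := h.path_density hs
  have hu := fun i => h.path_u hs i
  choose B hB0 hB using fun i => hρ.exists_integral_abs_mul_le (hu i)
  refine balance_law_mass (J := fun j t x => ρ t x * u t x j) h.contDiff_density
    (fun j t ht => (contDiff_slice h.contDiff_density ht).mul
      (h.contDiff_u_slice ht j))
    (fun t ht x => h.continuity_equation_apply ht x) hρ (fun j => hρ.mul (hu j))
    h.density_nonneg hρ0 (fun j t ht => hρ.integrable_mul (hu j) ht) (B := ∑ i, B i)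
    (fun j t ht => (hB j t ht).trans ?_) ht
  exact Finset.single_le_sum (fun i _ => hB0 i) (Finset.mem_univ j)

/-- `momentum_sq_balance` integrated over the whole space and in time. -/
theorem momentum_sq_integral (h : IsClassicalSolution d s T ρ u v p) (hs : 2 * (d / 2) + 1 ≤ s)
    (i : Fin d) {a b : ℝ} (ha : 0 ≤ a) (hab : a ≤ b) (hb : b ≤ T) :
    (∫ x, ρ b x * u b x i * u b x i) - ∫ x, ρ a x * u a x i * u a x i
      = ∫ τ in a..b, ∫ x, -2 * (ρ τ x * (u τ x i - v τ x i) * u τ x i) := by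
  have hρ := h.path_density hs
  have hu := fun i => h.path_u hs i
  have hdr := h.path_drag hs i
  have hq : BoundedL2Path T (fun t x => ρ t x * u t x i * u t x i) := (hρ.mul (hu i)).mul (hu i)
  have hS : BoundedL2Path T (fun t x => ρ t x * (u t x i - v t x i) * u t x i) := hdr.mul (hu i)
  have hS2 : BoundedL2Path T
      (fun t x => -2 * (ρ t x * (u t x i - v t x i) * u t x i)) := by
    have h1 := hS.add hS
    have h0 : BoundedL2Path T (fun _ (_ : Rd d) => (0 : ℝ)) :=
      BoundedL2Path.const MemLp.zero (B := 0) (by simp)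
    have h2 := h0.sub h1
    convert h2 using 3
    ring
  choose B hB0 hB using fun j => ((hρ.mul (hu j)).mul (hu i)).exists_integral_abs_mul_le (hu i)
  obtain ⟨B', hB0', hB'⟩ := hdr.exists_integral_abs_mul_le (hu i)
  have hcρ := fun t ht => contDiff_slice h.contDiff_density (t := t) ht
  have hcu := fun i t ht => h.contDiff_u_slice (t := t) ht i
  have hcv := fun i t ht => h.contDiff_v_slice (t := t) ht i
  refine balance_law_global (q := fun t x => ρ t x * u t x i * u t x i)
    (J := fun j t x => ρ t x * u t x j * u t x i * u t x i)
    (S := fun t x => -2 * (ρ t x * (u t x i - v t x i) * u t x i))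
    ((h.contDiff_density.mul (h.contDiff_u_apply i)).mul (h.contDiff_u_apply i))
    (fun j t ht => (((hcρ t ht).mul (hcu j t ht)).mul (hcu i t ht)).mul (hcu i t ht))
    (fun t ht => continuous_const.mul (((hcρ t ht).continuous.mul
      ((hcu i t ht).continuous.sub (hcv i t ht).continuous)).mul (hcu i t ht).continuous))
    (fun t ht x => h.momentum_sq_balance ht x i) hq (fun j => ((hρ.mul (hu j)).mul (hu i)).mul (hu i))
    hS2 (fun t ht => (hρ.mul (hu i)).integrable_mul (hu i) ht)
    (fun j t ht => ((hρ.mul (hu j)).mul (hu i)).integrable_mul (hu i) ht)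
    (fun t ht => (hdr.integrable_mul (hu i) ht).const_mul _) (B := ∑ j, B j + 2 * B')
    (fun j t ht => ?_) (fun t ht => ?_) ha hab hb
  · have := Finset.single_le_sum (fun i _ => hB0 i) (Finset.mem_univ j)
    exact (hB j t ht).trans (by linarith)
  · simp_rw [abs_mul (-2 : ℝ)]
    rw [integral_const_mul]
    have h1 := hB' t ht
    have h2 := Finset.sum_nonneg (s := Finset.univ) fun i _ => hB0 i
    rw [abs_neg, abs_two]
    linarith

end IsClassicalSolution

/-! ### The weak Navier–Stokes equation without pressure -/

section WeakForm

open scoped ContDiff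

variable {d : ℕ}

theorem contDiff_pderiv {j : Fin d} {f : Rd d → ℝ} {n : ℕ} (hf : ContDiff ℝ (n + 1) f) :
    ContDiff ℝ n (pderiv j f) :=
  (hf.fderiv_right le_rfl).clm_apply contDiff_const

theorem contDiff_pderiv_infty {j : Fin d} {f : Rd d → ℝ} (hf : ContDiff ℝ ∞ f) :
    ContDiff ℝ ∞ (pderiv j f) :=
  (hf.fderiv_right (by simp)).clm_apply contDiff_const

theorem pderiv_comm {f : Rd d → ℝ} (hf : ContDiff ℝ 2 f) (j k : Fin d) (x : Rd d) :
    pderiv j (pderiv k f) x = pderiv k (pderiv j f) x := by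
  have hd : DifferentiableAt ℝ (fderiv ℝ f) x :=
    (hf.fderiv_right (m := 1) (by norm_num)).differentiable one_ne_zero x
  have h2 : ∀ i, fderiv ℝ (pderiv i f) x = _ := fun i =>
    (hd.hasFDerivAt.clm_apply (hasFDerivAt_const (EuclideanSpace.single i (1 : ℝ)) x)).fderiv
  have hsym := (hf.contDiffAt (x := x)).isSymmSndFDerivAt (by simp)
  rw [pderiv, h2 k, pderiv, h2 j]
  simpa using hsym (EuclideanSpace.single j 1) (EuclideanSpace.single k 1)

namespace IsClassicalSolution

variable {s : ℕ} {T : ℝ} {ρ : ℝ → Rd d → ℝ} {u v : ℝ → Rd d → Rd d} {p : ℝ → Rd d → ℝ}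

/-- The `l`-th component of the Navier–Stokes equation tested with `ψ`, with all spatial
derivatives moved to `ψ`. -/
theorem integral_mul_deriv_v (h : IsClassicalSolution d s T ρ u v p) {t : ℝ} (ht : t ∈ Ioo 0 T)
    (l : Fin d) {ψ : Rd d → ℝ} (hψ : ContDiff ℝ ∞ ψ) (hψc : HasCompactSupport ψ) :
    ∫ x, ψ x * deriv (fun τ => v τ x l) t
      = (∑ j, ∫ x, pderiv j ψ x * (v t x j * v t x l))
        + (∑ j, ∫ x, pderiv j (pderiv j ψ) x * v t x l)
        + (∫ x, ψ x * (ρ t x * (u t x l - v t x l))) + ∫ x, pderiv l ψ x * p t x := by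
  have hv := fun i => h.contDiff_v_slice ht i
  have hv2 := fun i => h.contDiff_v_space_apply ht i
  have hu := fun i => h.contDiff_u_slice ht i
  have hρ := contDiff_slice h.contDiff_density ht
  have hp := h.contDiff_pressure t ht
  have hψ1 : ContDiff ℝ 1 ψ := hψ.of_le (by simp)
  have hψ1' : ∀ j, ContDiff ℝ 1 (pderiv j ψ) := fun j => (contDiff_pderiv_infty hψ).of_le (by simp)
  have hpt : ∀ x, deriv (fun τ => v τ x l) t = ρ t x * (u t x l - v t x l)
      - (∑ j, pderiv j (fun y => v t y j * v t y l) x)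
      + (∑ j, pderiv j (pderiv j (fun y => v t y l)) x) - pderiv l (p t) x := by
    intro x
    have h1 := h.navier_stokes_apply ht x l
    have h2 : ∑ j, pderiv j (fun y => v t y j * v t y l) x
        = ∑ j, v t x j * pderiv j (fun y => v t y l) x := by
      have h3 : ∀ j, pderiv j (fun y => v t y j * v t y l) x
          = v t x j * pderiv j (fun y => v t y l) x + pderiv j (fun y => v t y j) x * v t x l :=
        fun j => pderiv_mul ((hv j).differentiable one_ne_zero x)
          ((hv l).differentiable one_ne_zero x)
      simp_rw [h3]
      rw [Finset.sum_add_distrib, ← Finset.sum_mul, h.incompressible_apply ht x]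
      ring
    rw [h2]
    linear_combination h1
  have hvv : ∀ j, ContDiff ℝ 1 (fun y => v t y j * v t y l) := fun j => (hv j).mul (hv l)
  have hdv : ∀ j, ContDiff ℝ 1 (pderiv j (fun y => v t y l)) := fun j =>
    contDiff_pderiv (n := 1) ((hv2 l).of_le (by norm_num))
  have i1 : Integrable (fun x => ψ x * (ρ t x * (u t x l - v t x l))) :=
    (hψ.continuous.mul (hρ.continuous.mul ((hu l).continuous.sub
      (hv l).continuous))).integrable_of_hasCompactSupport hψc.mul_right
  have i2 : ∀ j, Integrable (fun x => ψ x * pderiv j (fun y => v t y j * v t y l) x) := fun j =>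
    (hψ.continuous.mul (continuous_pderiv (hvv j))).integrable_of_hasCompactSupport hψc.mul_right
  have i3 : ∀ j, Integrable (fun x => ψ x * pderiv j (pderiv j (fun y => v t y l)) x) := fun j =>
    (hψ.continuous.mul (continuous_pderiv (hdv j))).integrable_of_hasCompactSupport hψc.mul_right
  have i4 : Integrable (fun x => ψ x * pderiv l (p t) x) :=
    (hψ.continuous.mul (continuous_pderiv hp)).integrable_of_hasCompactSupport hψc.mul_right
  have hpt' : ∀ x, ψ x * deriv (fun τ => v τ x l) t = ψ x * (ρ t x * (u t x l - v t x l))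
      - (∑ j, ψ x * pderiv j (fun y => v t y j * v t y l) x)
      + (∑ j, ψ x * pderiv j (pderiv j (fun y => v t y l)) x) - ψ x * pderiv l (p t) x := by
    intro x
    rw [hpt x, ← Finset.mul_sum, ← Finset.mul_sum]
    ring
  have s2 : Integrable (fun x => ∑ j, ψ x * pderiv j (fun y => v t y j * v t y l) x) :=
    integrable_finsetSum _ fun j _ => i2 j
  have s3 : Integrable (fun x => ∑ j, ψ x * pderiv j (pderiv j (fun y => v t y l)) x) :=
    integrable_finsetSum _ fun j _ => i3 j
  have s23 : Integrable (fun x => ψ x * (ρ t x * (u t x l - v t x l))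
      - (∑ j, ψ x * pderiv j (fun y => v t y j * v t y l) x)
      + ∑ j, ψ x * pderiv j (pderiv j (fun y => v t y l)) x) := (i1.sub s2).add s3
  have s12 : Integrable (fun x => ψ x * (ρ t x * (u t x l - v t x l))
      - (∑ j, ψ x * pderiv j (fun y => v t y j * v t y l) x)) := i1.sub s2
  simp_rw [hpt']
  rw [integral_sub s23 i4, integral_add s12 s3, integral_sub i1 s2,
    integral_finsetSum _ fun j _ => i2 j, integral_finsetSum _ fun j _ => i3 j]
  have p3 : ∀ j, ∫ x, ψ x * pderiv j (pderiv j (fun y => v t y l)) x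
      = ∫ x, pderiv j (pderiv j ψ) x * v t x l := by
    intro j
    rw [integral_mul_pderiv_eq_neg hψ1 hψc (hdv j),
      integral_mul_pderiv_eq_neg (hψ1' j) hψc.pderiv (hv l), neg_neg]
  simp_rw [p3, integral_mul_pderiv_eq_neg hψ1 hψc (hvv _), integral_mul_pderiv_eq_neg hψ1 hψc hp]
  rw [Finset.sum_neg_distrib]
  ring

/-- The right-hand side of the `l`-th component of the weak Navier–Stokes equation, without the
pressure. -/
noncomputable def weakForce (ρ : ℝ → Rd d → ℝ) (u v : ℝ → Rd d → Rd d) (l : Fin d) (ψ : Rd d → ℝ)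
    (t : ℝ) : ℝ :=
  (∑ j, ∫ x, pderiv j ψ x * (v t x j * v t x l)) + (∑ j, ∫ x, pderiv j (pderiv j ψ) x * v t x l)
    + ∫ x, ψ x * (ρ t x * (u t x l - v t x l))

theorem path_flux (h : IsClassicalSolution d s T ρ u v p) (hs : 2 * (d / 2) + 1 ≤ s)
    (j l : Fin d) : BoundedL2Path T (fun t x => v t x j * v t x l) :=
  (h.path_v hs j).mul (h.path_v hs l)

theorem continuousOn_weakForce (h : IsClassicalSolution d s T ρ u v p)
    (hs : 2 * (d / 2) + 1 ≤ s) (l : Fin d) {ψ : Rd d → ℝ} (hψ : ContDiff ℝ ∞ ψ)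
    (hψc : HasCompactSupport ψ) : ContinuousOn (weakForce ρ u v l ψ) (Icc 0 T) := by
  have hc : ∀ {φ : Rd d → ℝ}, ContDiff ℝ ∞ φ → HasCompactSupport φ →
      BoundedL2Path T (fun _ => φ) := fun hφ hφc => Continuous.boundedL2Path hφ.continuous hφc
  refine ((continuousOn_finsetSum _ fun j _ => ?_).add
    (continuousOn_finsetSum _ fun j _ => ?_)).add ?_
  · exact (hc (contDiff_pderiv_infty hψ) hψc.pderiv).continuousOn_integral_mul (h.path_flux hs j l)
  · exact (hc (contDiff_pderiv_infty (contDiff_pderiv_infty hψ))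
      hψc.pderiv.pderiv).continuousOn_integral_mul (h.path_v hs l)
  · exact (hc hψ hψc).continuousOn_integral_mul (h.path_drag hs l)

/-- The weak vorticity equation: tested with the divergence-free field
`∂ₖφ eₗ - ∂ₗφ eₖ`, the Navier–Stokes equation loses its pressure. -/
theorem weak_vorticity (h : IsClassicalSolution d s T ρ u v p) (hs : 2 * (d / 2) + 1 ≤ s)
    (k l : Fin d) {φ : Rd d → ℝ} (hφ : ContDiff ℝ ∞ φ) (hφc : HasCompactSupport φ) {a b : ℝ}
    (ha : 0 ≤ a) (hab : a ≤ b) (hb : b ≤ T) :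
    ((∫ x, pderiv k φ x * v b x l) - ∫ x, pderiv k φ x * v a x l)
        - ((∫ x, pderiv l φ x * v b x k) - ∫ x, pderiv l φ x * v a x k)
      = (∫ τ in a..b, weakForce ρ u v l (pderiv k φ) τ)
        - ∫ τ in a..b, weakForce ρ u v k (pderiv l φ) τ := by
  have hψ : ∀ j, ContDiff ℝ ∞ (pderiv j φ) := fun j => contDiff_pderiv_infty hφ
  have hψc : ∀ j, HasCompactSupport (pderiv j φ) := fun j => hφc.pderiv
  have hpath : ∀ j, BoundedL2Path T (fun _ => pderiv j φ) := fun j =>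
    Continuous.boundedL2Path (hψ j).continuous (hψc j)
  have hF : ∀ k l, ContinuousOn (weakForce ρ u v l (pderiv k φ)) (Icc 0 T) := fun k l =>
    h.continuousOn_weakForce hs l (hψ k) (hψc k)
  have hint : ∀ k l, IntervalIntegrable (weakForce ρ u v l (pderiv k φ)) volume a b := fun k l =>
    ((hF k l).mono (by rw [uIcc_of_le hab]; exact Icc_subset_Icc ha hb)).intervalIntegrable
  rw [← intervalIntegral.integral_sub (hint k l) (hint l k)]
  have key := integral_eq_sub_of_hasDerivAt_Ioo (T := T)
    (f := fun t => (∫ x, pderiv k φ x * v t x l) - ∫ x, pderiv l φ x * v t x k)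
    (g := fun t => weakForce ρ u v l (pderiv k φ) t - weakForce ρ u v k (pderiv l φ) t)
    (((hpath k).continuousOn_integral_mul (h.path_v hs l)).sub
      ((hpath l).continuousOn_integral_mul (h.path_v hs k)))
    ((hF k l).sub (hF l k)) (fun t ht => ?_) ha hab hb
  · rw [key]
    ring
  · refine ((hasDerivAt_integral_mul (q := fun t x => v t x l) (h.contDiff_v_apply l)
      (hψ k).continuous (hψc k) ht).sub (hasDerivAt_integral_mul (q := fun t x => v t x k)
      (h.contDiff_v_apply k) (hψ l).continuous (hψc l) ht)).congr_deriv ?_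
    rw [h.integral_mul_deriv_v ht l (hψ k) (hψc k), h.integral_mul_deriv_v ht k (hψ l) (hψc l)]
    have hsymm : ∀ x, pderiv l (pderiv k φ) x = pderiv k (pderiv l φ) x :=
      pderiv_comm (mod_cast contDiff_infty.1 hφ 2) l k
    simp_rw [hsymm]
    simp only [weakForce]
    ring

theorem weak_incompressible (h : IsClassicalSolution d s T ρ u v p) (hT : 0 < T)
    (hs : 2 * (d / 2) + 1 ≤ s)
    {φ : Rd d → ℝ} (hφ : ContDiff ℝ ∞ φ) (hφc : HasCompactSupport φ) {t : ℝ} (ht : t ∈ Icc 0 T) :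
    ∑ j, ∫ x, pderiv j φ x * v t x j = 0 := by
  have hcont : ContinuousOn (fun t => ∑ j, ∫ x, pderiv j φ x * v t x j) (Icc 0 T) :=
    continuousOn_finsetSum _ fun j _ => (Continuous.boundedL2Path
      (contDiff_pderiv_infty hφ).continuous hφc.pderiv).continuousOn_integral_mul (h.path_v hs j)
  have h0 : ∀ t ∈ Ioo 0 T, ∑ j, ∫ x, pderiv j φ x * v t x j = 0 := by
    intro t ht
    have hv := fun i => h.contDiff_v_slice ht i
    have h1 : ∀ j, ∫ x, pderiv j φ x * v t x j = -∫ x, φ x * pderiv j (fun y => v t y j) x :=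
      fun j => by rw [integral_mul_pderiv_eq_neg (hφ.of_le (by simp)) hφc (hv j), neg_neg]
    simp_rw [h1]
    rw [Finset.sum_neg_distrib, ← integral_finsetSum]
    · simp_rw [← Finset.mul_sum, h.incompressible_apply ht]
      simp
    · exact fun j _ => (hφ.continuous.mul
        (continuous_pderiv (hv j))).integrable_of_hasCompactSupport hφc.mul_right
  have hcl : t ∈ closure (Ioo 0 T) := by rwa [closure_Ioo hT.ne]
  have hmem : ∃ᶠ τ in nhdsWithin t (Icc 0 T), τ ∈ Ioo 0 T := by
    rw [frequently_nhdsWithin_iff]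
    rw [mem_closure_iff_frequently] at hcl
    exact hcl.mono fun τ hτ => ⟨hτ, Ioo_subset_Icc_self hτ⟩
  have hlim := hcont t ht
  have hclosed : IsClosed ({0} : Set ℝ) := isClosed_singleton
  exact hclosed.mem_of_frequently_of_tendsto (hmem.mono fun τ hτ => h0 τ hτ) hlim

end IsClassicalSolution

end WeakForm

/-! ### The Navier–Stokes equation on the Fourier side -/

section FourierOfEquation

open FourierTransform LineDeriv

open scoped ContDiff

variable {d : ℕ}

theorem toL2_apply_schwartz {f : Rd d → ℝ} (hf : MemLp f 2) {ψ : 𝓢(Rd d, ℂ)} {g : Rd d → ℝ}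
    (hg : ∀ x, ψ x = g x) : (toL2 f : 𝓢'(Rd d, ℂ)) ψ = ((∫ x, g x * f x : ℝ) : ℂ) := by
  rw [(TemperedDistribution.IsRepresentedBy.of_Lp (toL2 f)).apply_eq ψ, ← integral_complex_ofReal]
  refine integral_congr_ae ?_
  filter_upwards [coeFn_toL2 hf] with x hx
  rw [hx, hg x]
  exact (Complex.ofReal_mul _ _).symm

theorem intervalIntegral_apply_schwartz {F : ℝ → Lp ℂ 2 (volume : Measure (Rd d))} {a b : ℝ}
    (hF : IntervalIntegrable F volume a b) (ψ : 𝓢(Rd d, ℂ)) :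
    ((∫ τ in a..b, F τ : Lp ℂ 2 (volume : Measure (Rd d))) : 𝓢'(Rd d, ℂ)) ψ
      = ∫ τ in a..b, (F τ : 𝓢'(Rd d, ℂ)) ψ :=
  (((PointwiseConvergenceCLM.evalCLM (RingHom.id ℂ) ℂ ψ).comp
    (Lp.toTemperedDistributionCLM ℂ volume 2)).intervalIntegral_comp_comm hF).symm

theorem lineDerivOp_eq_pderiv {ψ : 𝓢(Rd d, ℂ)} {g : Rd d → ℝ} (hgd : Differentiable ℝ g)
    (hg : ∀ x, ψ x = g x) (j : Fin d) (x : Rd d) :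
    (∂_{EuclideanSpace.single j (1 : ℝ)} ψ : 𝓢(Rd d, ℂ)) x = pderiv j g x := by
  rw [SchwartzMap.lineDerivOp_apply_eq_fderiv]
  have h : (ψ : Rd d → ℂ) = fun x => (g x : ℂ) := funext hg
  have h' : HasFDerivAt (fun x => (g x : ℂ)) (Complex.ofRealCLM.comp (fderiv ℝ g x)) x :=
    (Complex.ofRealCLM.hasFDerivAt (x := g x)).comp x (hgd x).hasFDerivAt
  rw [h, h'.fderiv]
  rfl

/-- A bounded path in `L²`, integrated in time and paired with a test function. -/
theorem BoundedL2Path.intervalIntegral_toL2_apply {T : ℝ} {f : ℝ → Rd d → ℝ}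
    (hf : BoundedL2Path T f) {a b : ℝ} (ha : 0 ≤ a) (hab : a ≤ b) (hb : b ≤ T)
    {ψ : 𝓢(Rd d, ℂ)} {g : Rd d → ℝ} (hg : ∀ x, ψ x = g x) :
    ((∫ τ in a..b, toL2 (f τ) : Lp ℂ 2 (volume : Measure (Rd d))) : 𝓢'(Rd d, ℂ)) ψ
      = ((∫ τ in a..b, ∫ x, g x * f τ x : ℝ) : ℂ) := by
  have hsub : uIcc a b ⊆ Icc 0 T := by rw [uIcc_of_le hab]; exact Icc_subset_Icc ha hb
  rw [intervalIntegral_apply_schwartz (hf.continuousOn.mono hsub).intervalIntegrable,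
    ← intervalIntegral.integral_ofReal]
  exact intervalIntegral.integral_congr fun τ hτ =>
    toL2_apply_schwartz (hf.memLp τ (hsub hτ)) hg

namespace IsClassicalSolution

variable {s : ℕ} {T : ℝ} {ρ : ℝ → Rd d → ℝ} {u v : ℝ → Rd d → Rd d} {p : ℝ → Rd d → ℝ}

/-- The tempered distribution `[vₗ]ₐᵇ + ∫ₐᵇ (∑ⱼ ∂ⱼ(vⱼvₗ) - Δvₗ - ρ(uₗ - vₗ)) dτ`, which the
Navier–Stokes equation identifies with `-∂ₗ ∫ₐᵇ p dτ`. -/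
noncomputable def pressureForce (ρ : ℝ → Rd d → ℝ) (u v : ℝ → Rd d → Rd d) (a b : ℝ)
    (l : Fin d) : 𝓢'(Rd d, ℂ) :=
  (((toL2 fun x => v b x l : Lp ℂ 2 volume) : 𝓢'(Rd d, ℂ))
      - ((toL2 fun x => v a x l : Lp ℂ 2 volume) : 𝓢'(Rd d, ℂ))
      + ∑ j : Fin d, ∂_{EuclideanSpace.single j (1 : ℝ)}
        ((∫ τ in a..b, toL2 (fun x => v τ x j * v τ x l) : Lp ℂ 2 volume) : 𝓢'(Rd d, ℂ))
      - ∑ j : Fin d, ∂_{EuclideanSpace.single j (1 : ℝ)} (∂_{EuclideanSpace.single j (1 : ℝ)}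
        ((∫ τ in a..b, toL2 (fun x => v τ x l) : Lp ℂ 2 volume) : 𝓢'(Rd d, ℂ))))
    - ((∫ τ in a..b, toL2 (fun x => ρ τ x * (u τ x l - v τ x l)) : Lp ℂ 2 volume) :
        𝓢'(Rd d, ℂ))

theorem pressureForce_apply (h : IsClassicalSolution d s T ρ u v p)
    (hs : 2 * (d / 2) + 1 ≤ s) {a b : ℝ} (ha : 0 ≤ a) (hab : a ≤ b) (hb : b ≤ T) (l : Fin d)
    {ψ : 𝓢(Rd d, ℂ)} {g : Rd d → ℝ} (hgs : ContDiff ℝ ∞ g) (hgc : HasCompactSupport g)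
    (hg : ∀ x, ψ x = g x) :
    pressureForce ρ u v a b l ψ = (((∫ x, g x * v b x l) - (∫ x, g x * v a x l)
      - ∫ τ in a..b, weakForce ρ u v l g τ : ℝ) : ℂ) := by
  have hpath : ∀ {φ : Rd d → ℝ}, ContDiff ℝ ∞ φ → HasCompactSupport φ →
      BoundedL2Path T (fun _ => φ) := fun hφ hφc => Continuous.boundedL2Path hφ.continuous hφc
  have hsub : uIcc a b ⊆ Icc 0 T := by rw [uIcc_of_le hab]; exact Icc_subset_Icc ha hb
  have hii : ∀ {φ : Rd d → ℝ} {f : ℝ → Rd d → ℝ}, ContDiff ℝ ∞ φ → HasCompactSupport φ →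
      BoundedL2Path T f → IntervalIntegrable (fun τ => ∫ x, φ x * f τ x) volume a b :=
    fun hφ hφc hf => (((hpath hφ hφc).continuousOn_integral_mul hf).mono hsub).intervalIntegrable
  have hgj : ∀ j, ContDiff ℝ ∞ (pderiv j g) := fun j => contDiff_pderiv_infty hgs
  have hgjj : ∀ j, ContDiff ℝ ∞ (pderiv j (pderiv j g)) := fun j => contDiff_pderiv_infty (hgj j)
  have h1 : ∀ j x, (∂_{EuclideanSpace.single j (1 : ℝ)} ψ : 𝓢(Rd d, ℂ)) x = pderiv j g x :=
    fun j => lineDerivOp_eq_pderiv (hgs.differentiable (by simp)) hg j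
  have h2 : ∀ j x, (∂_{EuclideanSpace.single j (1 : ℝ)} (∂_{EuclideanSpace.single j (1 : ℝ)} ψ) :
      𝓢(Rd d, ℂ)) x = pderiv j (pderiv j g) x :=
    fun j => lineDerivOp_eq_pderiv ((hgj j).differentiable (by simp)) (h1 j) j
  have e1 : ∀ j, (∂_{EuclideanSpace.single j (1 : ℝ)}
      ((∫ τ in a..b, toL2 (fun x => v τ x j * v τ x l) : Lp ℂ 2 volume) : 𝓢'(Rd d, ℂ))) ψ
      = -((∫ τ in a..b, ∫ x, pderiv j g x * (v τ x j * v τ x l) : ℝ) : ℂ) := fun j => by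
    rw [TemperedDistribution.lineDerivOp_apply_apply, map_neg,
      (h.path_flux hs j l).intervalIntegral_toL2_apply ha hab hb (h1 j)]
  have e2 : ∀ j, (∂_{EuclideanSpace.single j (1 : ℝ)} (∂_{EuclideanSpace.single j (1 : ℝ)}
      ((∫ τ in a..b, toL2 (fun x => v τ x l) : Lp ℂ 2 volume) : 𝓢'(Rd d, ℂ)))) ψ
      = ((∫ τ in a..b, ∫ x, pderiv j (pderiv j g) x * v τ x l : ℝ) : ℂ) := fun j => by
    rw [TemperedDistribution.lineDerivOp_apply_apply, map_neg,
      TemperedDistribution.lineDerivOp_apply_apply, map_neg, neg_neg,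
      (h.path_v hs l).intervalIntegral_toL2_apply ha hab hb (h2 j)]
  have e3 := (h.path_drag hs l).intervalIntegral_toL2_apply ha hab hb hg
  have hev : pressureForce ρ u v a b l ψ = ((∫ x, g x * v b x l : ℝ) : ℂ)
      - ((∫ x, g x * v a x l : ℝ) : ℂ)
      + (∑ j, -((∫ τ in a..b, ∫ x, pderiv j g x * (v τ x j * v τ x l) : ℝ) : ℂ))
      - (∑ j, ((∫ τ in a..b, ∫ x, pderiv j (pderiv j g) x * v τ x l : ℝ) : ℂ))
      - ((∫ τ in a..b, ∫ x, g x * (ρ τ x * (u τ x l - v τ x l)) : ℝ) : ℂ) := by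
    rw [← e3, ← toL2_apply_schwartz ((h.path_v hs l).memLp b ⟨ha.trans hab, hb⟩) hg,
      ← toL2_apply_schwartz ((h.path_v hs l).memLp a ⟨ha, hab.trans hb⟩) hg]
    simp_rw [← e1, ← e2]
    have hsum : ∀ Λ : Fin d → 𝓢'(Rd d, ℂ), (∑ j, Λ j) ψ = ∑ j, Λ j ψ := fun Λ =>
      map_sum (PointwiseConvergenceCLM.evalCLM (RingHom.id ℂ) ℂ ψ) Λ Finset.univ
    rw [← hsum, ← hsum]
    rfl
  have hw : ∫ τ in a..b, weakForce ρ u v l g τ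
      = (∑ j, ∫ τ in a..b, ∫ x, pderiv j g x * (v τ x j * v τ x l))
      + (∑ j, ∫ τ in a..b, ∫ x, pderiv j (pderiv j g) x * v τ x l)
      + ∫ τ in a..b, ∫ x, g x * (ρ τ x * (u τ x l - v τ x l)) := by
    have i1 := fun j => hii (hgj j) hgc.pderiv (h.path_flux hs j l)
    have i2 := fun j => hii (hgjj j) hgc.pderiv.pderiv (h.path_v hs l)
    have i3 := hii hgs hgc (h.path_drag hs l)
    have s1 := IntervalIntegrable.sum (Finset.univ : Finset (Fin d)) fun j _ => i1 j
    have s2 := IntervalIntegrable.sum (Finset.univ : Finset (Fin d)) fun j _ => i2 j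
    rw [Finset.sum_fn] at s1 s2
    simp only [weakForce]
    rw [intervalIntegral.integral_add (s1.add s2) i3, intervalIntegral.integral_add s1 s2,
      intervalIntegral.integral_finsetSum fun j _ => i1 j,
      intervalIntegral.integral_finsetSum fun j _ => i2 j]
  rw [hev, hw]
  push_cast
  rw [Finset.sum_neg_distrib]
  ring

/-- The weak vorticity equation says that `pressureForce` is curl-free. -/
theorem lineDeriv_pressureForce_comm (h : IsClassicalSolution d s T ρ u v p)
    (hs : 2 * (d / 2) + 1 ≤ s) {a b : ℝ} (ha : 0 ≤ a) (hab : a ≤ b) (hb : b ≤ T) (k l : Fin d) :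
    ∂_{EuclideanSpace.single k (1 : ℝ)} (pressureForce ρ u v a b l)
      - ∂_{EuclideanSpace.single l (1 : ℝ)} (pressureForce ρ u v a b k) = 0 := by
  refine TemperedDistribution.eq_zero_of_forall_hasCompactSupport fun ψ g hgs hgc hg => ?_
  have h1 : ∀ j x, (∂_{EuclideanSpace.single j (1 : ℝ)} ψ : 𝓢(Rd d, ℂ)) x = pderiv j g x :=
    fun j => lineDerivOp_eq_pderiv (hgs.differentiable (by simp)) hg j
  change (∂_{EuclideanSpace.single k (1 : ℝ)} (pressureForce ρ u v a b l)) ψ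
      - (∂_{EuclideanSpace.single l (1 : ℝ)} (pressureForce ρ u v a b k)) ψ = 0
  rw [TemperedDistribution.lineDerivOp_apply_apply, TemperedDistribution.lineDerivOp_apply_apply,
    map_neg, map_neg,
    h.pressureForce_apply hs ha hab hb l (contDiff_pderiv_infty hgs) hgc.pderiv (h1 k),
    h.pressureForce_apply hs ha hab hb k (contDiff_pderiv_infty hgs) hgc.pderiv (h1 l)]
  have := h.weak_vorticity hs k l hgs hgc ha hab hb
  norm_cast
  linear_combination -this

/-- The Fourier transform of `pressureForce`. -/
noncomputable def pressureSymbol (ρ : ℝ → Rd d → ℝ) (u v : ℝ → Rd d → Rd d) (a b : ℝ)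
    (l : Fin d) (ξ : Rd d) : ℂ :=
  ((𝓕 (toL2 fun x => v b x l) : Lp ℂ 2 (volume : Measure (Rd d))) ξ
      - (𝓕 (toL2 fun x => v a x l) : Lp ℂ 2 (volume : Measure (Rd d))) ξ
      + (∑ j, (2 * Real.pi * Complex.I) * ((ξ j : ℝ) *
        (𝓕 (∫ τ in a..b, toL2 (fun x => v τ x j * v τ x l)) :
          Lp ℂ 2 (volume : Measure (Rd d))) ξ))
      - ∑ j, (2 * Real.pi * Complex.I) * ((ξ j : ℝ) * ((2 * Real.pi * Complex.I) * ((ξ j : ℝ) *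
        (𝓕 (∫ τ in a..b, toL2 (fun x => v τ x l)) : Lp ℂ 2 (volume : Measure (Rd d))) ξ))))
    - (𝓕 (∫ τ in a..b, toL2 (fun x => ρ τ x * (u τ x l - v τ x l))) :
        Lp ℂ 2 (volume : Measure (Rd d))) ξ

theorem inner_single_one (ξ : Rd d) (j : Fin d) :
    inner ℝ ξ (EuclideanSpace.single j (1 : ℝ)) = ξ j := by
  rw [EuclideanSpace.inner_single_right]
  simp

theorem isRepresentedBy_fourier_pressureForce (ρ : ℝ → Rd d → ℝ) (u v : ℝ → Rd d → Rd d)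
    (a b : ℝ) (l : Fin d) :
    TemperedDistribution.IsRepresentedBy (𝓕 (pressureForce ρ u v a b l))
      (pressureSymbol ρ u v a b l) := by
  have hsub : ∀ Λ Λ' : 𝓢'(Rd d, ℂ), 𝓕 (Λ - Λ') = 𝓕 Λ - 𝓕 Λ' := fun Λ Λ' =>
    map_sub (FourierTransform.fourierCLM ℂ 𝓢'(Rd d, ℂ)) Λ Λ'
  have hadd : ∀ Λ Λ' : 𝓢'(Rd d, ℂ), 𝓕 (Λ + Λ') = 𝓕 Λ + 𝓕 Λ' := fun Λ Λ' =>
    map_add (FourierTransform.fourierCLM ℂ 𝓢'(Rd d, ℂ)) Λ Λ'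
  have hsum : ∀ Λ : Fin d → 𝓢'(Rd d, ℂ), 𝓕 (∑ j, Λ j) = ∑ j, 𝓕 (Λ j) := fun Λ =>
    map_sum (FourierTransform.fourierCLM ℂ 𝓢'(Rd d, ℂ)) Λ Finset.univ
  have hL := fun F : Lp ℂ 2 (volume : Measure (Rd d)) =>
    TemperedDistribution.IsRepresentedBy.fourier_of_Lp F
  have hD := fun (j : Fin d) {Λ : 𝓢'(Rd d, ℂ)} {F : Rd d → ℂ}
    (hΛ : TemperedDistribution.IsRepresentedBy (𝓕 Λ) F) =>
    hΛ.fourier_lineDerivOp (EuclideanSpace.single j (1 : ℝ))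
  simp_rw [inner_single_one] at hD
  rw [pressureForce, hsub, hsub, hadd, hsub, hsum, hsum]
  exact ((((hL _).sub (hL _)).add (.sum fun j _ => hD j (hL _))).sub
    (.sum fun j _ => hD j (hD j (hL _)))).sub (hL _)

/-- The Fourier transform of `pressureForce` is, at almost every frequency `ξ`, parallel to `ξ`. -/
theorem mul_pressureSymbol_comm (h : IsClassicalSolution d s T ρ u v p)
    (hs : 2 * (d / 2) + 1 ≤ s) {a b : ℝ} (ha : 0 ≤ a) (hab : a ≤ b) (hb : b ≤ T) :
    ∀ᵐ ξ : Rd d, ∀ k l, (ξ k : ℂ) * pressureSymbol ρ u v a b l ξ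
      = ξ l * pressureSymbol ρ u v a b k ξ := by
  rw [ae_all_iff]; intro k
  rw [ae_all_iff]; intro l
  have h0 := (isRepresentedBy_fourier_pressureForce ρ u v a b l).fourier_lineDerivOp
    (EuclideanSpace.single k (1 : ℝ))
  have h1 := (isRepresentedBy_fourier_pressureForce ρ u v a b k).fourier_lineDerivOp
    (EuclideanSpace.single l (1 : ℝ))
  rw [← sub_eq_zero.1 (h.lineDeriv_pressureForce_comm hs ha hab hb k l)] at h1
  filter_upwards [h0.ae_eq h1] with ξ hξ
  rw [inner_single_one, inner_single_one] at hξ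
  exact mul_left_cancel₀ Complex.two_pi_I_ne_zero hξ

/-- `v` is divergence-free on the Fourier side. -/
theorem sum_mul_fourier_eq_zero (h : IsClassicalSolution d s T ρ u v p) (hT : 0 < T)
    (hs : 2 * (d / 2) + 1 ≤ s) {t : ℝ} (ht : t ∈ Icc 0 T) :
    ∀ᵐ ξ : Rd d, ∑ j, (ξ j : ℂ) *
      (𝓕 (toL2 fun x => v t x j) : Lp ℂ 2 (volume : Measure (Rd d))) ξ = 0 := by
  have h0 : ∑ j, ∂_{EuclideanSpace.single j (1 : ℝ)}
      ((toL2 fun x => v t x j : Lp ℂ 2 (volume : Measure (Rd d))) : 𝓢'(Rd d, ℂ)) = 0 := by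
    refine TemperedDistribution.eq_zero_of_forall_hasCompactSupport fun ψ g hgs hgc hg => ?_
    have h1 : ∀ j x, (∂_{EuclideanSpace.single j (1 : ℝ)} ψ : 𝓢(Rd d, ℂ)) x = pderiv j g x :=
      fun j => lineDerivOp_eq_pderiv (hgs.differentiable (by simp)) hg j
    have h2 : ∀ j, (∂_{EuclideanSpace.single j (1 : ℝ)}
        ((toL2 fun x => v t x j : Lp ℂ 2 (volume : Measure (Rd d))) : 𝓢'(Rd d, ℂ))) ψ
        = -((∫ x, pderiv j g x * v t x j : ℝ) : ℂ) := fun j => by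
      rw [TemperedDistribution.lineDerivOp_apply_apply, map_neg,
        toL2_apply_schwartz ((h.path_v hs j).memLp t ht) (h1 j)]
    rw [show ∀ Λ : Fin d → 𝓢'(Rd d, ℂ), (∑ j, Λ j) ψ = ∑ j, Λ j ψ from fun Λ =>
      map_sum (PointwiseConvergenceCLM.evalCLM (RingHom.id ℂ) ℂ ψ) Λ Finset.univ]
    simp_rw [h2]
    rw [Finset.sum_neg_distrib, ← Complex.ofReal_sum, h.weak_incompressible hT hs hgs hgc ht]
    simp
  have hrep := TemperedDistribution.IsRepresentedBy.sum (s := Finset.univ) fun (j : Fin d) _ =>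
    (TemperedDistribution.IsRepresentedBy.fourier_of_Lp
      (toL2 fun x => v t x j)).fourier_lineDerivOp (EuclideanSpace.single j (1 : ℝ))
  have hsum : ∀ Λ : Fin d → 𝓢'(Rd d, ℂ), 𝓕 (∑ j, Λ j) = ∑ j, 𝓕 (Λ j) := fun Λ =>
    map_sum (FourierTransform.fourierCLM ℂ 𝓢'(Rd d, ℂ)) Λ Finset.univ
  have hF0 : 𝓕 (0 : 𝓢'(Rd d, ℂ)) = 0 := map_zero (FourierTransform.fourierCLM ℂ 𝓢'(Rd d, ℂ))
  rw [← hsum, h0, hF0] at hrep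
  have hzero : TemperedDistribution.IsRepresentedBy (0 : 𝓢'(Rd d, ℂ)) (fun _ : Rd d => (0 : ℂ)) := by
    refine ⟨locallyIntegrable_zero, fun φ => by simp, fun φ => ?_⟩
    simp only [mul_zero, integral_zero]
    rfl
  filter_upwards [hrep.ae_eq hzero] with ξ hξ
  simp_rw [inner_single_one] at hξ
  rw [← Finset.mul_sum] at hξ
  exact (mul_eq_zero.1 hξ).resolve_left Complex.two_pi_I_ne_zero

end IsClassicalSolution

end FourierOfEquation

/-! ### The energy balance in low frequencies -/

section EnergyInHilbertSpace

/-- If the increments of `y` agree with those of a primitive of `g` when tested against the values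
of `y`, then `‖y‖²` has the derivative `2 Re ⟪g, y⟫`: in
`‖y t‖² - ‖y s‖² = Re ⟪y t - y s, y t + y s⟫` the increment of `y` may be replaced by that of the
primitive, although `y` itself need not be differentiable. -/
theorem sum_norm_sq_sub_eq_integral {ι : Type*} [Fintype ι] {H : Type*} [NormedAddCommGroup H]
    [InnerProductSpace ℂ H] [CompleteSpace H] {T : ℝ} {y g : ι → ℝ → H}
    (hy : ∀ l, ContinuousOn (y l) (Icc 0 T)) (hg : ∀ l, ContinuousOn (g l) (Icc 0 T))
    (horth : ∀ a b c, 0 ≤ a → a ≤ b → b ≤ T → c ∈ Icc 0 T →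
      ∑ l, (inner ℂ (y l b - y l a - ∫ τ in a..b, g l τ) (y l c)).re = 0)
    {a b : ℝ} (ha : 0 ≤ a) (hab : a ≤ b) (hb : b ≤ T) :
    ∑ l, ‖y l b‖ ^ 2 - ∑ l, ‖y l a‖ ^ 2
      = ∫ τ in a..b, 2 * ∑ l, (inner ℂ (g l τ) (y l τ)).re := by
  set G : ι → ℝ → H := fun l t => ∫ τ in (0 : ℝ)..t, g l τ with hG
  have hint : ∀ l, ∀ a ∈ Icc 0 T, ∀ b ∈ Icc 0 T, IntervalIntegrable (g l) volume a b :=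
    fun l a ha b hb => ((hg l).mono (uIcc_subset_Icc ha hb)).intervalIntegrable
  have hGd : ∀ l, ∀ t ∈ Ioo 0 T, HasDerivAt (G l) (g l t) t := fun l t ht =>
    intervalIntegral.integral_hasDerivAt_right
      (hint l 0 ⟨le_rfl, (ht.1.trans ht.2).le⟩ t (Ioo_subset_Icc_self ht))
      (((hg l).mono Ioo_subset_Icc_self).stronglyMeasurableAtFilter isOpen_Ioo t ht)
      ((hg l).continuousAt (Icc_mem_nhds ht.1 ht.2))
  have hstep : ∀ s ∈ Icc 0 T, ∀ t ∈ Icc 0 T, ∑ l, ‖y l t‖ ^ 2 - ∑ l, ‖y l s‖ ^ 2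
      = ∑ l, (inner ℂ (G l t - G l s) (y l t + y l s)).re := by
    have hle : ∀ s ∈ Icc 0 T, ∀ t ∈ Icc 0 T, s ≤ t → ∑ l, ‖y l t‖ ^ 2 - ∑ l, ‖y l s‖ ^ 2
        = ∑ l, (inner ℂ (G l t - G l s) (y l t + y l s)).re := by
      intro s hs t ht hst
      have e1 : ∀ l, G l t - G l s = ∫ τ in s..t, g l τ := fun l =>
        intervalIntegral.integral_interval_sub_left
          (hint l 0 ⟨le_rfl, ht.1.trans ht.2⟩ t ht) (hint l 0 ⟨le_rfl, ht.1.trans ht.2⟩ s hs)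
      have e2 : ∀ l, (inner ℂ (y l t - y l s - ∫ τ in s..t, g l τ) (y l t)).re
          + (inner ℂ (y l t - y l s - ∫ τ in s..t, g l τ) (y l s)).re
          = ‖y l t‖ ^ 2 - ‖y l s‖ ^ 2 - (inner ℂ (G l t - G l s) (y l t + y l s)).re := by
        intro l
        rw [e1 l, ← Complex.add_re, ← inner_add_right, inner_sub_left, Complex.sub_re]
        congr 1
        rw [inner_sub_left, inner_add_right, inner_add_right]
        have h1 := inner_self_eq_norm_sq (𝕜 := ℂ) (y l t)
        have h2 := inner_self_eq_norm_sq (𝕜 := ℂ) (y l s)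
        have h3 := inner_re_symm (𝕜 := ℂ) (y l t) (y l s)
        simp only [RCLike.re_to_complex] at h1 h2 h3
        simp only [Complex.sub_re, Complex.add_re]
        linarith
      have e3 := horth s t t hs.1 hst ht.2 ht
      have e4 := horth s t s hs.1 hst ht.2 hs
      have e5 := congrArg₂ (· + ·) e3 e4
      simp only [← Finset.sum_add_distrib, e2, Finset.sum_sub_distrib, add_zero] at e5
      linarith
    intro s hs t ht
    rcases le_total s t with hst | hst
    · exact hle s hs t ht hst
    · have := hle t ht s hs hst
      rw [← neg_sub, this, ← Finset.sum_neg_distrib]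
      refine Finset.sum_congr rfl fun l _ => ?_
      rw [← Complex.neg_re, ← inner_neg_left, neg_sub, add_comm]
  have hNc : ContinuousOn (fun t => ∑ l, ‖y l t‖ ^ 2) (Icc 0 T) :=
    continuousOn_finsetSum _ fun l _ => (hy l).norm.pow 2
  have hSc : ContinuousOn (fun τ => 2 * ∑ l, (inner ℂ (g l τ) (y l τ)).re) (Icc 0 T) :=
    continuousOn_const.mul (continuousOn_finsetSum _ fun l _ =>
      Complex.continuous_re.comp_continuousOn (ContinuousOn.inner (𝕜 := ℂ) (hg l) (hy l)))
  refine (integral_eq_sub_of_hasDerivAt_Ioo hNc hSc (fun t ht => ?_) ha hab hb).symm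
  have htI := Ioo_subset_Icc_self ht
  rw [hasDerivAt_iff_tendsto_slope]
  have hlim : Filter.Tendsto (fun s => ∑ l, (inner ℂ (slope (G l) t s) (y l s + y l t)).re)
      (nhdsWithin t {t}ᶜ) (nhds (∑ l, (inner ℂ (g l t) (y l t + y l t)).re)) := by
    refine tendsto_finsetSum _ fun l _ => (Complex.continuous_re.tendsto _).comp ?_
    refine Filter.Tendsto.inner (hasDerivAt_iff_tendsto_slope.1 (hGd l t ht)) ?_
    exact ((((hy l).continuousAt (Icc_mem_nhds ht.1 ht.2)).mono_left nhdsWithin_le_nhds)).add_const _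
  have hval : ∑ l, (inner ℂ (g l t) (y l t + y l t)).re
      = 2 * ∑ l, (inner ℂ (g l t) (y l t)).re := by
    rw [Finset.mul_sum]
    refine Finset.sum_congr rfl fun l _ => ?_
    rw [inner_add_right, Complex.add_re]
    ring
  rw [hval] at hlim
  refine hlim.congr' ?_
  filter_upwards [nhdsWithin_le_nhds (Icc_mem_nhds ht.1 ht.2)] with s hs
  rw [slope_def_field, hstep t htI s hs, Finset.sum_div]
  refine Finset.sum_congr rfl fun l _ => ?_
  rw [slope_def_module, ← Complex.coe_smul, inner_smul_left, Complex.conj_ofReal,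
    Complex.re_ofReal_mul, div_eq_inv_mul]

end EnergyInHilbertSpace

section FrequencyCutoff

open FourierTransform

variable {d : ℕ}

theorem memLp_top_indicator_ball {r C : ℝ} {m : Rd d → ℂ} (hm : Continuous m)
    (hC : ∀ ξ ∈ Metric.ball (0 : Rd d) r, ‖m ξ‖ ≤ C) (hC0 : 0 ≤ C) :
    MemLp ((Metric.ball (0 : Rd d) r).indicator m) ∞ := by
  refine memLp_top_of_bound
    (hm.aestronglyMeasurable.indicator Metric.isOpen_ball.measurableSet) C
    (Filter.Eventually.of_forall fun ξ => ?_)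
  by_cases hξ : ξ ∈ Metric.ball (0 : Rd d) r
  · rw [indicator_of_mem hξ]
    exact hC ξ hξ
  · rw [indicator_of_notMem hξ, norm_zero]
    exact hC0

theorem memLp_top_indicator_ball_one (r : ℝ) :
    MemLp ((Metric.ball (0 : Rd d) r).indicator fun _ => (1 : ℂ)) ∞ :=
  memLp_top_indicator_ball (C := 1) continuous_const (by simp) zero_le_one

/-- The restriction to the frequencies `|ξ| < r`. -/
noncomputable def lowPass (r : ℝ) :
    Lp ℂ 2 (volume : Measure (Rd d)) →L[ℂ] Lp ℂ 2 (volume : Measure (Rd d)) :=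
  mulL2 _ (memLp_top_indicator_ball_one r)

theorem coeFn_lowPass (r : ℝ) (F : Lp ℂ 2 (volume : Measure (Rd d))) :
    lowPass r F =ᵐ[volume] (Metric.ball (0 : Rd d) r).indicator F := by
  filter_upwards [coeFn_mulL2 (memLp_top_indicator_ball_one r) F] with ξ hξ
  rw [lowPass, hξ]
  by_cases h : ξ ∈ Metric.ball (0 : Rd d) r <;> simp [h]

theorem abs_coord_le (ξ : Rd d) (j : Fin d) : |ξ j| ≤ ‖ξ‖ := by
  simpa using PiLp.norm_apply_le ξ j

theorem norm_two_pi_I : ‖(2 * Real.pi * Complex.I : ℂ)‖ = 2 * Real.pi := by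
  simp [abs_of_pos Real.pi_pos]

theorem memLp_top_indicator_ball_coord (r : ℝ≥0) (j : Fin d) :
    MemLp ((Metric.ball (0 : Rd d) r).indicator
      fun ξ => (2 * Real.pi * Complex.I) * (ξ j : ℝ)) ∞ := by
  refine memLp_top_indicator_ball (C := 2 * Real.pi * r) (by fun_prop) (fun ξ hξ => ?_)
    (by positivity)
  rw [mem_ball_zero_iff] at hξ
  rw [norm_mul, norm_two_pi_I, Complex.norm_real, Real.norm_eq_abs]
  have := abs_coord_le ξ j
  gcongr
  linarith

/-- The Fourier multiplier `2πi ξⱼ` of `∂ⱼ`, restricted to the frequencies `|ξ| < r`. -/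
noncomputable def lowPassDeriv (r : ℝ≥0) (j : Fin d) :
    Lp ℂ 2 (volume : Measure (Rd d)) →L[ℂ] Lp ℂ 2 (volume : Measure (Rd d)) :=
  mulL2 _ (memLp_top_indicator_ball_coord r j)

theorem coeFn_lowPassDeriv (r : ℝ≥0) (j : Fin d) (F : Lp ℂ 2 (volume : Measure (Rd d))) :
    lowPassDeriv r j F =ᵐ[volume] (Metric.ball (0 : Rd d) r).indicator
      fun ξ => (2 * Real.pi * Complex.I) * ((ξ j : ℝ) * F ξ) := by
  filter_upwards [coeFn_mulL2 (memLp_top_indicator_ball_coord r j) F] with ξ hξ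
  rw [lowPassDeriv, hξ]
  by_cases h : ξ ∈ Metric.ball (0 : Rd d) r <;> simp [h, mul_assoc]

theorem inner_lowPass_comm (r : ℝ) (F G : Lp ℂ 2 (volume : Measure (Rd d))) :
    inner ℂ (lowPass r F) G = inner ℂ F (lowPass r G) := by
  rw [L2.inner_def, L2.inner_def]
  refine integral_congr_ae ?_
  filter_upwards [coeFn_lowPass r F, coeFn_lowPass r G] with ξ h1 h2
  rw [h1, h2]
  by_cases h : ξ ∈ Metric.ball (0 : Rd d) r <;> simp [h]

theorem lowPass_lowPass (r : ℝ) (F : Lp ℂ 2 (volume : Measure (Rd d))) :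
    lowPass r (lowPass r F) = lowPass r F := by
  refine Lp.ext ?_
  filter_upwards [coeFn_lowPass r F, coeFn_lowPass r (lowPass r F)] with ξ h1 h2
  rw [h2]
  by_cases h : ξ ∈ Metric.ball (0 : Rd d) r <;> simp [h, h1]

theorem inner_lowPassDeriv_lowPass (r : ℝ≥0) (j : Fin d)
    (F G : Lp ℂ 2 (volume : Measure (Rd d))) :
    inner ℂ (lowPassDeriv r j F) (lowPass r G) = -inner ℂ F (lowPassDeriv r j G) := by
  rw [L2.inner_def, L2.inner_def, ← integral_neg]
  refine integral_congr_ae ?_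
  filter_upwards [coeFn_lowPassDeriv r j F, coeFn_lowPass r G, coeFn_lowPassDeriv r j G]
    with ξ h1 h2 h3
  rw [h1, h2, h3]
  by_cases h : ξ ∈ Metric.ball (0 : Rd d) r
  · simp [h, Complex.conj_ofNat]
    ring
  · simp [h]

/-- The Fourier transform `2πi ξⱼ f̂(ξ)` of `∂ⱼ f`, with the junk value `0` if it is not
square integrable. -/
noncomputable def fourierPartial (j : Fin d) (f : Rd d → ℝ) : Lp ℂ 2 (volume : Measure (Rd d)) :=
  open Classical in
  if h : MemLp (fun ξ : Rd d => (2 * Real.pi * Complex.I) * ((ξ j : ℝ) *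
      (𝓕 (toL2 f) : Lp ℂ 2 (volume : Measure (Rd d))) ξ)) 2 then h.toLp _ else 0

theorem ContinuousInSobolev.coeFn_fourierPartial {s T : ℝ} {f : ℝ → Rd d → ℝ}
    (h : ContinuousInSobolev s T f) (hs : 1 ≤ s) (j : Fin d) {t : ℝ} (ht : t ∈ Icc 0 T) :
    ∀ᵐ ξ, fourierPartial j (f t) ξ = (2 * Real.pi * Complex.I) * ((ξ j : ℝ) *
      (𝓕 (toL2 (f t)) : Lp ℂ 2 (volume : Measure (Rd d))) ξ) := by
  obtain ⟨G, -, hG⟩ := h.exists_fourier_deriv hs j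
  have hmem : MemLp (fun ξ : Rd d => (2 * Real.pi * Complex.I) * ((ξ j : ℝ) *
      (𝓕 (toL2 (f t)) : Lp ℂ 2 (volume : Measure (Rd d))) ξ)) 2 :=
    (Lp.memLp (G t)).ae_eq (hG t ht)
  rw [fourierPartial, dif_pos hmem]
  exact hmem.coeFn_toLp

theorem ContinuousInSobolev.continuousOn_fourierPartial {s T : ℝ} {f : ℝ → Rd d → ℝ}
    (h : ContinuousInSobolev s T f) (hs : 1 ≤ s) (j : Fin d) :
    ContinuousOn (fun t => fourierPartial j (f t)) (Icc 0 T) := by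
  obtain ⟨G, hGc, hG⟩ := h.exists_fourier_deriv hs j
  refine hGc.congr fun t ht => Lp.ext ?_
  filter_upwards [h.coeFn_fourierPartial hs j ht, hG t ht] with ξ h1 h2
  rw [h1, h2]

theorem lowPassDeriv_fourier (r : ℝ≥0) {j : Fin d} {f : Rd d → ℝ}
    (h : ∀ᵐ ξ, fourierPartial j f ξ = (2 * Real.pi * Complex.I) * ((ξ j : ℝ) *
      (𝓕 (toL2 f) : Lp ℂ 2 (volume : Measure (Rd d))) ξ)) :
    lowPassDeriv r j (𝓕 (toL2 f)) = lowPass r (fourierPartial j f) := by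
  refine Lp.ext ?_
  filter_upwards [coeFn_lowPassDeriv r j (𝓕 (toL2 f)), coeFn_lowPass r (fourierPartial j f), h]
    with ξ h1 h2 h3
  rw [h1, h2]
  by_cases hξ : ξ ∈ Metric.ball (0 : Rd d) r <;> simp [hξ, h3]

namespace IsClassicalSolution

variable {s : ℕ} {T : ℝ} {ρ : ℝ → Rd d → ℝ} {u v : ℝ → Rd d → Rd d} {p : ℝ → Rd d → ℝ}

theorem coeFn_fourierPartial_v (h : IsClassicalSolution d s T ρ u v p) (j l : Fin d) {t : ℝ}
    (ht : t ∈ Icc 0 T) :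
    ∀ᵐ ξ, fourierPartial j (fun x => v t x l) ξ = (2 * Real.pi * Complex.I) * ((ξ j : ℝ) *
      (𝓕 (toL2 fun x => v t x l) : Lp ℂ 2 (volume : Measure (Rd d))) ξ) :=
  (h.sobolev_v l).coeFn_fourierPartial (by simp) j ht

theorem continuousOn_fourierPartial_v (h : IsClassicalSolution d s T ρ u v p) (j l : Fin d) :
    ContinuousOn (fun t => fourierPartial j (fun x => v t x l)) (Icc 0 T) :=
  (h.sobolev_v l).continuousOn_fourierPartial (by simp) j

theorem continuousOn_fourier {f : ℝ → Rd d → ℝ} (hf : BoundedL2Path T f) :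
    ContinuousOn (fun t => (𝓕 (toL2 (f t)) : Lp ℂ 2 (volume : Measure (Rd d)))) (Icc 0 T) :=
  (Lp.fourierTransformₗᵢ (Rd d) ℂ).continuous.comp_continuousOn hf.continuousOn

/-- Half the rate of change of the energy of `v` in the frequencies `|ξ| < r`. The convective term
has been integrated by parts, and the pressure does not contribute. -/
noncomputable def lowPassPower (ρ : ℝ → Rd d → ℝ) (u v : ℝ → Rd d → Rd d) (r : ℝ≥0) (τ : ℝ) : ℝ :=
  ∑ l, ((∑ j, ((inner ℂ (lowPass r (𝓕 (toL2 fun x => v τ x j * v τ x l)))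
      (fourierPartial j fun x => v τ x l)).re
        - ‖lowPass r (fourierPartial j fun x => v τ x l)‖ ^ 2))
    + (inner ℂ (lowPass r (𝓕 (toL2 fun x => ρ τ x * (u τ x l - v τ x l))))
      (𝓕 (toL2 fun x => v τ x l))).re)

/-- The right-hand side of the `l`-th component of the Navier–Stokes equation on the Fourier side,
without the pressure, in the frequencies `|ξ| < r`. -/
noncomputable def lowPassForce (ρ : ℝ → Rd d → ℝ) (u v : ℝ → Rd d → Rd d) (r : ℝ≥0) (l : Fin d)
    (τ : ℝ) : Lp ℂ 2 (volume : Measure (Rd d)) :=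
  (-∑ j, lowPassDeriv r j (𝓕 (toL2 fun x => v τ x j * v τ x l)))
    + (∑ j, lowPassDeriv r j (lowPassDeriv r j (𝓕 (toL2 fun x => v τ x l))))
    + lowPass r (𝓕 (toL2 fun x => ρ τ x * (u τ x l - v τ x l)))

theorem continuousOn_lowPassForce (h : IsClassicalSolution d s T ρ u v p)
    (hs : 2 * (d / 2) + 1 ≤ s) (r : ℝ≥0) (l : Fin d) :
    ContinuousOn (lowPassForce ρ u v r l) (Icc 0 T) := by
  refine ((continuousOn_finsetSum _ fun j _ => ?_).neg.add
    (continuousOn_finsetSum _ fun j _ => ?_)).add ?_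
  · exact (lowPassDeriv r j).continuous.comp_continuousOn
      (continuousOn_fourier (h.path_flux hs j l))
  · exact (lowPassDeriv r j).continuous.comp_continuousOn
      ((lowPassDeriv r j).continuous.comp_continuousOn (continuousOn_fourier (h.path_v hs l)))
  · exact (lowPass r).continuous.comp_continuousOn (continuousOn_fourier (h.path_drag hs l))

theorem integral_lowPassForce (h : IsClassicalSolution d s T ρ u v p)
    (hs : 2 * (d / 2) + 1 ≤ s) (r : ℝ≥0) (l : Fin d) {a b : ℝ} (ha : 0 ≤ a) (hab : a ≤ b)
    (hb : b ≤ T) :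
    ∫ τ in a..b, lowPassForce ρ u v r l τ
      = (-∑ j, lowPassDeriv r j (𝓕 (∫ τ in a..b, toL2 fun x => v τ x j * v τ x l)))
        + (∑ j, lowPassDeriv r j (lowPassDeriv r j (𝓕 (∫ τ in a..b, toL2 fun x => v τ x l))))
        + lowPass r (𝓕 (∫ τ in a..b, toL2 fun x => ρ τ x * (u τ x l - v τ x l))) := by
  have hsub : uIcc a b ⊆ Icc 0 T := by rw [uIcc_of_le hab]; exact Icc_subset_Icc ha hb
  let Φ : Lp ℂ 2 (volume : Measure (Rd d)) →L[ℂ] Lp ℂ 2 (volume : Measure (Rd d)) :=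
    (Lp.fourierTransformₗᵢ (Rd d) ℂ).toContinuousLinearEquiv
  have hcomm : ∀ {f : ℝ → Rd d → ℝ} (_ : BoundedL2Path T f)
      (L : Lp ℂ 2 (volume : Measure (Rd d)) →L[ℂ] Lp ℂ 2 (volume : Measure (Rd d))),
      IntervalIntegrable (fun τ => L (𝓕 (toL2 (f τ)))) volume a b ∧
      ∫ τ in a..b, L (𝓕 (toL2 (f τ))) = L (𝓕 (∫ τ in a..b, toL2 (f τ))) := by
    intro f hf L
    have hi := (hf.continuousOn.mono hsub).intervalIntegrable (μ := volume)
    refine ⟨?_, (L.comp Φ).intervalIntegral_comp_comm hi⟩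
    exact ((L.continuous.comp_continuousOn (continuousOn_fourier hf)).mono hsub).intervalIntegrable
  have hW := fun j => hcomm (h.path_flux hs j l) (lowPassDeriv r j)
  have hV := fun j => hcomm (h.path_v hs l) ((lowPassDeriv r j).comp (lowPassDeriv r j))
  have hH := hcomm (h.path_drag hs l) (lowPass r)
  simp only [ContinuousLinearMap.comp_apply] at hV
  have s1 := IntervalIntegrable.sum (Finset.univ : Finset (Fin d)) fun j _ => (hW j).1
  have s2 := IntervalIntegrable.sum (Finset.univ : Finset (Fin d)) fun j _ => (hV j).1
  rw [Finset.sum_fn] at s1 s2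
  have s1n : IntervalIntegrable (fun τ => -∑ j, lowPassDeriv r j
      (𝓕 (toL2 fun x => v τ x j * v τ x l))) volume a b := s1.neg
  simp only [lowPassForce]
  rw [intervalIntegral.integral_add (s1n.add s2) hH.1,
    intervalIntegral.integral_add s1n s2, intervalIntegral.integral_neg,
    intervalIntegral.integral_finsetSum fun j _ => (hW j).1,
    intervalIntegral.integral_finsetSum fun j _ => (hV j).1, hH.2]
  simp_rw [(hW _).2, (hV _).2]

theorem coeFn_lowPass_sub (r : ℝ≥0) (A B C H : Lp ℂ 2 (volume : Measure (Rd d)))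
    (W : Fin d → Lp ℂ 2 (volume : Measure (Rd d))) :
    (lowPass r A - lowPass r B - (-(∑ j, lowPassDeriv r j (W j))
      + (∑ j, lowPassDeriv r j (lowPassDeriv r j C)) + lowPass r H) :
        Lp ℂ 2 (volume : Measure (Rd d)))
      =ᵐ[volume] (Metric.ball (0 : Rd d) r).indicator fun ξ => A ξ - B ξ
        + (∑ j, (2 * Real.pi * Complex.I) * ((ξ j : ℝ) * W j ξ))
        - (∑ j, (2 * Real.pi * Complex.I) * ((ξ j : ℝ) *
          ((2 * Real.pi * Complex.I) * ((ξ j : ℝ) * C ξ)))) - H ξ := by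
  have hcoe : ∀ F : Fin d → Lp ℂ 2 (volume : Measure (Rd d)),
      (∑ j, F j : Lp ℂ 2 (volume : Measure (Rd d))) =ᵐ[volume] fun ξ => ∑ j, F j ξ := fun F => by
    filter_upwards [Lp.coeFn_finsetSum Finset.univ F] with ξ hξ
    rw [hξ, Finset.sum_apply]
  filter_upwards [Lp.coeFn_sub (lowPass r A - lowPass r B) (-(∑ j, lowPassDeriv r j (W j))
      + (∑ j, lowPassDeriv r j (lowPassDeriv r j C)) + lowPass r H),
    Lp.coeFn_sub (lowPass r A) (lowPass r B),
    Lp.coeFn_add (-(∑ j, lowPassDeriv r j (W j))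
      + (∑ j, lowPassDeriv r j (lowPassDeriv r j C))) (lowPass r H),
    Lp.coeFn_add (-(∑ j, lowPassDeriv r j (W j))) (∑ j, lowPassDeriv r j (lowPassDeriv r j C)),
    Lp.coeFn_neg (∑ j, lowPassDeriv r j (W j)), hcoe fun j => lowPassDeriv r j (W j),
    hcoe fun j => lowPassDeriv r j (lowPassDeriv r j C), coeFn_lowPass r A, coeFn_lowPass r B,
    ae_all_iff.2 fun j => coeFn_lowPassDeriv r j (W j),
    ae_all_iff.2 fun j => coeFn_lowPassDeriv r j (lowPassDeriv r j C),
    ae_all_iff.2 fun j => coeFn_lowPassDeriv r j C, coeFn_lowPass r H]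
    with ξ h1 h2 h3 h4 h5 h6 h7 hA hB hW1 hV1 hV2 hH1
  rw [h1, Pi.sub_apply, h2, Pi.sub_apply, h3, Pi.add_apply, h4, Pi.add_apply, h5, Pi.neg_apply,
    h6, h7, hA, hB, hH1]
  simp only [hW1, hV1]
  by_cases hξ : ξ ∈ Metric.ball (0 : Rd d) r
  · simp only [indicator_of_mem hξ, hV2]
    ring
  · simp [indicator_of_notMem hξ]

theorem coeFn_increment_sub_integral_lowPassForce (h : IsClassicalSolution d s T ρ u v p)
    (hs : 2 * (d / 2) + 1 ≤ s) (r : ℝ≥0) (l : Fin d) {a b : ℝ} (ha : 0 ≤ a) (hab : a ≤ b)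
    (hb : b ≤ T) :
    (lowPass r (𝓕 (toL2 fun x => v b x l)) - lowPass r (𝓕 (toL2 fun x => v a x l))
      - ∫ τ in a..b, lowPassForce ρ u v r l τ : Lp ℂ 2 (volume : Measure (Rd d)))
      =ᵐ[volume] (Metric.ball (0 : Rd d) r).indicator (pressureSymbol ρ u v a b l) := by
  rw [h.integral_lowPassForce hs r l ha hab hb]
  exact coeFn_lowPass_sub r _ _ _ _ _

theorem sum_inner_increment_eq_zero (h : IsClassicalSolution d s T ρ u v p) (hd : 0 < d)
    (hT : 0 < T) (hs : 2 * (d / 2) + 1 ≤ s) (r : ℝ≥0) {a b c : ℝ} (ha : 0 ≤ a) (hab : a ≤ b)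
    (hb : b ≤ T) (hc : c ∈ Icc 0 T) :
    ∑ l, (inner ℂ (lowPass r (𝓕 (toL2 fun x => v b x l)) - lowPass r (𝓕 (toL2 fun x => v a x l))
      - ∫ τ in a..b, lowPassForce ρ u v r l τ) (lowPass r (𝓕 (toL2 fun x => v c x l)))).re
      = 0 := by
  simp_rw [L2.inner_def]
  rw [← Complex.re_sum, ← integral_finsetSum _ fun l _ => L2.integrable_inner _ _]
  rw [integral_eq_zero_of_ae, Complex.zero_re]
  have : Nonempty (Fin d) := ⟨⟨0, hd⟩⟩
  have hne : ∀ᵐ ξ : Rd d, ξ ≠ 0 := by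
    have : Nontrivial (Rd d) := inferInstance
    exact (measure_eq_zero_iff_ae_notMem).1 (measure_singleton (0 : Rd d))
  filter_upwards [hne, h.mul_pressureSymbol_comm hs ha hab hb, h.sum_mul_fourier_eq_zero hT hs hc,
    ae_all_iff.2 fun l => h.coeFn_increment_sub_integral_lowPassForce hs r l ha hab hb,
    ae_all_iff.2 fun l => coeFn_lowPass r (𝓕 (toL2 fun x => v c x l))] with ξ h0 h1 h2 h3 h4
  simp only [h3, h4, Pi.zero_apply]
  by_cases hξ : ξ ∈ Metric.ball (0 : Rd d) r
  · simp only [indicator_of_mem hξ]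
    obtain ⟨k, hk⟩ : ∃ k, ξ k ≠ 0 := by
      by_contra! hcon
      exact h0 (by ext k; simpa using hcon k)
    have hk' : ((ξ k : ℝ) : ℂ) ≠ 0 := by exact_mod_cast hk
    refine (mul_eq_zero.1 ?_).resolve_left hk'
    rw [Finset.mul_sum]
    have e : ∀ l, (ξ k : ℂ) * inner ℂ (pressureSymbol ρ u v a b l ξ)
        ((𝓕 (toL2 fun x => v c x l) : Lp ℂ 2 (volume : Measure (Rd d))) ξ)
        = (starRingEnd ℂ) (pressureSymbol ρ u v a b k ξ) * ((ξ l : ℂ) *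
          (𝓕 (toL2 fun x => v c x l) : Lp ℂ 2 (volume : Measure (Rd d))) ξ) := by
      intro l
      have := congrArg (starRingEnd ℂ) (h1 k l)
      simp only [map_mul, Complex.conj_ofReal] at this
      rw [RCLike.inner_apply]
      linear_combination ((𝓕 (toL2 fun x => v c x l) : Lp ℂ 2 (volume : Measure (Rd d))) ξ) * this
    simp_rw [e]
    rw [← Finset.mul_sum, h2, mul_zero]
  · simp [indicator_of_notMem hξ]

theorem inner_lowPassForce (h : IsClassicalSolution d s T ρ u v p) (r : ℝ≥0) {τ : ℝ}
    (hτ : τ ∈ Icc 0 T) :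
    ∑ l, (inner ℂ (lowPassForce ρ u v r l τ) (lowPass r (𝓕 (toL2 fun x => v τ x l)))).re
      = lowPassPower ρ u v r τ := by
  refine Finset.sum_congr rfl fun l _ => ?_
  have hD := fun j => lowPassDeriv_fourier r (h.coeFn_fourierPartial_v j l hτ)
  rw [lowPassForce, inner_add_left, inner_add_left, inner_neg_left, sum_inner, sum_inner,
    ← inner_lowPass_comm, lowPass_lowPass, Complex.add_re, Complex.add_re, Complex.neg_re,
    Complex.re_sum, Complex.re_sum, ← Finset.sum_neg_distrib, ← Finset.sum_add_distrib]
  congr 1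
  refine Finset.sum_congr rfl fun j _ => ?_
  rw [inner_lowPassDeriv_lowPass, inner_lowPassDeriv_lowPass, hD j, Complex.neg_re, Complex.neg_re,
    neg_neg, sub_eq_add_neg, ← inner_lowPass_comm r (𝓕 (toL2 fun x => v τ x j * v τ x l))]
  congr 2
  exact inner_self_eq_norm_sq (𝕜 := ℂ) (lowPass r (fourierPartial j fun x => v τ x l))

/-- The energy balance of `v` in the frequencies `|ξ| < r`. -/
theorem lowPass_energy_balance (h : IsClassicalSolution d s T ρ u v p) (hd : 0 < d)
    (hT : 0 < T) (hs : 2 * (d / 2) + 1 ≤ s) (r : ℝ≥0) {a b : ℝ} (ha : 0 ≤ a) (hab : a ≤ b)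
    (hb : b ≤ T) :
    ∑ l, ‖lowPass r (𝓕 (toL2 fun x => v b x l))‖ ^ 2
        - ∑ l, ‖lowPass r (𝓕 (toL2 fun x => v a x l))‖ ^ 2
      = ∫ τ in a..b, 2 * lowPassPower ρ u v r τ := by
  rw [sum_norm_sq_sub_eq_integral (T := T)
    (y := fun l t => lowPass r (𝓕 (toL2 fun x => v t x l))) (g := lowPassForce ρ u v r)
    (fun l => (lowPass r).continuous.comp_continuousOn (continuousOn_fourier (h.path_v hs l)))
    (fun l => h.continuousOn_lowPassForce hs r l)
    (fun a b c ha hab hb hc => h.sum_inner_increment_eq_zero hd hT hs r ha hab hb hc) ha hab hb]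
  refine intervalIntegral.integral_congr fun τ hτ => ?_
  rw [uIcc_of_le hab] at hτ
  simp only
  rw [h.inner_lowPassForce r ⟨ha.trans hτ.1, hτ.2.trans hb⟩]

end IsClassicalSolution

end FrequencyCutoff

/-! ### The full energy balance of the fluid -/

section FullEnergyBalance

open FourierTransform LineDeriv

open scoped ContDiff

variable {d : ℕ}

theorem norm_lowPass_le (r : ℝ) (F : Lp ℂ 2 (volume : Measure (Rd d))) :
    ‖lowPass r F‖ ≤ ‖F‖ := by
  refine Lp.norm_le_norm_of_ae_le ?_
  filter_upwards [coeFn_lowPass r F] with ξ hξ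
  rw [hξ]
  exact norm_indicator_le_norm_self _ _

theorem norm_sub_lowPass_sq (r : ℝ) (F : Lp ℂ 2 (volume : Measure (Rd d))) :
    ‖F - lowPass r F‖ ^ 2 = ∫ ξ, (Metric.ball (0 : Rd d) r)ᶜ.indicator (fun ξ => ‖F ξ‖ ^ 2) ξ := by
  rw [norm_sq_eq_integral]
  refine integral_congr_ae ?_
  filter_upwards [coeFn_lowPass r F, Lp.coeFn_sub F (lowPass r F)] with ξ h1 h2
  rw [h2, Pi.sub_apply, h1]
  by_cases h : ξ ∈ Metric.ball (0 : Rd d) r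
  · have h' : ξ ∉ (Metric.ball (0 : Rd d) r)ᶜ := fun hc => hc h
    simp [indicator_of_mem h, indicator_of_notMem h']
  · have h' : ξ ∈ (Metric.ball (0 : Rd d) r)ᶜ := h
    simp [indicator_of_notMem h, indicator_of_mem h']

theorem tendsto_lowPass (F : Lp ℂ 2 (volume : Measure (Rd d))) :
    Filter.Tendsto (fun n : ℕ => lowPass ((n : ℝ≥0) : ℝ) F) Filter.atTop (nhds F) := by
  have hF : Integrable (fun ξ => ‖F ξ‖ ^ 2) :=
    (memLp_two_iff_integrable_sq_norm (Lp.memLp F).1).1 (Lp.memLp F)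
  have h0 : Filter.Tendsto (fun n : ℕ => ‖F - lowPass ((n : ℝ≥0) : ℝ) F‖ ^ 2) Filter.atTop
      (nhds 0) := by
    simp_rw [norm_sub_lowPass_sq]
    have := tendsto_integral_of_dominated_convergence (μ := (volume : Measure (Rd d)))
      (F := fun (n : ℕ) ξ => (Metric.ball (0 : Rd d) ((n : ℝ≥0) : ℝ))ᶜ.indicator
        (fun ξ => ‖F ξ‖ ^ 2) ξ) (f := fun _ => 0) (fun ξ => ‖F ξ‖ ^ 2)
      (fun n => hF.1.indicator Metric.isOpen_ball.measurableSet.compl) hF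
      (fun n => Filter.Eventually.of_forall fun ξ => by
        refine (norm_indicator_le_norm_self _ _).trans ?_
        simp)
      (Filter.Eventually.of_forall fun ξ => by
        refine tendsto_const_nhds.congr' ?_
        obtain ⟨N, hN⟩ := exists_nat_gt ‖ξ‖
        filter_upwards [Filter.eventually_ge_atTop N] with n hn
        rw [indicator_of_notMem]
        simp only [mem_compl_iff, mem_ball_zero_iff, not_not, NNReal.coe_natCast]
        exact hN.trans_le (by exact_mod_cast hn))
    simpa using this
  rw [tendsto_iff_norm_sub_tendsto_zero]
  have h1 := h0.sqrt
  simp only [Real.sqrt_sq (norm_nonneg _), Real.sqrt_zero] at h1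
  exact h1.congr fun n => norm_sub_rev _ _

theorem TemperedDistribution.IsRepresentedBy.ext {Λ Λ' : 𝓢'(Rd d, ℂ)} {F F' : Rd d → ℂ}
    (h : IsRepresentedBy Λ F) (h' : IsRepresentedBy Λ' F') (hF : F =ᵐ[volume] F') : Λ = Λ' := by
  ext φ
  rw [h.apply_eq, h'.apply_eq]
  refine integral_congr_ae ?_
  filter_upwards [hF] with ξ hξ
  rw [hξ]

/-- For a `C¹` function in `L²` with `2πi ξⱼ f̂ ∈ L²`, the classical derivative `∂ⱼ f` is the one
given by the Fourier transform. -/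
theorem pderiv_of_fourierPartial {f : Rd d → ℝ} (hf : ContDiff ℝ 1 f) (hf2 : MemLp f 2)
    {j : Fin d} (h : ∀ᵐ ξ, fourierPartial j f ξ = (2 * Real.pi * Complex.I) * ((ξ j : ℝ) *
      (𝓕 (toL2 f) : Lp ℂ 2 (volume : Measure (Rd d))) ξ)) :
    MemLp (pderiv j f) 2 ∧ 𝓕 (toL2 (pderiv j f)) = fourierPartial j f := by
  set G : Lp ℂ 2 (volume : Measure (Rd d)) := 𝓕⁻ (fourierPartial j f) with hG
  have hFG : 𝓕 G = fourierPartial j f := fourier_fourierInv_eq _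
  have hdist : ∂_{EuclideanSpace.single j (1 : ℝ)} (toL2 f : 𝓢'(Rd d, ℂ)) = (G : 𝓢'(Rd d, ℂ)) := by
    have h1 := (TemperedDistribution.IsRepresentedBy.fourier_of_Lp (toL2 f)).fourier_lineDerivOp
      (EuclideanSpace.single j (1 : ℝ))
    simp_rw [IsClassicalSolution.inner_single_one] at h1
    have h2 := TemperedDistribution.IsRepresentedBy.fourier_of_Lp G
    rw [hFG] at h2
    have h3 := h1.ext h2 (Filter.EventuallyEq.symm h)
    have hinv : ∀ Λ : 𝓢'(Rd d, ℂ), (𝓕⁻ (𝓕 Λ : 𝓢'(Rd d, ℂ)) : 𝓢'(Rd d, ℂ)) = Λ := fun Λ =>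
      fourierInv_fourier_eq Λ
    rw [← hinv (∂_{EuclideanSpace.single j (1 : ℝ)} (toL2 f : 𝓢'(Rd d, ℂ))), h3, hinv]
  have hae : (fun x => ((pderiv j f x : ℝ) : ℂ)) =ᵐ[volume] G := by
    have hloc : LocallyIntegrable (fun x => ((pderiv j f x : ℝ) : ℂ)) volume :=
      (Complex.continuous_ofReal.comp (continuous_pderiv hf)).locallyIntegrable
    refine ae_eq_of_integral_contDiff_smul_eq hloc
      ((Lp.memLp G).locallyIntegrable (by norm_num)) fun g hg hgc => ?_
    have hgc' : HasCompactSupport (fun x => (g x : ℂ)) := hgc.comp_left (g := Complex.ofReal) rfl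
    let ψ := hgc'.toSchwartzMap (Complex.ofRealCLM.contDiff.comp hg)
    have hψ : ∀ x, ψ x = g x := fun x => rfl
    have h1 := congrArg (fun Λ : 𝓢'(Rd d, ℂ) => Λ ψ) hdist
    rw [TemperedDistribution.lineDerivOp_apply_apply, map_neg,
      toL2_apply_schwartz hf2 (lineDerivOp_eq_pderiv (hg.differentiable (by simp)) hψ j),
      (TemperedDistribution.IsRepresentedBy.of_Lp G).apply_eq] at h1
    have h2 := integral_mul_pderiv_eq_neg (j := j) (hg.of_le (by simp)) hgc hf
    rw [← Complex.ofReal_neg, ← h2, ← integral_complex_ofReal] at h1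
    calc ∫ x, g x • ((pderiv j f x : ℝ) : ℂ) = ∫ x, ((g x * pderiv j f x : ℝ) : ℂ) := by
          simp
      _ = _ := h1
      _ = ∫ x, g x • G x := by simp_rw [hψ]; simp
  have hmem : MemLp (pderiv j f) 2 := by
    have := ((Lp.memLp G).ae_eq hae.symm).re
    simpa using this
  refine ⟨hmem, ?_⟩
  rw [toL2_eq_of_ae_eq hmem hae, hFG]

namespace IsClassicalSolution

variable {s : ℕ} {T : ℝ} {ρ : ℝ → Rd d → ℝ} {u v : ℝ → Rd d → Rd d} {p : ℝ → Rd d → ℝ}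

theorem memLp_pderiv_v (h : IsClassicalSolution d s T ρ u v p) (hs : 2 * (d / 2) + 1 ≤ s)
    (j l : Fin d) {t : ℝ} (ht : t ∈ Ioo 0 T) : MemLp (pderiv j fun x => v t x l) 2 :=
  (pderiv_of_fourierPartial (h.contDiff_v_slice ht l)
    ((h.path_v hs l).memLp t (Ioo_subset_Icc_self ht))
    (h.coeFn_fourierPartial_v j l (Ioo_subset_Icc_self ht))).1

theorem fourier_pderiv_v (h : IsClassicalSolution d s T ρ u v p) (hs : 2 * (d / 2) + 1 ≤ s)
    (j l : Fin d) {t : ℝ} (ht : t ∈ Ioo 0 T) :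
    fourierPartial j (fun x => v t x l) = 𝓕 (toL2 (pderiv j fun x => v t x l)) :=
  (pderiv_of_fourierPartial (h.contDiff_v_slice ht l)
    ((h.path_v hs l).memLp t (Ioo_subset_Icc_self ht))
    (h.coeFn_fourierPartial_v j l (Ioo_subset_Icc_self ht))).2.symm

theorem inner_fourier (F G : Lp ℂ 2 (volume : Measure (Rd d))) :
    inner ℂ (𝓕 F) (𝓕 G) = inner ℂ F G :=
  (Lp.fourierTransformₗᵢ (Rd d) ℂ).inner_map_map F G

theorem norm_fourier (F : Lp ℂ 2 (volume : Measure (Rd d))) :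
    ‖(𝓕 F : Lp ℂ 2 (volume : Measure (Rd d)))‖ = ‖F‖ :=
  (Lp.fourierTransformₗᵢ (Rd d) ℂ).norm_map F

/-- The convective term does no work on a divergence-free field. -/
theorem sum_integral_convection_eq_zero (h : IsClassicalSolution d s T ρ u v p)
    (hs : 2 * (d / 2) + 1 ≤ s) (l : Fin d) {t : ℝ} (ht : t ∈ Ioo 0 T) :
    ∑ j, ∫ x, (v t x j * v t x l) * pderiv j (fun x => v t x l) x = 0 := by
  have htI := Ioo_subset_Icc_self ht
  have hv := fun i => h.contDiff_v_slice ht i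
  have hvm := fun i => (h.path_v hs i).memLp t htI
  have hW := fun i j => (h.path_flux hs i j).memLp t htI
  have hD := fun i j => h.memLp_pderiv_v hs i j ht
  have hprod : ∀ j x, pderiv j (fun y => v t y j * v t y l) x
      = v t x j * pderiv j (fun y => v t y l) x + pderiv j (fun y => v t y j) x * v t x l :=
    fun j x => pderiv_mul ((hv j).differentiable one_ne_zero x)
      ((hv l).differentiable one_ne_zero x)
  have i1 : ∀ j, Integrable (fun x => (v t x j * v t x l) * pderiv j (fun x => v t x l) x) :=
    fun j => (hW j l).integrable_mul (hD j l)
  have i2 : ∀ j, Integrable (fun x => pderiv j (fun y => v t y j) x * (v t x l * v t x l)) :=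
    fun j => (hD j j).integrable_mul (hW l l)
  have hparts : ∀ j, ∫ x, (v t x j * v t x l) * pderiv j (fun x => v t x l) x
      = -(∫ x, (v t x j * v t x l) * pderiv j (fun x => v t x l) x)
        - ∫ x, pderiv j (fun y => v t y j) x * (v t x l * v t x l) := by
    intro j
    have e : ∀ x, pderiv j (fun y => v t y j * v t y l) x * v t x l
        = (v t x j * v t x l) * pderiv j (fun x => v t x l) x
          + pderiv j (fun y => v t y j) x * (v t x l * v t x l) := fun x => by
      rw [hprod j x]; ring
    have i3 : Integrable (fun x => pderiv j (fun y => v t y j * v t y l) x * v t x l) := by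
      simp_rw [e]
      exact (i1 j).add (i2 j)
    have key := integral_mul_fderiv_eq_neg_fderiv_mul_of_integrable (𝕜 := ℝ)
      (μ := (volume : Measure (Rd d))) (f := fun y => v t y j * v t y l)
      (g := fun y => v t y l) (v := EuclideanSpace.single j (1 : ℝ)) i3 (i1 j)
      ((hW j l).integrable_mul (hvm l)) (fun x _ => ((hv j).mul (hv l)).differentiable one_ne_zero x)
      (fun x _ => (hv l).differentiable one_ne_zero x)
    refine key.trans ?_
    change -∫ x, pderiv j (fun y => v t y j * v t y l) x * v t x l = _
    simp_rw [e]
    rw [integral_add (i1 j) (i2 j)]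
    ring
  have hdiv : ∑ j, ∫ x, pderiv j (fun y => v t y j) x * (v t x l * v t x l) = 0 := by
    rw [← integral_finsetSum _ fun j _ => i2 j]
    simp_rw [← Finset.sum_mul, h.incompressible_apply ht]
    simp
  have hsum := Finset.sum_congr (rfl : (Finset.univ : Finset (Fin d)) = Finset.univ)
    fun j _ => hparts j
  rw [Finset.sum_sub_distrib, Finset.sum_neg_distrib, hdiv] at hsum
  linarith

/-- Half the rate of change of `∫ |v|²`. -/
noncomputable def fluidPower (ρ : ℝ → Rd d → ℝ) (u v : ℝ → Rd d → Rd d) (τ : ℝ) : ℝ :=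
  ∑ l, ((∑ j, ((inner ℂ (𝓕 (toL2 fun x => v τ x j * v τ x l) : Lp ℂ 2 (volume : Measure (Rd d)))
      (fourierPartial j fun x => v τ x l)).re - ‖fourierPartial j fun x => v τ x l‖ ^ 2))
    + (inner ℂ (𝓕 (toL2 fun x => ρ τ x * (u τ x l - v τ x l)) :
      Lp ℂ 2 (volume : Measure (Rd d))) (𝓕 (toL2 fun x => v τ x l))).re)

theorem fluidPower_eq (h : IsClassicalSolution d s T ρ u v p) (hs : 2 * (d / 2) + 1 ≤ s)
    {t : ℝ} (ht : t ∈ Ioo 0 T) :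
    fluidPower ρ u v t = -(∑ l, ∑ j, ‖fourierPartial j fun x => v t x l‖ ^ 2)
      + ∑ l, ∫ x, (ρ t x * (u t x l - v t x l)) * v t x l := by
  have htI := Ioo_subset_Icc_self ht
  rw [← Finset.sum_neg_distrib, ← Finset.sum_add_distrib]
  refine Finset.sum_congr rfl fun l _ => ?_
  rw [inner_fourier, re_inner_toL2 ((h.path_drag hs l).memLp t htI) ((h.path_v hs l).memLp t htI)]
  congr 1
  have h1 : ∀ j, (inner ℂ (𝓕 (toL2 fun x => v t x j * v t x l) :
      Lp ℂ 2 (volume : Measure (Rd d))) (fourierPartial j fun x => v t x l)).re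
      = ∫ x, (v t x j * v t x l) * pderiv j (fun x => v t x l) x := fun j => by
    rw [h.fourier_pderiv_v hs j l ht, inner_fourier,
      re_inner_toL2 ((h.path_flux hs j l).memLp t htI) (h.memLp_pderiv_v hs j l ht)]
  simp_rw [h1]
  rw [Finset.sum_sub_distrib, h.sum_integral_convection_eq_zero hs l ht, zero_sub]

theorem continuousOn_lowPassPower (h : IsClassicalSolution d s T ρ u v p)
    (hs : 2 * (d / 2) + 1 ≤ s) (r : ℝ≥0) : ContinuousOn (lowPassPower ρ u v r) (Icc 0 T) := by
  have hD := h.continuousOn_fourierPartial_v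
  refine continuousOn_finsetSum _ fun l _ => (continuousOn_finsetSum _ fun j _ => ?_).add ?_
  · exact (Complex.continuous_re.comp_continuousOn (ContinuousOn.inner (𝕜 := ℂ)
      ((lowPass r).continuous.comp_continuousOn (continuousOn_fourier (h.path_flux hs j l)))
      (hD j l))).sub (((lowPass r).continuous.comp_continuousOn (hD j l)).norm.pow 2)
  · exact Complex.continuous_re.comp_continuousOn (ContinuousOn.inner (𝕜 := ℂ)
      ((lowPass r).continuous.comp_continuousOn (continuousOn_fourier (h.path_drag hs l)))
      (continuousOn_fourier (h.path_v hs l)))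

/-- The energy balance of `v`, as the limit of the balances in the frequencies `|ξ| < n`. -/
theorem energy_balance_v (h : IsClassicalSolution d s T ρ u v p) (hd : 0 < d)
    (hT : 0 < T) (hs : 2 * (d / 2) + 1 ≤ s) {a b : ℝ} (ha : 0 ≤ a) (hab : a ≤ b) (hb : b ≤ T) :
    ∑ l, ‖toL2 fun x => v b x l‖ ^ 2 - ∑ l, ‖toL2 fun x => v a x l‖ ^ 2
      = ∫ τ in a..b, 2 * fluidPower ρ u v τ := by
  have hsub : uIcc a b ⊆ Icc 0 T := by rw [uIcc_of_le hab]; exact Icc_subset_Icc ha hb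
  have hD := h.continuousOn_fourierPartial_v
  have hleft : Filter.Tendsto (fun n : ℕ =>
      ∑ l, ‖lowPass ((n : ℝ≥0) : ℝ) (𝓕 (toL2 fun x => v b x l))‖ ^ 2
        - ∑ l, ‖lowPass ((n : ℝ≥0) : ℝ) (𝓕 (toL2 fun x => v a x l))‖ ^ 2) Filter.atTop
      (nhds (∑ l, ‖toL2 fun x => v b x l‖ ^ 2 - ∑ l, ‖toL2 fun x => v a x l‖ ^ 2)) := by
    refine (tendsto_finsetSum _ fun l _ => ?_).sub (tendsto_finsetSum _ fun l _ => ?_)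
    · rw [← norm_fourier]
      exact (tendsto_lowPass _).norm.pow 2
    · rw [← norm_fourier]
      exact (tendsto_lowPass _).norm.pow 2
  let B : ℝ → ℝ := fun τ => ∑ l, ((∑ j, (‖(𝓕 (toL2 fun x => v τ x j * v τ x l) :
      Lp ℂ 2 (volume : Measure (Rd d)))‖ * ‖fourierPartial j fun x => v τ x l‖
        + ‖fourierPartial j fun x => v τ x l‖ ^ 2))
    + ‖(𝓕 (toL2 fun x => ρ τ x * (u τ x l - v τ x l)) : Lp ℂ 2 (volume : Measure (Rd d)))‖
      * ‖(𝓕 (toL2 fun x => v τ x l) : Lp ℂ 2 (volume : Measure (Rd d)))‖)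
  have hBc : ContinuousOn B (Icc 0 T) :=
    continuousOn_finsetSum _ fun l _ => (continuousOn_finsetSum _ fun j _ =>
      ((continuousOn_fourier (h.path_flux hs j l)).norm.mul (hD j l).norm).add
        ((hD j l).norm.pow 2)).add
      ((continuousOn_fourier (h.path_drag hs l)).norm.mul (continuousOn_fourier (h.path_v hs l)).norm)
  have hinner : ∀ (r : ℝ) (F G : Lp ℂ 2 (volume : Measure (Rd d))),
      |(inner ℂ (lowPass r F) G).re| ≤ ‖F‖ * ‖G‖ := fun r F G => by
    have h1 : |(inner ℂ (lowPass r F) G).re| ≤ ‖inner ℂ (lowPass r F) G‖ := Complex.abs_re_le_norm _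
    have h2 : ‖inner ℂ (lowPass r F) G‖ ≤ ‖lowPass r F‖ * ‖G‖ := norm_inner_le_norm _ _
    have h3 := norm_lowPass_le r F
    exact h1.trans (h2.trans (by gcongr))
  have hbound : ∀ (r : ℝ≥0) τ, |lowPassPower ρ u v r τ| ≤ B τ := by
    intro r τ
    refine (Finset.abs_sum_le_sum_abs _ _).trans (Finset.sum_le_sum fun l _ => ?_)
    refine (abs_add_le _ _).trans (add_le_add ?_ (hinner _ _ _))
    refine (Finset.abs_sum_le_sum_abs _ _).trans (Finset.sum_le_sum fun j _ => ?_)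
    refine (abs_sub _ _).trans (add_le_add (hinner _ _ _) ?_)
    rw [abs_of_nonneg (by positivity)]
    have := norm_lowPass_le r (fourierPartial j fun x => v τ x l)
    gcongr
  have hright : Filter.Tendsto (fun n : ℕ => ∫ τ in a..b, 2 * lowPassPower ρ u v n τ) Filter.atTop
      (nhds (∫ τ in a..b, 2 * fluidPower ρ u v τ)) := by
    refine intervalIntegral.tendsto_integral_filter_of_dominated_convergence (fun τ => 2 * B τ)
      (Filter.Eventually.of_forall fun n => ?_) (Filter.Eventually.of_forall fun n =>
        Filter.Eventually.of_forall fun τ _ => ?_) ?_ (Filter.Eventually.of_forall fun τ _ => ?_)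
    · exact ((continuousOn_const.mul (h.continuousOn_lowPassPower hs n)).mono
        (uIoc_subset_uIcc.trans hsub)).aestronglyMeasurable measurableSet_uIoc
    · rw [Real.norm_eq_abs, abs_mul, abs_two]
      have := hbound n τ
      gcongr
    · exact ((continuousOn_const.mul hBc).mono hsub).intervalIntegrable
    · refine Filter.Tendsto.const_mul 2 (tendsto_finsetSum _ fun l _ =>
        (tendsto_finsetSum _ fun j _ => ?_).add ?_)
      · exact ((Complex.continuous_re.tendsto _).comp
          ((tendsto_lowPass _).inner tendsto_const_nhds)).sub ((tendsto_lowPass _).norm.pow 2)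
      · exact (Complex.continuous_re.tendsto _).comp
          ((tendsto_lowPass _).inner tendsto_const_nhds)
  refine tendsto_nhds_unique hleft (hright.congr fun n => ?_)
  exact (h.lowPass_energy_balance hd hT hs n ha hab hb).symm

end IsClassicalSolution

end FullEnergyBalance

/-! ### The growth of the low frequencies -/

section LowFrequencies

open FourierTransform

variable {d : ℕ}

/-- If `N' ≤ 2 h √N` then `√N` grows at most at the rate `h`. -/
theorem sqrt_le_of_deriv_le_mul_sqrt {T : ℝ} {N S g : ℝ → ℝ} (hN : ContinuousOn N (Icc 0 T))
    (hS : ContinuousOn S (Icc 0 T)) (hg : ContinuousOn g (Icc 0 T))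
    (hN0 : ∀ t ∈ Icc 0 T, 0 ≤ N t) (hg0 : ∀ t ∈ Icc 0 T, 0 ≤ g t)
    (hNS : ∀ t ∈ Icc 0 T, N t - N 0 = ∫ τ in (0)..t, 2 * S τ)
    (hle : ∀ t ∈ Icc 0 T, S t ≤ g t * √(N t)) {t : ℝ} (ht : t ∈ Icc 0 T) :
    √(N t) ≤ √(N 0) + ∫ τ in (0)..t, g τ := by
  have h0 : (0 : ℝ) ∈ Icc 0 T := ⟨le_rfl, ht.1.trans ht.2⟩
  have hprim : ∀ {f : ℝ → ℝ}, ContinuousOn f (Icc 0 T) → ∀ x ∈ Ioo 0 T,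
      HasDerivAt (fun x => ∫ τ in (0)..x, f τ) (f x) x := fun {f} hf x hx =>
    intervalIntegral.integral_hasDerivAt_right
      (hf.mono (uIcc_subset_Icc h0 (Ioo_subset_Icc_self hx))).intervalIntegrable
      ((hf.mono Ioo_subset_Icc_self).stronglyMeasurableAtFilter isOpen_Ioo x hx)
      (hf.continuousAt (Icc_mem_nhds hx.1 hx.2))
  have hprimc : ContinuousOn (fun x => ∫ τ in (0)..x, g τ) (Icc 0 T) := by
    have := intervalIntegral.continuousOn_primitive_interval' (μ := volume)
      (hg.mono (uIcc_subset_Icc h0 (right_mem_Icc.2 h0.2))).intervalIntegrable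
      (left_mem_uIcc (a := (0 : ℝ)) (b := T))
    rwa [uIcc_of_le h0.2] at this
  have hNd : ∀ x ∈ Ioo 0 T, HasDerivAt N (2 * S x) x := by
    intro x hx
    refine ((hprim (continuousOn_const.mul hS) x hx).add_const (N 0)).congr_of_eventuallyEq ?_
    filter_upwards [Icc_mem_nhds hx.1 hx.2] with y hy
    change N y = (∫ τ in (0)..y, 2 * S τ) + N 0
    rw [← hNS y hy]
    ring
  refine le_of_forall_pos_le_add fun η hη => ?_
  have hpos : ∀ x ∈ Icc 0 T, 0 < N x + η ^ 2 := fun x hx =>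
    add_pos_of_nonneg_of_pos (hN0 x hx) (by positivity)
  have hderiv : ∀ x ∈ Ioo 0 T, HasDerivAt (fun x => √(N x + η ^ 2) - ∫ τ in (0)..x, g τ)
      (2 * S x / (2 * √(N x + η ^ 2)) - g x) x := fun x hx =>
    (((hNd x hx).add_const _).sqrt (hpos x (Ioo_subset_Icc_self hx)).ne').sub (hprim hg x hx)
  have hanti : AntitoneOn (fun x => √(N x + η ^ 2) - ∫ τ in (0)..x, g τ) (Icc 0 T) := by
    refine antitoneOn_of_deriv_nonpos (convex_Icc 0 T)
      ((hN.add continuousOn_const).sqrt.sub hprimc) ?_ ?_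
    · rw [interior_Icc]
      exact fun x hx => (hderiv x hx).differentiableAt.differentiableWithinAt
    · rw [interior_Icc]
      intro x hx
      have hxI := Ioo_subset_Icc_self hx
      have hsp := Real.sqrt_pos.2 (hpos x hxI)
      rw [(hderiv x hx).deriv, sub_nonpos, mul_div_mul_left _ _ two_ne_zero, div_le_iff₀ hsp]
      refine (hle x hxI).trans (mul_le_mul_of_nonneg_left ?_ (hg0 x hxI))
      exact Real.sqrt_le_sqrt (by nlinarith)
  have h1 := hanti h0 ht ht.1
  simp only [intervalIntegral.integral_same, sub_zero] at h1
  have h2 : √(N t) ≤ √(N t + η ^ 2) := Real.sqrt_le_sqrt (by nlinarith)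
  have h3 : √(N 0 + η ^ 2) ≤ √(N 0) + η := by
    refine Real.sqrt_le_iff.2 ⟨by positivity, ?_⟩
    nlinarith [Real.sq_sqrt (hN0 0 h0), Real.sqrt_nonneg (N 0)]
  linarith

theorem norm_fourier_toL2_le {f : Rd d → ℝ} (hf : MemLp f 2) (hf1 : Integrable f) :
    ∀ᵐ ξ, ‖(𝓕 (toL2 f) : Lp ℂ 2 (volume : Measure (Rd d))) ξ‖ ≤ ∫ x, |f x| := by
  have h1 : Integrable (toL2 f) := hf1.ofReal.congr (coeFn_toL2 hf).symm
  have h2 : ∫ x, ‖toL2 f x‖ = ∫ x, |f x| := by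
    refine integral_congr_ae ?_
    filter_upwards [coeFn_toL2 hf] with x hx
    rw [hx, Complex.norm_real, Real.norm_eq_abs]
  rw [← h2]
  exact Lp.norm_fourier_le_integral _ h1

theorem norm_lowPass_sq (r : ℝ) (F : Lp ℂ 2 (volume : Measure (Rd d))) :
    ‖lowPass r F‖ ^ 2 = ∫ ξ, (Metric.ball (0 : Rd d) r).indicator (fun ξ => ‖F ξ‖ ^ 2) ξ := by
  rw [norm_sq_eq_integral]
  refine integral_congr_ae ?_
  filter_upwards [coeFn_lowPass r F] with ξ h1
  rw [h1]
  by_cases h : ξ ∈ Metric.ball (0 : Rd d) r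
  · simp [indicator_of_mem h]
  · simp [indicator_of_notMem h]

theorem norm_lowPass_le_of_bound (r : ℝ) {F : Lp ℂ 2 (volume : Measure (Rd d))} {A : ℝ}
    (hA0 : 0 ≤ A) (hA : ∀ᵐ ξ, ‖F ξ‖ ≤ A) :
    ‖lowPass r F‖ ≤ A * √(volume.real (Metric.ball (0 : Rd d) r)) := by
  refine abs_le_of_sq_le_sq' ?_ (by positivity) |>.2
  rw [norm_lowPass_sq, mul_pow, Real.sq_sqrt measureReal_nonneg,
    integral_indicator Metric.isOpen_ball.measurableSet]
  have hF : Integrable (fun ξ => ‖F ξ‖ ^ 2) :=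
    (memLp_two_iff_integrable_sq_norm (Lp.memLp F).1).1 (Lp.memLp F)
  have hfin : volume (Metric.ball (0 : Rd d) r) ≠ ∞ := measure_ball_lt_top.ne
  calc ∫ ξ in Metric.ball (0 : Rd d) r, ‖F ξ‖ ^ 2
      ≤ ∫ _ in Metric.ball (0 : Rd d) r, A ^ 2 := by
        refine integral_mono_ae hF.integrableOn (integrableOn_const hfin) ?_
        refine ae_restrict_of_ae ?_
        filter_upwards [hA] with ξ hξ
        gcongr
    _ = _ := by rw [setIntegral_const, smul_eq_mul, mul_comm]

theorem abs_re_inner_lowPass_le (r : ℝ) {F : Lp ℂ 2 (volume : Measure (Rd d))} {A : ℝ}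
    (hA0 : 0 ≤ A) (hA : ∀ᵐ ξ, ‖F ξ‖ ≤ A) (G : Lp ℂ 2 (volume : Measure (Rd d))) :
    |(inner ℂ (lowPass r F) G).re|
      ≤ A * √(volume.real (Metric.ball (0 : Rd d) r)) * ‖lowPass r G‖ := by
  rw [← lowPass_lowPass, inner_lowPass_comm]
  refine (Complex.abs_re_le_norm _).trans ((norm_inner_le_norm _ _).trans ?_)
  have := norm_lowPass_le_of_bound r hA0 hA
  gcongr

theorem norm_lowPassDeriv_le (r : ℝ≥0) (j : Fin d) (F : Lp ℂ 2 (volume : Measure (Rd d))) :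
    ‖lowPassDeriv r j F‖ ≤ 2 * Real.pi * r * ‖lowPass r F‖ := by
  refine Lp.norm_le_mul_norm_of_ae_le_mul ?_
  filter_upwards [coeFn_lowPassDeriv r j F, coeFn_lowPass r F] with ξ h1 h2
  rw [h1, h2]
  by_cases h : ξ ∈ Metric.ball (0 : Rd d) r
  · rw [indicator_of_mem h, indicator_of_mem h, norm_mul, norm_two_pi_I, norm_mul,
      Complex.norm_real, Real.norm_eq_abs, ← mul_assoc]
    rw [mem_ball_zero_iff] at h
    have := abs_coord_le ξ j
    gcongr
    linarith
  · simp [indicator_of_notMem h]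

/-- The frequencies `|ξ| ≥ r` are controlled by the gradient. -/
theorem norm_sq_le_lowPass_add {r : ℝ≥0} (hr : 0 < r) {f : Rd d → ℝ}
    (h : ∀ j, ∀ᵐ ξ, fourierPartial j f ξ = (2 * Real.pi * Complex.I) * ((ξ j : ℝ) *
      (𝓕 (toL2 f) : Lp ℂ 2 (volume : Measure (Rd d))) ξ)) :
    ‖toL2 f‖ ^ 2 ≤ ‖lowPass r (𝓕 (toL2 f))‖ ^ 2
      + (∑ j, ‖fourierPartial j f‖ ^ 2) * ((r : ℝ) ^ 2)⁻¹ := by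
  have hint : ∀ F : Lp ℂ 2 (volume : Measure (Rd d)), Integrable (fun ξ => ‖F ξ‖ ^ 2) := fun F =>
    (memLp_two_iff_integrable_sq_norm (Lp.memLp F).1).1 (Lp.memLp F)
  rw [← IsClassicalSolution.norm_fourier, norm_sq_eq_integral, norm_lowPass_sq,
    Finset.sum_mul]
  simp_rw [norm_sq_eq_integral, ← integral_mul_const]
  rw [← integral_finsetSum _ fun j _ => (hint _).mul_const _, ← integral_add
    ((hint _).indicator Metric.isOpen_ball.measurableSet)
    (integrable_finsetSum _ fun j _ => (hint _).mul_const _)]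
  refine integral_mono_ae (hint _) (((hint _).indicator Metric.isOpen_ball.measurableSet).add
    (integrable_finsetSum _ fun j _ => (hint _).mul_const _)) ?_
  filter_upwards [ae_all_iff.2 h] with ξ hξ
  have hsum : 0 ≤ ∑ j, ‖fourierPartial j f ξ‖ ^ 2 * ((r : ℝ) ^ 2)⁻¹ :=
    Finset.sum_nonneg fun j _ => by positivity
  by_cases hb : ξ ∈ Metric.ball (0 : Rd d) r
  · rw [indicator_of_mem hb]
    linarith
  · rw [indicator_of_notMem hb, zero_add]
    have hrξ : (r : ℝ) ≤ ‖ξ‖ := by simpa using hb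
    have e : ∀ j, ‖fourierPartial j f ξ‖ ^ 2 * ((r : ℝ) ^ 2)⁻¹
        = (ξ j) ^ 2 * ((2 * Real.pi) ^ 2 * ((r : ℝ) ^ 2)⁻¹ *
          ‖(𝓕 (toL2 f) : Lp ℂ 2 (volume : Measure (Rd d))) ξ‖ ^ 2) := fun j => by
      rw [hξ j, norm_mul, norm_two_pi_I, norm_mul, Complex.norm_real, Real.norm_eq_abs,
        ← sq_abs (ξ j)]
      ring
    simp_rw [e]
    rw [← Finset.sum_mul, ← EuclideanSpace.real_norm_sq_eq, ← mul_assoc]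
    refine le_mul_of_one_le_left (by positivity) ?_
    have h1 : 1 ≤ ‖ξ‖ ^ 2 * ((r : ℝ) ^ 2)⁻¹ := by
      rw [← div_eq_mul_inv, one_le_div (by positivity)]
      gcongr
    have h2 : (1 : ℝ) ≤ (2 * Real.pi) ^ 2 := by nlinarith [Real.pi_gt_three]
    nlinarith

namespace IsClassicalSolution

variable {s : ℕ} {T : ℝ} {ρ : ℝ → Rd d → ℝ} {u v : ℝ → Rd d → Rd d} {p : ℝ → Rd d → ℝ}

/-- `∑ᵢ ∫ vᵢ²`. -/
noncomputable def fluidSq (v : ℝ → Rd d → Rd d) (t : ℝ) : ℝ := ∑ l, ‖toL2 fun x => v t x l‖ ^ 2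

/-- `∫ |∇v|²`, expressed through the Fourier transform. -/
noncomputable def gradSq (v : ℝ → Rd d → Rd d) (t : ℝ) : ℝ :=
  ∑ l, ∑ j, ‖fourierPartial j fun x => v t x l‖ ^ 2

/-- `∑ᵢ ∫ ρ (uᵢ - vᵢ)²`. -/
noncomputable def dragSq (ρ : ℝ → Rd d → ℝ) (u v : ℝ → Rd d → Rd d) (t : ℝ) : ℝ :=
  ∑ l, ∫ x, (ρ t x * (u t x l - v t x l)) * (u t x l - v t x l)

theorem fluidSq_nonneg (v : ℝ → Rd d → Rd d) (t : ℝ) : 0 ≤ fluidSq v t :=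
  Finset.sum_nonneg fun _ _ => sq_nonneg _

theorem gradSq_nonneg (v : ℝ → Rd d → Rd d) (t : ℝ) : 0 ≤ gradSq v t :=
  Finset.sum_nonneg fun _ _ => Finset.sum_nonneg fun _ _ => sq_nonneg _

theorem integral_drag_nonneg (h : IsClassicalSolution d s T ρ u v p) {t : ℝ} (ht : t ∈ Icc 0 T)
    (l : Fin d) : 0 ≤ ∫ x, (ρ t x * (u t x l - v t x l)) * (u t x l - v t x l) :=
  integral_nonneg fun x => by
    have := h.density_nonneg t ht x
    rw [mul_assoc]
    exact mul_nonneg this (mul_self_nonneg _)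

theorem dragSq_nonneg (h : IsClassicalSolution d s T ρ u v p) {t : ℝ} (ht : t ∈ Icc 0 T) :
    0 ≤ dragSq ρ u v t :=
  Finset.sum_nonneg fun l _ => h.integral_drag_nonneg ht l

theorem continuousOn_fluidSq (h : IsClassicalSolution d s T ρ u v p)
    (hs : 2 * (d / 2) + 1 ≤ s) : ContinuousOn (fluidSq v) (Icc 0 T) :=
  continuousOn_finsetSum _ fun l _ => (h.path_v hs l).continuousOn.norm.pow 2

theorem continuousOn_gradSq (h : IsClassicalSolution d s T ρ u v p) :
    ContinuousOn (gradSq v) (Icc 0 T) :=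
  continuousOn_finsetSum _ fun l _ => continuousOn_finsetSum _ fun j _ =>
    (h.continuousOn_fourierPartial_v j l).norm.pow 2

theorem continuousOn_dragSq (h : IsClassicalSolution d s T ρ u v p)
    (hs : 2 * (d / 2) + 1 ≤ s) : ContinuousOn (dragSq ρ u v) (Icc 0 T) :=
  continuousOn_finsetSum _ fun l _ =>
    (h.path_drag hs l).continuousOn_integral_mul ((h.path_u hs l).sub (h.path_v hs l))

theorem integral_abs_flux_le (h : IsClassicalSolution d s T ρ u v p)
    (hs : 2 * (d / 2) + 1 ≤ s) (j l : Fin d) {t : ℝ} (ht : t ∈ Icc 0 T) :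
    ∫ x, |v t x j * v t x l| ≤ fluidSq v t := by
  have hsq : ∀ i, Integrable (fun x => v t x i ^ 2) := fun i =>
    ((h.path_v hs i).memLp t ht).integrable_sq
  have h1 : ∀ i, ‖toL2 fun x => v t x i‖ ^ 2 ≤ fluidSq v t := fun i =>
    Finset.single_le_sum (f := fun l => ‖toL2 fun x => v t x l‖ ^ 2) (fun _ _ => sq_nonneg _)
      (Finset.mem_univ i)
  have h2 : ∫ x, |v t x j * v t x l| ≤ ∫ x, (1 / 2 * v t x j ^ 2 + 1 / 2 * v t x l ^ 2) := by
    refine integral_mono ((h.path_v hs j).integrable_mul (h.path_v hs l) ht).abs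
      (((hsq j).const_mul _).add ((hsq l).const_mul _)) fun x => ?_
    simp only
    rw [abs_mul, ← sq_abs (v t x j), ← sq_abs (v t x l)]
    nlinarith [sq_nonneg (|v t x j| - |v t x l|)]
  rw [integral_add ((hsq j).const_mul _) ((hsq l).const_mul _), integral_const_mul,
    integral_const_mul, ← norm_sq_toL2 ((h.path_v hs j).memLp t ht),
    ← norm_sq_toL2 ((h.path_v hs l).memLp t ht)] at h2
  linarith [h1 j, h1 l]

/-- The total drag force is controlled by the mass and the dissipation. -/
theorem integral_abs_drag_le (h : IsClassicalSolution d s T ρ u v p)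
    (hs : 2 * (d / 2) + 1 ≤ s) (hρ0 : Integrable (ρ 0)) (l : Fin d) {t : ℝ} (ht : t ∈ Icc 0 T) :
    Integrable (fun x => ρ t x * (u t x l - v t x l)) ∧
      ∫ x, |ρ t x * (u t x l - v t x l)| ≤ √(∫ x, ρ 0 x) * √(dragSq ρ u v t) := by
  obtain ⟨hi, hM⟩ := h.mass_le hs hρ0 ht
  have hρn := h.density_nonneg t ht
  have hD1 : Integrable (fun x => (ρ t x * (u t x l - v t x l)) * (u t x l - v t x l)) :=
    (h.path_drag hs l).integrable_mul ((h.path_u hs l).sub (h.path_v hs l)) ht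
  have hd1 : Integrable (fun x => ρ t x * (u t x l - v t x l)) :=
    (h.path_density hs).integrable_mul ((h.path_u hs l).sub (h.path_v hs l)) ht
  refine ⟨hd1, ?_⟩
  have e1 : ∀ x, √(ρ t x) ^ 2 = ρ t x := fun x => Real.sq_sqrt (hρn x)
  have e2 : ∀ x, (√(ρ t x) * |u t x l - v t x l|) ^ 2
      = (ρ t x * (u t x l - v t x l)) * (u t x l - v t x l) := fun x => by
    rw [mul_pow, e1, sq_abs]; ring
  have e3 : ∀ x, √(ρ t x) * (√(ρ t x) * |u t x l - v t x l|)
      = |ρ t x * (u t x l - v t x l)| := fun x => by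
    rw [← mul_assoc, Real.mul_self_sqrt (hρn x), abs_mul, abs_of_nonneg (hρn x)]
  have hcs := sq_integral_mul_le (μ := (volume : Measure (Rd d))) (f := fun x => √(ρ t x))
    (g := fun x => √(ρ t x) * |u t x l - v t x l|) (by simpa only [e1] using hi)
    (by simpa only [e2] using hD1) (by simpa only [e3] using hd1.abs)
  simp only [e1, e2, e3] at hcs
  rw [← Real.sqrt_mul' _ (h.dragSq_nonneg ht)]
  refine Real.le_sqrt_of_sq_le (hcs.trans ?_)
  have h1 : ∫ x, (ρ t x * (u t x l - v t x l)) * (u t x l - v t x l) ≤ dragSq ρ u v t :=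
    Finset.single_le_sum
      (f := fun l => ∫ x, (ρ t x * (u t x l - v t x l)) * (u t x l - v t x l))
      (fun l _ => h.integral_drag_nonneg ht l) (Finset.mem_univ l)
  exact mul_le_mul hM h1 (h.integral_drag_nonneg ht l)
    ((integral_nonneg hρn).trans hM)

/-- `∑ₗ ∫_{|ξ| < r} |v̂ₗ|²`. -/
noncomputable def lowPassSq (v : ℝ → Rd d → Rd d) (r : ℝ≥0) (t : ℝ) : ℝ :=
  ∑ l, ‖lowPass r (𝓕 (toL2 fun x => v t x l))‖ ^ 2

theorem norm_lowPass_le_sqrt (v : ℝ → Rd d → Rd d) (r : ℝ≥0) (t : ℝ) (l : Fin d) :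
    ‖lowPass r (𝓕 (toL2 fun x => v t x l))‖ ≤ √(lowPassSq v r t) :=
  Real.le_sqrt_of_sq_le (Finset.single_le_sum
    (f := fun l => ‖lowPass r (𝓕 (toL2 fun x => v t x l))‖ ^ 2) (fun _ _ => sq_nonneg _)
    (Finset.mem_univ l))

/-- The fluxes and the drag are bounded in `L¹`, so their Fourier transforms are bounded, and over the
frequencies `|ξ| < r` the Cauchy–Schwarz inequality leaves the square root of the volume. -/
theorem lowPassPower_le (h : IsClassicalSolution d s T ρ u v p)
    (hs : 2 * (d / 2) + 1 ≤ s) (hρ0 : Integrable (ρ 0)) (r : ℝ≥0) {t : ℝ} (ht : t ∈ Icc 0 T) :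
    lowPassPower ρ u v r t
      ≤ (√(volume.real (Metric.ball (0 : Rd d) r)) * (d * (d * (2 * Real.pi * r * fluidSq v t)
        + √(∫ x, ρ 0 x) * √(dragSq ρ u v t)))) * √(lowPassSq v r t) := by
  set ω := √(volume.real (Metric.ball (0 : Rd d) r)) with hω
  set n := √(lowPassSq v r t) with hn
  have hf0 := fluidSq_nonneg v t
  have hW : ∀ j l, (inner ℂ (lowPass r (𝓕 (toL2 fun x => v t x j * v t x l)))
      (fourierPartial j fun x => v t x l)).re
        - ‖lowPass r (fourierPartial j fun x => v t x l)‖ ^ 2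
      ≤ ω * (2 * Real.pi * r * fluidSq v t) * n := by
    intro j l
    have h1 := abs_re_inner_lowPass_le r (integral_nonneg fun x => abs_nonneg _)
      (norm_fourier_toL2_le ((h.path_flux hs j l).memLp t ht)
        ((h.path_v hs j).integrable_mul (h.path_v hs l) ht)) (fourierPartial j fun x => v t x l)
    have h2 : ‖lowPass r (fourierPartial j fun x => v t x l)‖ ≤ 2 * Real.pi * r * n := by
      rw [← lowPassDeriv_fourier r (h.coeFn_fourierPartial_v j l ht)]
      refine (norm_lowPassDeriv_le r j _).trans ?_
      have := norm_lowPass_le_sqrt v r t l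
      gcongr
    have h3 := h.integral_abs_flux_le hs j l ht
    calc _ ≤ |(inner ℂ (lowPass r (𝓕 (toL2 fun x => v t x j * v t x l)))
          (fourierPartial j fun x => v t x l)).re| :=
          (sub_le_self _ (sq_nonneg _)).trans (le_abs_self _)
      _ ≤ fluidSq v t * ω * (2 * Real.pi * r * n) := h1.trans (by gcongr)
      _ = _ := by ring
  have hH : ∀ l, (inner ℂ (lowPass r (𝓕 (toL2 fun x => ρ t x * (u t x l - v t x l))))
      (𝓕 (toL2 fun x => v t x l))).re ≤ ω * (√(∫ x, ρ 0 x) * √(dragSq ρ u v t)) * n := by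
    intro l
    obtain ⟨hi, h3⟩ := h.integral_abs_drag_le hs hρ0 l ht
    have h1 := abs_re_inner_lowPass_le r (integral_nonneg fun x => abs_nonneg _)
      (norm_fourier_toL2_le ((h.path_drag hs l).memLp t ht) hi) (𝓕 (toL2 fun x => v t x l))
    have h2 := norm_lowPass_le_sqrt v r t l
    calc _ ≤ _ := (le_abs_self _).trans h1
      _ ≤ (√(∫ x, ρ 0 x) * √(dragSq ρ u v t)) * ω * n := by gcongr
      _ = _ := by ring
  calc lowPassPower ρ u v r t
      ≤ ∑ _l : Fin d, ((∑ _j : Fin d, ω * (2 * Real.pi * r * fluidSq v t) * n)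
        + ω * (√(∫ x, ρ 0 x) * √(dragSq ρ u v t)) * n) :=
        Finset.sum_le_sum fun l _ => add_le_add (Finset.sum_le_sum fun j _ => hW j l) (hH l)
    _ = _ := by
        simp only [Finset.sum_const, Finset.card_univ, Fintype.card_fin, nsmul_eq_mul]
        ring

theorem lowPassSq_zero_le (h : IsClassicalSolution d s T ρ u v p) (hT : 0 ≤ T)
    (hs : 2 * (d / 2) + 1 ≤ s) (hv0 : Integrable (v 0)) (r : ℝ≥0) :
    √(lowPassSq v r 0)
      ≤ √(volume.real (Metric.ball (0 : Rd d) r)) * (d * ∫ x, ‖v 0 x‖) := by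
  set ω := √(volume.real (Metric.ball (0 : Rd d) r)) with hω
  have hm : 0 ≤ ∫ x, ‖v 0 x‖ := integral_nonneg fun x => norm_nonneg _
  have h1 : ∀ l, ‖lowPass r (𝓕 (toL2 fun x => v 0 x l))‖ ≤ ω * ∫ x, ‖v 0 x‖ := by
    intro l
    have hi : Integrable (fun x => v 0 x l) := (EuclideanSpace.proj (𝕜 := ℝ) l).integrable_comp hv0
    have h2 := norm_lowPass_le_of_bound r (integral_nonneg fun x => abs_nonneg _)
      (norm_fourier_toL2_le ((h.path_v hs l).memLp 0 ⟨le_rfl, hT⟩) hi)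
    have h3 : ∫ x, |v 0 x l| ≤ ∫ x, ‖v 0 x‖ :=
      integral_mono hi.abs hv0.norm fun x => abs_coord_le _ _
    refine h2.trans ?_
    rw [mul_comm]
    gcongr
  refine Real.sqrt_le_iff.2 ⟨by positivity, ?_⟩
  calc lowPassSq v r 0 ≤ ∑ _l : Fin d, (ω * ∫ x, ‖v 0 x‖) ^ 2 :=
        Finset.sum_le_sum fun l _ => by
          have := h1 l
          gcongr
    _ = d * (ω * ∫ x, ‖v 0 x‖) ^ 2 := by simp
    _ ≤ (d : ℝ) ^ 2 * (ω * ∫ x, ‖v 0 x‖) ^ 2 := by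
        have : (d : ℝ) ≤ (d : ℝ) ^ 2 := by exact_mod_cast Nat.le_self_pow two_ne_zero d
        gcongr
    _ = _ := by ring

/-- The growth of the low-frequency part of `v`. -/
theorem sqrt_lowPassSq_le (h : IsClassicalSolution d s T ρ u v p) (hd : 0 < d) (hT : 0 < T)
    (hs : 2 * (d / 2) + 1 ≤ s) (hρ0 : Integrable (ρ 0)) (hv0 : Integrable (v 0)) (r : ℝ≥0)
    {t : ℝ} (ht : t ∈ Icc 0 T) :
    √(lowPassSq v r t) ≤ √(volume.real (Metric.ball (0 : Rd d) r)) * (d * ((∫ x, ‖v 0 x‖)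
      + ∫ τ in (0)..t, (d * (2 * Real.pi * r * fluidSq v τ)
        + √(∫ x, ρ 0 x) * √(dragSq ρ u v τ)))) := by
  set ω := √(volume.real (Metric.ball (0 : Rd d) r)) with hω
  have hgc : ContinuousOn (fun t => ω * (d * (d * (2 * Real.pi * r * fluidSq v t)
      + √(∫ x, ρ 0 x) * √(dragSq ρ u v t)))) (Icc 0 T) :=
    continuousOn_const.mul (continuousOn_const.mul ((continuousOn_const.mul
      (continuousOn_const.mul (h.continuousOn_fluidSq hs))).add
      (continuousOn_const.mul (h.continuousOn_dragSq hs).sqrt)))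
  have key := sqrt_le_of_deriv_le_mul_sqrt (N := lowPassSq v r) (S := lowPassPower ρ u v r)
    (continuousOn_finsetSum _ fun l _ => ((lowPass r).continuous.comp_continuousOn
      (continuousOn_fourier (h.path_v hs l))).norm.pow 2)
    (h.continuousOn_lowPassPower hs r) hgc
    (fun t _ => Finset.sum_nonneg fun _ _ => sq_nonneg _)
    (fun t _ => by have := fluidSq_nonneg v t; positivity)
    (fun t ht => h.lowPass_energy_balance hd hT hs r le_rfl ht.1 ht.2)
    (fun t ht => h.lowPassPower_le hs hρ0 r ht) ht
  rw [intervalIntegral.integral_const_mul, intervalIntegral.integral_const_mul] at key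
  have h0 := h.lowPassSq_zero_le hT.le hs hv0 r
  calc _ ≤ _ := key
    _ ≤ ω * (d * ∫ x, ‖v 0 x‖) + _ := by gcongr
    _ = _ := by ring

end IsClassicalSolution

end LowFrequencies

/-! ### Fourier splitting for the coupled system -/

section Decay

variable {d : ℕ}

theorem le_on_Icc_of_le_on_Ioo {T : ℝ} (hT : 0 < T) {f g : ℝ → ℝ} (hf : ContinuousOn f (Icc 0 T))
    (hg : ContinuousOn g (Icc 0 T)) (h : ∀ t ∈ Ioo 0 T, f t ≤ g t) : ∀ t ∈ Icc 0 T, f t ≤ g t :=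
  fun t ht => ContinuousWithinAt.closure_le (s := Ioo 0 T) (by rwa [closure_Ioo hT.ne])
    ((hf t ht).mono Ioo_subset_Icc_self) ((hg t ht).mono Ioo_subset_Icc_self) h

namespace IsClassicalSolution

variable {s : ℕ} {T : ℝ} {ρ : ℝ → Rd d → ℝ} {u v : ℝ → Rd d → Rd d} {p : ℝ → Rd d → ℝ}

/-- The essential bound on `ρ` holds everywhere on `(0, T)`, since `ρ` is continuous there. -/
theorem density_le (h : IsClassicalSolution d s T ρ u v p) {K : ℝ≥0}
    (hK : eLpNorm (fun z : Rd d × ℝ => ρ z.2 z.1) ∞ (volume.prod (volume.restrict (Ioo 0 T))) ≤ K)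
    {t : ℝ} (ht : t ∈ Ioo 0 T) (x : Rd d) : ρ t x ≤ K := by
  by_contra! hcon
  have hae : ∀ᵐ z : Rd d × ℝ ∂(volume.prod (volume.restrict (Ioo 0 T))),
      ‖ρ z.2 z.1‖ₑ ≤ K := by
    rw [eLpNorm_exponent_top] at hK
    filter_upwards [ae_le_eLpNormEssSup (f := fun z : Rd d × ℝ => ρ z.2 z.1)
      (μ := volume.prod (volume.restrict (Ioo 0 T)))] with z hz
    exact hz.trans hK
  have hopen : IsOpen {z : Rd d × ℝ | z.2 ∈ Ioo 0 T ∧ (K : ℝ) < ρ z.2 z.1} := by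
    have hc : ContinuousOn (fun z : Rd d × ℝ => ρ z.2 z.1) (univ ×ˢ Ioo 0 T) :=
      h.contDiff_density.continuousOn.comp continuous_swap.continuousOn
        fun z hz => ⟨hz.2, mem_univ _⟩
    have := hc.isOpen_inter_preimage (isOpen_univ.prod isOpen_Ioo) (isOpen_Ioi (a := (K : ℝ)))
    convert this using 1
    ext z
    simp
  have hpos := hopen.measure_pos (volume.prod volume) ⟨(x, t), ht, hcon⟩
  have hprod : (volume : Measure (Rd d)).prod (volume.restrict (Ioo (0 : ℝ) T))
      = (volume.prod volume).restrict (univ ×ˢ Ioo 0 T) := by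
    rw [← Measure.prod_restrict, Measure.restrict_univ]
  rw [hprod, ae_restrict_iff' (MeasurableSet.univ.prod measurableSet_Ioo)] at hae
  refine hpos.ne' (measure_mono_null (fun z hz => ?_) (ae_iff.1 hae))
  simp only [mem_ofPred_eq, not_forall]
  refine ⟨⟨mem_univ _, hz.1⟩, ?_⟩
  rw [not_le, enorm_eq_nnnorm, ENNReal.coe_lt_coe, ← NNReal.coe_lt_coe, coe_nnnorm]
  exact hz.2.trans_le (Real.le_norm_self _)

/-- `∑ᵢ ∫ ρ uᵢ²`. -/
noncomputable def momentumSq (ρ : ℝ → Rd d → ℝ) (u : ℝ → Rd d → Rd d) (t : ℝ) : ℝ :=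
  ∑ i, ∫ x, ρ t x * u t x i * u t x i

theorem path_momentum (h : IsClassicalSolution d s T ρ u v p) (hs : 2 * (d / 2) + 1 ≤ s)
    (i : Fin d) : BoundedL2Path T (fun t x => ρ t x * u t x i) :=
  (h.path_density hs).mul (h.path_u hs i)

theorem momentumSq_nonneg (h : IsClassicalSolution d s T ρ u v p) {t : ℝ} (ht : t ∈ Icc 0 T) :
    0 ≤ momentumSq ρ u t :=
  Finset.sum_nonneg fun i _ => integral_nonneg fun x => by
    have := h.density_nonneg t ht x
    rw [mul_assoc]
    exact mul_nonneg this (mul_self_nonneg _)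

theorem continuousOn_momentumSq (h : IsClassicalSolution d s T ρ u v p)
    (hs : 2 * (d / 2) + 1 ≤ s) : ContinuousOn (momentumSq ρ u) (Icc 0 T) :=
  continuousOn_finsetSum _ fun i _ => (h.path_momentum hs i).continuousOn_integral_mul (h.path_u hs i)

theorem energy_eq (h : IsClassicalSolution d s T ρ u v p) (hs : 2 * (d / 2) + 1 ≤ s) {t : ℝ}
    (ht : t ∈ Icc 0 T) : energy ρ u v t = momentumSq ρ u t + 1 / 2 * fluidSq v t := by
  rw [energy, momentumSq, fluidSq]
  congr 1
  · rw [← integral_finsetSum _ fun i _ => (h.path_momentum hs i).integrable_mul (h.path_u hs i) ht]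
    refine integral_congr_ae (Filter.Eventually.of_forall fun x => ?_)
    simp only
    rw [EuclideanSpace.real_norm_sq_eq, Finset.mul_sum]
    exact Finset.sum_congr rfl fun i _ => by ring
  · simp_rw [norm_sq_toL2 ((h.path_v hs _).memLp t ht)]
    rw [← integral_finsetSum _ fun i _ => ((h.path_v hs i).memLp t ht).integrable_sq]
    simp_rw [EuclideanSpace.real_norm_sq_eq]

/-- The endpoints are excluded because the pointwise derivatives in `dissipation` are only known to
be the weak ones at interior times. -/
theorem dissipation_eq (h : IsClassicalSolution d s T ρ u v p) (hs : 2 * (d / 2) + 1 ≤ s) {t : ℝ}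
    (ht : t ∈ Ioo 0 T) : dissipation ρ u v t = gradSq v t + dragSq ρ u v t := by
  have htI := Ioo_subset_Icc_self ht
  have hv : ContDiff ℝ 1 (v t) := contDiff_slice h.contDiff_v ht
  have hD : ∀ j l, Integrable (fun x => pderiv j (fun y => v t y l) x ^ 2) := fun j l =>
    (h.memLp_pderiv_v hs j l ht).integrable_sq
  rw [dissipation, gradSq, dragSq]
  congr 1
  · have e : ∀ l j, ‖fourierPartial j fun x => v t x l‖ ^ 2
        = ∫ x, pderiv j (fun y => v t y l) x ^ 2 := fun l j => by
      rw [h.fourier_pderiv_v hs j l ht, norm_fourier, norm_sq_toL2 (h.memLp_pderiv_v hs j l ht)]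
    simp_rw [e]
    rw [Finset.sum_comm]
    simp_rw [← integral_finsetSum (μ := (volume : Measure (Rd d))) Finset.univ
      (fun (l : Fin d) _ => hD _ l)]
    rw [← integral_finsetSum _ fun j _ => integrable_finsetSum _ fun l _ => hD j l]
    refine integral_congr_ae (Filter.Eventually.of_forall fun x => ?_)
    refine Finset.sum_congr rfl fun j _ => ?_
    rw [EuclideanSpace.real_norm_sq_eq]
    exact Finset.sum_congr rfl fun l _ => by rw [pderiv_apply (hv.differentiable one_ne_zero x)]
  · rw [← integral_finsetSum _ fun l _ =>
      (h.path_drag hs l).integrable_mul ((h.path_u hs l).sub (h.path_v hs l)) htI]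
    refine integral_congr_ae (Filter.Eventually.of_forall fun x => ?_)
    simp only
    rw [EuclideanSpace.real_norm_sq_eq, Finset.mul_sum]
    exact Finset.sum_congr rfl fun l _ => by rw [PiLp.sub_apply]; ring

/-- The drag exchanges energy between the two phases and dissipates `∫ ρ|u - v|²` of it. Kinetic
energy carries the factor `½` in both phases here, unlike in `energy`. -/
theorem energy_balance (h : IsClassicalSolution d s T ρ u v p) (hd : 0 < d) (hT : 0 < T)
    (hs : 2 * (d / 2) + 1 ≤ s) {t : ℝ} (ht : t ∈ Icc 0 T) :
    1 / 2 * momentumSq ρ u t + 1 / 2 * fluidSq v t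
      = 1 / 2 * momentumSq ρ u 0 + 1 / 2 * fluidSq v 0
        - ∫ τ in (0)..t, (gradSq v τ + dragSq ρ u v τ) := by
  have hsub : uIcc 0 t ⊆ Icc 0 T := by rw [uIcc_of_le ht.1]; exact Icc_subset_Icc le_rfl ht.2
  have hmom : momentumSq ρ u t - momentumSq ρ u 0 = ∫ τ in (0)..t,
      (-2 * ∑ i, ∫ x, (ρ τ x * (u τ x i - v τ x i)) * u τ x i) := by
    have hc : ∀ i, ContinuousOn (fun τ => ∫ x, -2 * (ρ τ x * (u τ x i - v τ x i) * u τ x i))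
        (Icc 0 T) := fun i => by
      simp_rw [integral_const_mul]
      exact continuousOn_const.mul ((h.path_drag hs i).continuousOn_integral_mul (h.path_u hs i))
    rw [momentumSq, momentumSq, ← Finset.sum_sub_distrib,
      Finset.sum_congr rfl fun i _ => h.momentum_sq_integral hs i le_rfl ht.1 ht.2,
      ← intervalIntegral.integral_finsetSum fun i _ => ((hc i).mono hsub).intervalIntegrable]
    simp_rw [integral_const_mul, Finset.mul_sum]
  have hflu : fluidSq v t - fluidSq v 0 = ∫ τ in (0)..t, 2 * (-gradSq v τ
      + ∑ l, ∫ x, (ρ τ x * (u τ x l - v τ x l)) * v τ x l) := by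
    refine (h.energy_balance_v hd hT hs le_rfl ht.1 ht.2).trans
      (intervalIntegral.integral_congr_uIoo fun τ hτ => ?_)
    rw [uIoo_of_le ht.1] at hτ
    simp only
    rw [h.fluidPower_eq hs ⟨hτ.1, hτ.2.trans_le ht.2⟩]
    rfl
  have hcg := h.continuousOn_gradSq
  have hcu : ContinuousOn (fun τ => ∑ i, ∫ x, (ρ τ x * (u τ x i - v τ x i)) * u τ x i) (Icc 0 T) :=
    continuousOn_finsetSum _ fun i _ =>
      (h.path_drag hs i).continuousOn_integral_mul (h.path_u hs i)
  have hcv : ContinuousOn (fun τ => ∑ i, ∫ x, (ρ τ x * (u τ x i - v τ x i)) * v τ x i) (Icc 0 T) :=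
    continuousOn_finsetSum _ fun i _ =>
      (h.path_drag hs i).continuousOn_integral_mul (h.path_v hs i)
  have hsum : (momentumSq ρ u t - momentumSq ρ u 0) + (fluidSq v t - fluidSq v 0)
      = ∫ τ in (0)..t, -2 * (gradSq v τ + dragSq ρ u v τ) := by
    have i1 : IntervalIntegrable
        (fun τ => -2 * ∑ i, ∫ x, (ρ τ x * (u τ x i - v τ x i)) * u τ x i) volume 0 t :=
      ((continuousOn_const.mul hcu).mono hsub).intervalIntegrable
    have i2 : IntervalIntegrable (fun τ => 2 * (-gradSq v τ
        + ∑ l, ∫ x, (ρ τ x * (u τ x l - v τ x l)) * v τ x l)) volume 0 t :=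
      ((continuousOn_const.mul (hcg.neg.add hcv)).mono hsub).intervalIntegrable
    rw [hmom, hflu, ← intervalIntegral.integral_add i1 i2]
    refine intervalIntegral.integral_congr fun τ hτ => ?_
    have hτ' := hsub hτ
    have hdr : dragSq ρ u v τ = (∑ i, ∫ x, (ρ τ x * (u τ x i - v τ x i)) * u τ x i)
        - ∑ i, ∫ x, (ρ τ x * (u τ x i - v τ x i)) * v τ x i := by
      rw [dragSq, ← Finset.sum_sub_distrib]
      refine Finset.sum_congr rfl fun i _ => ?_
      rw [← integral_sub ((h.path_drag hs i).integrable_mul (h.path_u hs i) hτ')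
        ((h.path_drag hs i).integrable_mul (h.path_v hs i) hτ')]
      simp_rw [mul_sub]
    simp only
    rw [hdr]
    ring
  rw [intervalIntegral.integral_const_mul] at hsum
  linarith

/-- The velocity `u` carries no diffusion: its energy is controlled by that of `v` and the drag. -/
theorem momentumSq_le (h : IsClassicalSolution d s T ρ u v p) (hT : 0 < T)
    (hs : 2 * (d / 2) + 1 ≤ s) {K : ℝ≥0}
    (hK : eLpNorm (fun z : Rd d × ℝ => ρ z.2 z.1) ∞ (volume.prod (volume.restrict (Ioo 0 T))) ≤ K)
    {t : ℝ} (ht : t ∈ Icc 0 T) :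
    momentumSq ρ u t ≤ 2 * dragSq ρ u v t + 2 * K * fluidSq v t := by
  refine le_on_Icc_of_le_on_Ioo hT (h.continuousOn_momentumSq hs)
    ((continuousOn_const.mul (h.continuousOn_dragSq hs)).add
      (continuousOn_const.mul (h.continuousOn_fluidSq hs))) (fun t ht => ?_) t ht
  have htI := Ioo_subset_Icc_self ht
  change momentumSq ρ u t ≤ 2 * dragSq ρ u v t + 2 * K * fluidSq v t
  rw [momentumSq, dragSq, fluidSq, Finset.mul_sum, Finset.mul_sum, ← Finset.sum_add_distrib]
  refine Finset.sum_le_sum fun i _ => ?_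
  have i1 := (h.path_drag hs i).integrable_mul ((h.path_u hs i).sub (h.path_v hs i)) htI
  have i2 := ((h.path_v hs i).memLp t htI).integrable_sq
  rw [norm_sq_toL2 ((h.path_v hs i).memLp t htI), ← integral_const_mul, ← integral_const_mul,
    ← integral_add (i1.const_mul _) (i2.const_mul _)]
  refine integral_mono ((h.path_momentum hs i).integrable_mul (h.path_u hs i) htI)
    ((i1.const_mul _).add (i2.const_mul _)) fun x => ?_
  have h1 := h.density_nonneg t htI x
  have h2 := h.density_le hK ht x
  simp only
  have h3 : ρ t x * v t x i ^ 2 ≤ K * v t x i ^ 2 := by gcongr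
  -- `u² ≤ 2 (u - v)² + 2 v²`
  have h4 : 0 ≤ ρ t x * (u t x i - 2 * v t x i) ^ 2 := by positivity
  nlinarith

/-- `ω₁ d² (1 + 4πd² + √M)²`, with `ω₁` the volume of the unit ball. -/
noncomputable def lowFrequencyConst (d : ℕ) (M : ℝ) : ℝ :=
  volume.real (Metric.ball (0 : Rd d) 1) * (d * (1 + (4 * Real.pi * d + √M))) ^ 2

/-- The low frequencies of `v`, with the volume of the ball of radius `√σ` made explicit. -/
theorem lowPassSq_le (h : IsClassicalSolution d s T ρ u v p) (hd : 0 < d) (hT : 0 < T)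
    (hs : 2 * (d / 2) + 1 ≤ s) (hρ0 : Integrable (ρ 0)) (hv0 : Integrable (v 0)) {M : ℝ}
    (hM : ∫ x, ρ 0 x ≤ M) {t : ℝ} (ht : t ∈ Icc 0 T) {σ : ℝ} (hσ : 0 < σ)
    {r : ℝ≥0} (hrσ : (r : ℝ) = √σ) :
    lowPassSq v r t ≤ lowFrequencyConst d M * (σ ^ ((d : ℝ) / 2) *
      ((∫ x, ‖v 0 x‖) + ∫ τ in (0)..t, (√σ * (1 / 2 * momentumSq ρ u τ + 1 / 2 * fluidSq v τ)
        + √(gradSq v τ + dragSq ρ u v τ))) ^ 2) := by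
  set c : ℝ := 4 * Real.pi * d + √M with hc
  have hc0 : 0 ≤ c := by positivity
  set m := ∫ x, ‖v 0 x‖ with hm
  have hm0 : 0 ≤ m := integral_nonneg fun x => norm_nonneg _
  have hsub : uIcc 0 t ⊆ Icc 0 T := by rw [uIcc_of_le ht.1]; exact Icc_subset_Icc le_rfl ht.2
  set I := ∫ τ in (0)..t, (√σ * (1 / 2 * momentumSq ρ u τ + 1 / 2 * fluidSq v τ)
        + √(gradSq v τ + dragSq ρ u v τ)) with hI
  have hcI : ContinuousOn (fun τ => √σ * (1 / 2 * momentumSq ρ u τ + 1 / 2 * fluidSq v τ)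
        + √(gradSq v τ + dragSq ρ u v τ)) (Icc 0 T) :=
    (continuousOn_const.mul ((continuousOn_const.mul (h.continuousOn_momentumSq hs)).add
      (continuousOn_const.mul (h.continuousOn_fluidSq hs)))).add
      (h.continuousOn_gradSq.add (h.continuousOn_dragSq hs)).sqrt
  have hI0 : 0 ≤ I := intervalIntegral.integral_nonneg ht.1 fun τ hτ => by
    have h1 := h.momentumSq_nonneg ⟨hτ.1, hτ.2.trans ht.2⟩
    have h2 := fluidSq_nonneg v τ
    positivity
  have hJ : ∫ τ in (0)..t, (d * (2 * Real.pi * r * fluidSq v τ)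
      + √(∫ x, ρ 0 x) * √(dragSq ρ u v τ)) ≤ c * I := by
    rw [hI, ← intervalIntegral.integral_const_mul]
    refine intervalIntegral.integral_mono_on ht.1
      (((continuousOn_const.mul (continuousOn_const.mul (h.continuousOn_fluidSq hs))).add
        (continuousOn_const.mul (h.continuousOn_dragSq hs).sqrt)).mono hsub).intervalIntegrable
      ((continuousOn_const.mul hcI).mono hsub).intervalIntegrable fun τ hτ => ?_
    have h1 := h.momentumSq_nonneg ⟨hτ.1, hτ.2.trans ht.2⟩
    have h2 := fluidSq_nonneg v τ
    have h3 : √(dragSq ρ u v τ) ≤ √(gradSq v τ + dragSq ρ u v τ) :=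
      Real.sqrt_le_sqrt (by have := gradSq_nonneg v τ; linarith)
    have h4 : √(∫ x, ρ 0 x) ≤ √M := Real.sqrt_le_sqrt hM
    have h5 : (0 : ℝ) ≤ 4 * Real.pi * d := by positivity
    have h6 : 4 * Real.pi * d ≤ c := by rw [hc]; linarith [Real.sqrt_nonneg M]
    have h7 : √M ≤ c := by rw [hc]; linarith
    rw [hrσ]
    calc d * (2 * Real.pi * √σ * fluidSq v τ) + √(∫ x, ρ 0 x) * √(dragSq ρ u v τ)
        ≤ 4 * Real.pi * d * (√σ * (1 / 2 * momentumSq ρ u τ + 1 / 2 * fluidSq v τ))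
          + √M * √(gradSq v τ + dragSq ρ u v τ) := by
          refine add_le_add ?_ (by gcongr)
          have : 0 ≤ 4 * Real.pi * d * (√σ * (1 / 2 * momentumSq ρ u τ)) := by positivity
          linarith
      _ ≤ c * (√σ * (1 / 2 * momentumSq ρ u τ + 1 / 2 * fluidSq v τ))
          + c * √(gradSq v τ + dragSq ρ u v τ) := by gcongr
      _ = _ := by ring
  have hvol : volume.real (Metric.ball (0 : Rd d) r)
      = σ ^ ((d : ℝ) / 2) * volume.real (Metric.ball (0 : Rd d) 1) := by
    rw [measureReal_def, Measure.addHaar_ball_of_pos volume _ (hrσ ▸ Real.sqrt_pos.2 hσ),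
      finrank_euclideanSpace, Fintype.card_fin, ENNReal.toReal_mul,
      ENNReal.toReal_ofReal (by positivity), measureReal_def, hrσ,
      Real.sqrt_eq_rpow, ← Real.rpow_natCast, ← Real.rpow_mul hσ.le]
    congr 2
    ring
  have hNn : 0 ≤ lowPassSq v r t := Finset.sum_nonneg fun _ _ => sq_nonneg _
  calc lowPassSq v r t = √(lowPassSq v r t) ^ 2 := (Real.sq_sqrt hNn).symm
    _ ≤ (√(volume.real (Metric.ball (0 : Rd d) r)) * (d * (m + c * I))) ^ 2 := by
        have := h.sqrt_lowPassSq_le hd hT hs hρ0 hv0 r ht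
        refine pow_le_pow_left₀ (Real.sqrt_nonneg _) (this.trans ?_) 2
        gcongr
    _ ≤ (√(volume.real (Metric.ball (0 : Rd d) r)) * (d * ((1 + c) * (m + I)))) ^ 2 := by
        have : m + c * I ≤ (1 + c) * (m + I) := by nlinarith [mul_nonneg hc0 hm0]
        gcongr
    _ = _ := by
        rw [mul_pow, Real.sq_sqrt measureReal_nonneg, hvol, lowFrequencyConst]
        ring

/-- The two balances of the system in the form in which they enter the decay argument. -/
theorem fourierSplitting (h : IsClassicalSolution d s T ρ u v p) (hd : 0 < d) (hT : 0 < T)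
    (hs : 2 * (d / 2) + 1 ≤ s) (hρ0 : Integrable (ρ 0)) (hv0 : Integrable (v 0)) {K : ℝ≥0}
    (hK : eLpNorm (fun z : Rd d × ℝ => ρ z.2 z.1) ∞ (volume.prod (volume.restrict (Ioo 0 T))) ≤ K)
    {M R : ℝ} (hM : ∫ x, ρ 0 x ≤ M) (hR : energy ρ u v 0 + (∫ x, ‖v 0 x‖) ^ 2 ≤ R) :
    FourierSplitting ((d : ℝ) / 2) ((3 / 2 + K) * (1 + lowFrequencyConst d M)) R T
      (energy ρ u v 0 + (∫ x, ‖v 0 x‖) ^ 2) (∫ x, ‖v 0 x‖)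
      (fun t => 1 / 2 * momentumSq ρ u t + 1 / 2 * fluidSq v t)
      (fun t => gradSq v t + dragSq ρ u v t) where
  continuousOn_energy := (continuousOn_const.mul (h.continuousOn_momentumSq hs)).add
    (continuousOn_const.mul (h.continuousOn_fluidSq hs))
  continuousOn_dissipation := h.continuousOn_gradSq.add (h.continuousOn_dragSq hs)
  energy_nonneg t ht := by
    have h1 := h.momentumSq_nonneg ht
    have h2 := fluidSq_nonneg v t
    positivity
  dissipation_nonneg t ht := add_nonneg (gradSq_nonneg v t) (h.dragSq_nonneg ht)
  balance t ht := h.energy_balance hd hT hs ht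
  m_sq_le := by
    have h0 : (0 : ℝ) ∈ Icc 0 T := ⟨le_rfl, hT.le⟩
    rw [h.energy_eq hs h0]
    linarith [h.momentumSq_nonneg h0, fluidSq_nonneg v 0]
  le_R := hR
  energy_zero_le := by
    have h0 : (0 : ℝ) ∈ Icc 0 T := ⟨le_rfl, hT.le⟩
    rw [h.energy_eq hs h0]
    linarith [h.momentumSq_nonneg h0, sq_nonneg (∫ x, ‖v 0 x‖)]
  splitting t ht σ hσ := by
    have h1 := h.momentumSq_le hT hs hK ht
    obtain ⟨r, hrσ⟩ : ∃ r : ℝ≥0, (r : ℝ) = √σ := ⟨⟨√σ, Real.sqrt_nonneg σ⟩, rfl⟩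
    have hr : 0 < r := by rw [← NNReal.coe_pos, hrσ]; exact Real.sqrt_pos.2 hσ
    have h2 := h.lowPassSq_le hd hT hs hρ0 hv0 hM ht hσ hrσ
    have h3 : fluidSq v t ≤ lowPassSq v r t + gradSq v t * σ⁻¹ := by
      unfold fluidSq lowPassSq gradSq
      rw [Finset.sum_mul, ← Finset.sum_add_distrib]
      refine Finset.sum_le_sum fun l _ => ?_
      have := norm_sq_le_lowPass_add hr fun j => h.coeFn_fourierPartial_v j l ht
      rwa [hrσ, Real.sq_sqrt hσ.le, ← hrσ] at this
    set Y := σ ^ ((d : ℝ) / 2) * ((∫ x, ‖v 0 x‖) + ∫ τ in (0)..t,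
      (√σ * (1 / 2 * momentumSq ρ u τ + 1 / 2 * fluidSq v τ)
        + √(gradSq v τ + dragSq ρ u v τ))) ^ 2 with hY
    have hY0 : 0 ≤ Y := by positivity
    have hA : 0 ≤ lowFrequencyConst d M :=
      mul_nonneg measureReal_nonneg (sq_nonneg _)
    have hg := gradSq_nonneg v t
    have hdr := h.dragSq_nonneg ht
    have hσ' : 0 < σ⁻¹ := inv_pos.2 hσ
    set A := lowFrequencyConst d M
    set G := gradSq v t
    set D := dragSq ρ u v t
    calc 1 / 2 * momentumSq ρ u t + 1 / 2 * fluidSq v t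
        ≤ D + (1 / 2 + K) * fluidSq v t := by linarith
      _ ≤ D + (1 / 2 + K) * (A * Y + G * σ⁻¹) := by
          have : fluidSq v t ≤ A * Y + G * σ⁻¹ := h3.trans (by linarith)
          gcongr
      _ ≤ (3 / 2 + K) * ((G + D) + (A * Y + (G + D) * σ⁻¹)) := by
          have hK0 : (0 : ℝ) ≤ K := K.2
          have e1 : 0 ≤ D * σ⁻¹ := by positivity
          have e2 : 0 ≤ G * σ⁻¹ := by positivity
          have e3 : 0 ≤ A * Y := by positivity
          nlinarith [mul_nonneg hK0 hg, mul_nonneg hK0 hdr, mul_nonneg hK0 e1]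
      _ ≤ (3 / 2 + K) * ((1 + A) * ((1 + σ⁻¹) * (G + D) + Y)) := by
          have e1 : 0 ≤ A * ((1 + σ⁻¹) * (G + D)) := by positivity
          have : (G + D) + (A * Y + (G + D) * σ⁻¹) ≤ (1 + A) * ((1 + σ⁻¹) * (G + D) + Y) := by
            nlinarith
          gcongr
      _ = _ := by ring

end IsClassicalSolution

end Decay

theorem propositionP3p1 (d : ℕ) (hd : 3 ≤ d) (α : ℝ) (hα : α ∈ Ioo (0 : ℝ) ((d : ℝ) / 2))
    (K : ℝ≥0) (M R : ℝ) :
    ∃ C : ℝ, 0 < C ∧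
      ∀ (s : ℕ), 2 * (d / 2) + 1 ≤ s →
      ∀ (T : ℝ), 0 < T →
      ∀ (ρ : ℝ → Rd d → ℝ) (u v : ℝ → Rd d → Rd d) (p : ℝ → Rd d → ℝ),
        IsClassicalSolution d s T ρ u v p →
        Integrable (ρ 0) → Integrable (v 0) →
        eLpNorm (fun z : Rd d × ℝ => ρ z.2 z.1) ∞ (volume.prod (volume.restrict (Ioo 0 T))) ≤ K →
        ∫ x, ρ 0 x ≤ M →
        energy ρ u v 0 + (∫ x, ‖v 0 x‖) ^ 2 ≤ R →
        ∀ t ∈ Icc 0 T,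
          IntervalIntegrable (fun τ => (1 + τ) ^ α * dissipation ρ u v τ) volume 0 t ∧
          energy ρ u v t * (1 + t) ^ α + ∫ τ in (0)..t, (1 + τ) ^ α * dissipation ρ u v τ
            ≤ C * (energy ρ u v 0 + (∫ x, ‖v 0 x‖) ^ 2) := by
  have hd' : (3 : ℝ) ≤ d := by exact_mod_cast hd
  have hκ : 0 < (3 / 2 + (K : ℝ)) * (1 + IsClassicalSolution.lowFrequencyConst d M) := by
    have h1 : 0 ≤ IsClassicalSolution.lowFrequencyConst d M :=
      mul_nonneg measureReal_nonneg (sq_nonneg _)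
    positivity
  obtain ⟨C, hC, hdecay⟩ := FourierSplitting.decay (δ := (d : ℝ) / 2) (α := α) (R := max R 0)
    (by linarith) hκ (le_max_right _ _) hα.1 hα.2
  refine ⟨2 * C, by positivity, fun s hs T hT ρ u v p h hρ0 hv0 hK hM hR t ht => ?_⟩
  have hsplit := h.fourierSplitting (by omega) hT hs hρ0 hv0 hK hM (hR.trans (le_max_left R 0))
  have hmain := hdecay hsplit t ht
  have hsub : uIcc 0 t ⊆ Icc 0 T := by rw [uIcc_of_le ht.1]; exact Icc_subset_Icc le_rfl ht.2
  -- the continuous dissipation agrees with `dissipation` off the endpoints of `[0, T]`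
  have hcongr : EqOn (fun τ => (1 + τ) ^ α *
      (IsClassicalSolution.gradSq v τ + IsClassicalSolution.dragSq ρ u v τ))
      (fun τ => (1 + τ) ^ α * dissipation ρ u v τ) (uIoo 0 t) := by
    intro τ hτ
    rw [uIoo_of_le ht.1] at hτ
    simp only
    rw [h.dissipation_eq hs ⟨hτ.1, hτ.2.trans_le ht.2⟩]
  have hpow : ContinuousOn (fun τ : ℝ => (1 + τ) ^ α) (Icc 0 T) := fun τ hτ =>
    (ContinuousAt.rpow_const (by fun_prop) (Or.inl (by linarith [hτ.1]))).continuousWithinAt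
  have hii : IntervalIntegrable (fun τ => (1 + τ) ^ α *
      (IsClassicalSolution.gradSq v τ + IsClassicalSolution.dragSq ρ u v τ)) volume 0 t :=
    ((hpow.mul (h.continuousOn_gradSq.add (h.continuousOn_dragSq hs))).mono hsub).intervalIntegrable
  refine ⟨hii.congr_uIoo hcongr, ?_⟩
  rw [← intervalIntegral.integral_congr_uIoo hcongr, h.energy_eq hs ht]
  have hint : 0 ≤ ∫ τ in (0)..t, (1 + τ) ^ α *
      (IsClassicalSolution.gradSq v τ + IsClassicalSolution.dragSq ρ u v τ) :=
    intervalIntegral.integral_nonneg ht.1 fun τ hτ => by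
      have h1 : 0 ≤ 1 + τ := by linarith [hτ.1]
      have h2 := hsplit.dissipation_nonneg τ ⟨hτ.1, hτ.2.trans ht.2⟩
      positivity
  have hp : 0 ≤ (1 + t) ^ α := Real.rpow_nonneg (by linarith [ht.1]) _
  have hfl := mul_nonneg hp (IsClassicalSolution.fluidSq_nonneg v t)
  -- `energy` is at most twice the energy that decays in `hmain`
  nlinarith
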